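/- **Setting.** Let $\mathbf k$ be a differential field of characteristic $0$ with one derivation $\delta$, let $\mathbf k\{Y\}=\mathbf k\{y_1,\dots,y_n\}$ be the ring of ordinary differential polynomials, and fix a ranking (a total order on the derivatives $y_i^{(j)}$ with $u\le\delta u$, and $u\le v\Rightarrow\delta u\le\delta v$). For $f\notin\mathbf k$ let $\operatorname{ld}f=y_i^{(j)}$ be the highest derivative in $f$ (the leader), $\operatorname{lv}f=y_i$, $\operatorname{rk}f=(\operatorname{ld}f)^{d}$ with $d=\deg_{\operatorname{ld}f}f$ (ranks are compared lexicographically, elements of $\mathbf k$ have the lowest rank), $\mathbf i_f$ the coefficient of $(\operatorname{ld}f)^d$ in $f$ and $\mathbf s_f=\partial f/\partial\operatorname{ld}f$; $H_A$ is the set of all $\mathbf i_f,\mathbf s_f$ with $f\in A$, and $H_f=H_{\{f\}}$. A polynomial $f$ is partially reduced w.r.t. $g$ if no proper derivative of $\operatorname{ld}g$ occurs in $f$, and reduced if moreover $\deg_{\operatorname{ld} g}f<\deg_{\operatorname{ld}g}g$; a set $A\subset\mathbf k\{Y\}\setminus\mathbf k$ is autoreduced if each element is reduced w.r.t. every other one.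 A system $(A,H)$ of finite sets is regular if $A$ is autoreduced, $H$ is partially reduced w.r.t. $A$, and $H_A\subseteq H$. $[F]$ and $\{F\}$ are the differential and the radical differential ideal generated by $F$; $I:S^\infty=\{a\mid sa\in I\text{ for some }s\in S^\infty\}$, where $S^\infty$ is the multiplicative set generated by $S\cup\{1\}$. Let $m_y(F)$ be the maximal order of $y$ in $F$ ($0$ if $y$ does not occur), $M(F)=\sum_{i}m_{y_i}(F)$. A differential remainder of $f$ w.r.t. a finite set $\mathbb D\subset\mathbf k\{Y\}\setminus\mathbf k$ is a $g$, reduced w.r.t. $\mathbb D$, with $hf-g\in[\mathbb D]:H_{\mathbb D}^\infty$ for some $h\in H_{\mathbb D}^\infty$. For $b=(b_y)_{y\in Y}$, $\mathrm{Truncate}(f,b)$ is the sum of the terms of $f$ in which each $y$ has order at most $b_y$. **Algorithm** (input: finite sets $F_0\ne\varnothing$, $F_0\cap\mathbf k=\varnothing$, and $H_0$). Put $T:=\varnothing$, $U:=\{(F_0,\varnothing,H_0)\}$. While $U\neq\varnothing$: take and remove any $(F,\mathbb C,H)\in U$, and let $f$ be any element of $F$ of least rank. Put $D:=\{C\in\mathbb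 C\mid\operatorname{lv}C=\operatorname{lv}f\}$, $G:=(F\cup D)\setminus\{f\}$, $\bar{\mathbb C}:=(\mathbb C\setminus D)\cup\{f\}$, $\bar G:=G\cup\bar{\mathbb C}\cup H$; $b_y:=m_y(\bar G)$ for $y\in\operatorname{lv}\bar{\mathbb C}$ and $b_z:=m_z(\bar G)+\sum_{y\in\operatorname{lv}\bar{\mathbb C}}\bigl(m_y(\bar G)-m_y(\operatorname{ld}\bar{\mathbb C})\bigr)$ for $z\notin\operatorname{lv}\bar{\mathbb C}$. 1. Put $\mathbb D:=\varnothing$; for $C\in\bar{\mathbb C}$ in order of increasing rank, take any differential remainder $E$ of $C$ w.r.t. $\mathbb D$ with $\operatorname{rk}E\le\operatorname{rk}C$ and put $\mathbb D:=\mathbb D\cup\{\mathrm{Truncate}(E,b)\}$; as soon as $\operatorname{rk}\mathrm{Truncate}(E,b)\neq\operatorname{rk}C$, abandon the loop and skip step 2. 2. Put $\bar F:=\mathrm{Truncate}(R,b)\setminus\{0\}$ and $\bar H:=\mathrm{Truncate}(R'\cup H_{\mathbb D},b)$, where $R$ and $R'$ consist of one arbitrary differential remainder w.r.t. $\mathbb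 D$ of each element of $G$ and of $H\cup H_f$, respectively. If $\bar F\cap\mathbf k=\varnothing$ and $0\notin\bar H$, then add $(\mathbb D,\bar H)$ to $T$ if $\bar F=\varnothing$, and add $(\bar F,\mathbb D,\bar H)$ to $U$ otherwise. 3. If $\mathbf s_f\notin\mathbf k$, add $(F\cup\{\mathbf s_f\},\mathbb C,H)$ to $U$ and, if moreover $\mathbf i_f\notin\mathbf k$, also $(F\cup\{\mathbf i_f\},\mathbb C,H)$. Return $T$ when $U=\varnothing$. **Proposition.** For every such input and for all choices made, the algorithm can always carry out its next step and terminates. At every moment $M(F\cup\mathbb C\cup H)\le(n-1)!\,M(F_0\cup H_0)$ for all $(F,\mathbb C,H)\in U$. The output $T$ is a finite set of regular systems with $$\{F_0\}:H_0^\infty=\bigcap_{(\mathbb A,H)\in T}[\mathbb A]:H^\infty\qquad\text{and}\qquad M(\mathbb A\cup H)\le(n-1)!\,M(F_0\cup H_0)\quad\text{for all }(\mathbb A,H)\in T.$$ -/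

import Mathlib

/-! Ordinary differential polynomials over a differential field, rankings, differential remainders,
regular systems, and the reduction-independent Rosenfeld-Gröbner algorithm as a transition system. -/

open scoped Classical

noncomputable section

namespace DiffAlg

/-- The derivative `δ ^ ord y_var` of one of the differential indeterminates `y_1, …, y_n`. -/
@[ext]
structure Der (n : ℕ) where
  var : Fin n
  ord : ℕ

/-- Application of `δ ^ j` to a derivative. -/
def Der.shift {n : ℕ} (u : Der n) (j : ℕ) : Der n := ⟨u.var, u.ord + j⟩

/-- The given total order on the derivatives is a (differential) ranking. -/
structure IsRanking (n : ℕ) [LinearOrder (Der n)] : Prop where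
  le_shift : ∀ (u : Der n) (j : ℕ), u ≤ u.shift j
  shift_le_shift : ∀ (u v : Der n) (j : ℕ), u ≤ v → u.shift j ≤ v.shift j

/-- The ring of ordinary differential polynomials `k{y_1, …, y_n}`. -/
abbrev DPoly (k : Type*) [Field k] (n : ℕ) := MvPolynomial (Der n) k

section ideals

variable {k : Type*} [Field k] [Differential k] {n : ℕ}

/-- The derivation of `k{y_1, …, y_n}`: it extends the derivation of `k` (first summand: the
derivation applied to the coefficients) and maps `y_i^{(j)}` to `y_i^{(j+1)}` (second summand). -/
def delta (f : DPoly k n) : DPoly k n :=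
  ∑ m ∈ f.support, MvPolynomial.monomial m (Differential.deriv (f.coeff m)) +
    MvPolynomial.mkDerivation k (fun u : Der n => (MvPolynomial.X (u.shift 1) : DPoly k n)) f

/-- Differential ideals. -/
def IsDiffIdeal (I : Ideal (DPoly k n)) : Prop := ∀ f ∈ I, delta f ∈ I

/-- The differential ideal `[F]` generated by `F`. -/
def diffIdeal (F : Set (DPoly k n)) : Ideal (DPoly k n) :=
  sInf {I | IsDiffIdeal I ∧ F ⊆ I}

/-- The radical differential ideal `{F}` generated by `F`. -/
def radDiffIdeal (F : Set (DPoly k n)) : Ideal (DPoly k n) :=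
  sInf {I | IsDiffIdeal I ∧ I.IsRadical ∧ F ⊆ I}

/-- The saturation `I : S^∞`, where `S^∞` is the multiplicative set generated by `S` and `1`. -/
def sat (I : Ideal (DPoly k n)) (S : Set (DPoly k n)) : Ideal (DPoly k n) where
  carrier := {a | ∃ s ∈ Submonoid.closure S, s * a ∈ I}
  zero_mem' := ⟨1, one_mem _, by simp⟩
  add_mem' := by
    rintro a b ⟨s, hs, ha⟩ ⟨t, ht, hb⟩
    refine ⟨s * t, mul_mem hs ht, ?_⟩
    have h : s * t * (a + b) = t * (s * a) + s * (t * b) := by ring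
    rw [h]
    exact I.add_mem (I.mul_mem_left _ ha) (I.mul_mem_left _ hb)
  smul_mem' := by
    rintro c a ⟨s, hs, ha⟩
    refine ⟨s, hs, ?_⟩
    have h : s * (c • a) = c * (s * a) := by rw [smul_eq_mul]; ring
    rw [h]
    exact I.mul_mem_left _ ha

end ideals

section ranks

variable {k : Type*} [Field k] {n : ℕ}

/-- `f ∈ k`. -/
def IsConst (f : DPoly k n) : Prop := ∃ c : k, f = MvPolynomial.C c

/-- `m_y(F)`: the maximal order of `y` in `F`, and `0` if `y` does not occur in `F`. -/
def maxOrd (y : Fin n) (F : Finset (DPoly k n)) : ℕ :=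
  F.sup fun f => (f.vars.filter fun u => u.var = y).sup Der.ord

/-- `M(F) = ∑_y m_y(F)`. -/
def totalOrd (F : Finset (DPoly k n)) : ℕ := ∑ y : Fin n, maxOrd y F

/-- The sum of those terms of `f` in which every `y_i` has order at most `b i`. -/
def truncate (b : Fin n → ℕ) (f : DPoly k n) : DPoly k n :=
  ∑ m ∈ f.support.filter (fun m => ∀ u ∈ m.support, u.ord ≤ b u.var),
    MvPolynomial.monomial m (f.coeff m)

variable [LinearOrder (Der n)]

/-- The leader of `f`; it is `⊥` exactly for constants. -/
def ld (f : DPoly k n) : WithBot (Der n) := f.vars.max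

/-- The leading variable of `f`; it is `⊥` exactly for constants. -/
def lv (f : DPoly k n) : WithBot (Fin n) := (ld f).map Der.var

/-- The rank `u ^ d` of `f`, ordered lexicographically; it is `⊥` exactly for constants. -/
def rk (f : DPoly k n) : WithBot (Der n ×ₗ ℕ) :=
  (ld f).map fun u => toLex (u, f.degreeOf u)

/-- The coefficient of `u ^ d` in `f`, regarded as a polynomial in `u`. -/
def coeffOf (u : Der n) (d : ℕ) (f : DPoly k n) : DPoly k n :=
  ∑ m ∈ f.support.filter (fun m => m u = d), MvPolynomial.monomial (m.erase u) (f.coeff m)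

/-- The initial of `f` (used for non-constant `f` only). -/
def initial (f : DPoly k n) : DPoly k n :=
  if h : f.vars.Nonempty then coeffOf (f.vars.max' h) (f.degreeOf (f.vars.max' h)) f else 0

/-- The separant of `f` (used for non-constant `f` only). -/
def separant (f : DPoly k n) : DPoly k n :=
  if h : f.vars.Nonempty then MvPolynomial.pderiv (f.vars.max' h) f else 0

/-- `H_A`, the set of initials and separants of the elements of `A`. -/
def initSep (A : Finset (DPoly k n)) : Finset (DPoly k n) := A.image initial ∪ A.image separant

/-- `f` is partially reduced w.r.t. `g`. -/
def PartReduced (f g : DPoly k n) : Prop :=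
  ∀ u : Der n, ld g = u → ∀ j : ℕ, 0 < j → u.shift j ∉ f.vars

/-- `f` is reduced w.r.t. `g`. -/
def Reduced (f g : DPoly k n) : Prop :=
  PartReduced f g ∧ ∀ u : Der n, ld g = u → f.degreeOf u < g.degreeOf u

def Autoreduced (A : Finset (DPoly k n)) : Prop :=
  (∀ f ∈ A, ¬ IsConst f) ∧ ∀ f ∈ A, ∀ g ∈ A, f ≠ g → Reduced f g

/-- The system `A = 0, H ≠ 0` is regular. -/
def RegularSystem (A H : Finset (DPoly k n)) : Prop :=
  Autoreduced A ∧ (∀ h ∈ H, ∀ a ∈ A, PartReduced h a) ∧ initSep A ⊆ H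

/-- The leaders of the elements of `A`. -/
def ldSet (A : Finset (DPoly k n)) : Finset (Der n) :=
  A.biUnion fun f => f.vars.filter fun u => ld f = u

/-- The leading variables of the elements of `A`. -/
def lvSet (A : Finset (DPoly k n)) : Finset (Fin n) := (ldSet A).image Der.var

/-- `m_y(ld A)`. -/
def ldOrd (y : Fin n) (A : Finset (DPoly k n)) : ℕ :=
  ((ldSet A).filter fun u => u.var = y).sup Der.ord

/-- The truncation bound of the algorithm, for the sets `Cbar ⊆ Gbar`; for leading variables `y`
of `Cbar` one has `m_y(ld Cbar) ≤ m_y(Gbar)`, so the subtraction is the usual one. -/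
def orderBound (Cbar Gbar : Finset (DPoly k n)) (z : Fin n) : ℕ :=
  if z ∈ lvSet Cbar then maxOrd z Gbar
  else maxOrd z Gbar + ∑ y ∈ lvSet Cbar, (maxOrd y Gbar - ldOrd y Cbar)

end ranks

section algorithm

variable {k : Type*} [Field k] [Differential k] {n : ℕ} [LinearOrder (Der n)]

/-- `g` is a differential remainder of `f` w.r.t. `D`: it is reduced w.r.t. `D`, and
`h f - g ∈ [D] : H_D^∞` for some `h ∈ H_D^∞`. -/
def IsDiffRem (D : Finset (DPoly k n)) (f g : DPoly k n) : Prop :=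
  (∀ a ∈ D, Reduced g a) ∧
    ∃ h ∈ Submonoid.closure (initSep D : Set (DPoly k n)),
      h * f - g ∈ sat (diffIdeal (D : Set (DPoly k n))) (initSep D)

/-- The **for**-loop `D := D ∪ {Truncate (Rem (C, D), b)}`, started at the current set `D`, over the
list of the elements `C` still to be treated. The remainder `E` of `C` is any differential remainder
of rank at most `rk C`. The result `some D` means that all ranks have been preserved, so that the
final set `D` has the same rank as `Cbar`. As soon as a rank drops, `D` and `Cbar` cannot end up
with the same rank and everything computed is discarded; this is the result `none`. -/
inductive ForLoop (b : Fin n → ℕ) :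
    Finset (DPoly k n) → List (DPoly k n) → Option (Finset (DPoly k n)) → Prop
  | done (D : Finset (DPoly k n)) : ForLoop b D [] (some D)
  | next (D : Finset (DPoly k n)) (C E : DPoly k n) (L : List (DPoly k n))
      (r : Option (Finset (DPoly k n))) (hrem : IsDiffRem D C E) (hle : rk E ≤ rk C)
      (hrk : rk (truncate b E) = rk C) (hloop : ForLoop b (insert (truncate b E) D) L r) :
      ForLoop b D (C :: L) r
  | fail (D : Finset (DPoly k n)) (C E : DPoly k n) (L : List (DPoly k n))
      (hrem : IsDiffRem D C E) (hle : rk E ≤ rk C) (hrk : rk (truncate b E) ≠ rk C) :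
      ForLoop b D (C :: L) none

/-- A triple `(F, C, H)`. -/
structure Triple (k : Type*) [Field k] (n : ℕ) where
  F : Finset (DPoly k n)
  C : Finset (DPoly k n)
  H : Finset (DPoly k n)

/-- A state of the **while**-loop: the set `U` of triples to be treated and the set `T` of pairs
`(A, H)` found so far. -/
structure State (k : Type*) [Field k] (n : ℕ) where
  U : Finset (Triple k n)
  T : Finset (Finset (DPoly k n) × Finset (DPoly k n))

/-- The initial state. -/
def start (F₀ H₀ : Finset (DPoly k n)) : State k n := ⟨{⟨F₀, ∅, H₀⟩}, ∅⟩

/-- The additions to `U` and `T` after the **for**-loop, depending on its result. Here `remG` and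
`remH` give the arbitrary differential remainders chosen for the elements of `G` and of `H ∪ H_f`. -/
inductive Collect (b : Fin n → ℕ) (G H : Finset (DPoly k n)) (f : DPoly k n) :
    Option (Finset (DPoly k n)) → Finset (Triple k n) →
      Finset (Finset (DPoly k n) × Finset (DPoly k n)) → Prop
  | discard : Collect b G H f none ∅ ∅
  | reduce (D : Finset (DPoly k n)) (remG remH : DPoly k n → DPoly k n)
      (hG : ∀ g ∈ G, IsDiffRem D g (remG g))
      (hH : ∀ h ∈ H ∪ initSep {f}, IsDiffRem D h (remH h))
      (Fbar Hbar : Finset (DPoly k n))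
      (hF : Fbar = ((G.image remG).image (truncate b)).erase 0)
      (hHbar : Hbar = ((H ∪ initSep {f}).image remH ∪ initSep D).image (truncate b)) :
      Collect b G H f (some D)
        (if (∀ g ∈ Fbar, ¬ IsConst g) ∧ 0 ∉ Hbar ∧ Fbar ≠ ∅ then {⟨Fbar, D, Hbar⟩} else ∅)
        (if (∀ g ∈ Fbar, ¬ IsConst g) ∧ 0 ∉ Hbar ∧ Fbar = ∅ then {(D, Hbar)} else ∅)

/-- The triples added to `U` for the separant and the initial of `f`. -/
def split (t : Triple k n) (f : DPoly k n) : Finset (Triple k n) :=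
  if IsConst (separant f) then ∅
  else insert ⟨insert (separant f) t.F, t.C, t.H⟩
    (if IsConst (initial f) then ∅ else {⟨insert (initial f) t.F, t.C, t.H⟩})

/-- The elements of `C` with the same leading variable as `f`. -/
def conflict (C : Finset (DPoly k n)) (f : DPoly k n) : Finset (DPoly k n) :=
  C.filter fun c => lv c = lv f

/-- The body of the **while**-loop for the triple `t = (F, C, H)` and the element `f` of `F`; the
last two arguments are the additions to `U` and to `T`. -/
def Body (t : Triple k n) (f : DPoly k n) (U' : Finset (Triple k n))
    (T' : Finset (Finset (DPoly k n) × Finset (DPoly k n))) : Prop :=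
  let D := conflict t.C f
  let G := (t.F ∪ D) \ {f}
  let Cbar := (t.C \ D) ∪ {f}
  let Gbar := G ∪ Cbar ∪ t.H
  let b := orderBound Cbar Gbar
  ∃ (L : List (DPoly k n)) (r : Option (Finset (DPoly k n))) (U₁ : Finset (Triple k n)),
    L.Pairwise (fun p q => rk p < rk q) ∧ L.toFinset = Cbar ∧
    ForLoop b ∅ L r ∧ Collect b G t.H f r U₁ T' ∧ U' = U₁ ∪ split t f

/-- One iteration of the **while**-loop, with all admissible choices. -/
def Step (s s' : State k n) : Prop :=
  ∃ t ∈ s.U, ∃ f ∈ t.F, (∀ g ∈ t.F, rk f ≤ rk g) ∧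
    ∃ U' T', Body t f U' T' ∧ s' = ⟨s.U.erase t ∪ U', s.T ∪ T'⟩

/-- The state `s` can occur in a run of the algorithm with input `F₀, H₀`. -/
def Reachable (F₀ H₀ : Finset (DPoly k n)) (s : State k n) : Prop :=
  Relation.ReflTransGen Step (start F₀ H₀) s

end algorithm

end DiffAlg

end

open DiffAlg

/-! A common solution of `F = 0`, `H ≠ 0` is taken in the strong sense of a differential ideal `I`
that contains `F` and modulo which the elements of `H` are not zero divisors; `{F} : H^∞` is the
least radical one. A reduction step replaces a system by one with the same solutions in this sense,
and splitting by the initial and the separant of `f` accounts for the solutions that it loses. When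
`F` is empty, Lazard's lemma shows that `[𝔸] : H^∞` is already radical.

Truncation is harmless because of the choice of the bounds: modulo the differential ideal of the
remainders found so far, every polynomial of the system is a fraction in derivatives within the
bounds. Solving the equations for the derivatives of their leaders brings the orders of the leading
variables down at the expense of the orders of the other variables, and the number of such
eliminations is at most `∑ (m_y(Ḡ) - m_y(ld C̄))`. By Rosenfeld's lemma the congruence between a
polynomial and its remainder then is an algebraic one, whose terms beyond the bounds may be dropped.

For the bound on the orders, let the `r` leading variables count `n - r` times: if the order of one
of them drops by `e`, those of the `n - r` others rise by at most `e`, so that the weighted sum does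
not increase. A new leading variable multiplies it by at most `n - 1 - r`. -/

noncomputable section

namespace DiffAlg

open MvPolynomial

section Polynomials

variable {σ R : Type*} [CommSemiring R]

lemma supported_le_iff {s : Set σ} {A : Subalgebra R (MvPolynomial σ R)} :
    supported R s ≤ A ↔ ∀ i ∈ s, X i ∈ A := by
  rw [supported_eq_adjoin_X, Algebra.adjoin_le_iff, Set.image_subset_iff]
  rfl

lemma vars_subset_of_support_subset {f g : MvPolynomial σ R} (h : f.support ⊆ g.support) :
    f.vars ⊆ g.vars := by
  intro i hi
  obtain ⟨m, hm, him⟩ := (mem_vars_iff_mem_support i).1 hi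
  exact (mem_vars_iff_mem_support i).2 ⟨m, h hm, him⟩

lemma degreeOf_le_of_support_subset {f g : MvPolynomial σ R} (h : f.support ⊆ g.support) (i : σ) :
    f.degreeOf i ≤ g.degreeOf i := by
  rw [degreeOf_eq_sup, degreeOf_eq_sup]
  exact Finset.sup_mono h

lemma degreeOf_pos_iff {f : MvPolynomial σ R} {i : σ} : 0 < f.degreeOf i ↔ i ∈ f.vars := by
  rw [mem_vars_iff_degreeOf_ne_zero, Nat.pos_iff_ne_zero]

lemma degreeOf_eq_zero_iff_notMem_vars {f : MvPolynomial σ R} {i : σ} :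
    f.degreeOf i = 0 ↔ i ∉ f.vars := by
  rw [mem_vars_iff_degreeOf_ne_zero, not_not]

lemma degreeOf_eq_zero_of_mem_supported {s : Set σ} {f : MvPolynomial σ R} {i : σ}
    (hf : f ∈ supported R s) (hi : i ∉ s) : f.degreeOf i = 0 :=
  degreeOf_eq_zero_iff_notMem_vars.2 fun h => hi (mem_supported.1 hf h)

lemma vars_pderiv_subset (i : σ) (f : MvPolynomial σ R) : (pderiv i f).vars ⊆ f.vars := by
  intro j hj
  obtain ⟨m, hm, hjm⟩ := (mem_vars_iff_mem_support j).1 hj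
  rw [mem_support_iff, coeff_pderiv] at hm
  refine (mem_vars_iff_mem_support j).2
    ⟨m + Finsupp.single i 1, mem_support_iff.2 (left_ne_zero_of_mul hm), ?_⟩
  simp only [Finsupp.mem_support_iff, Finsupp.add_apply] at hjm ⊢
  lia

lemma pderiv_mem_supported {s : Set σ} (i : σ) {f : MvPolynomial σ R} (hf : f ∈ supported R s) :
    pderiv i f ∈ supported R s :=
  mem_supported.2 ((Finset.coe_subset.2 (vars_pderiv_subset i f)).trans (mem_supported.1 hf))

lemma pderiv_eq_zero_of_mem_supported {i : σ} {f : MvPolynomial σ R}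
    (hf : f ∈ supported R ({i}ᶜ : Set σ)) : pderiv i f = 0 :=
  pderiv_eq_zero_of_notMem_vars fun h => mem_supported.1 hf h rfl

lemma pderiv_ne_zero [NoZeroDivisors R] [CharZero R] {f : MvPolynomial σ R} {i : σ}
    (h : i ∈ f.vars) : pderiv i f ≠ 0 := by
  obtain ⟨m, hm, him⟩ := (mem_vars_iff_mem_support i).1 h
  have hsub : m - Finsupp.single i 1 + Finsupp.single i 1 = m :=
    tsub_add_cancel_of_le (Finsupp.single_le_iff.2
      (Nat.one_le_iff_ne_zero.2 (Finsupp.mem_support_iff.1 him)))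
  refine ne_zero_iff.2 ⟨m - Finsupp.single i 1, ?_⟩
  rw [coeff_pderiv, hsub]
  exact mul_ne_zero (mem_support_iff.1 hm) (Nat.cast_add_one_ne_zero _)

end Polynomials

section Truncation

variable {k : Type*} [Field k] {n : ℕ}

lemma isConst_iff_vars_eq_empty {f : DPoly k n} : IsConst f ↔ f.vars = ∅ := by
  constructor
  · rintro ⟨c, rfl⟩
    exact vars_C
  · exact fun h => ⟨_, vars_eq_empty_iff_eq_C.1 h⟩

lemma isUnit_of_isConst {f : DPoly k n} (h : IsConst f) (h0 : f ≠ 0) : IsUnit f := by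
  obtain ⟨c, rfl⟩ := h
  exact (IsUnit.mk0 c fun hc => h0 (by rw [hc, map_zero])).map C

/-- The derivatives of order at most `b`, i.e. those which survive truncation at `b`. -/
def boundedDers (b : Fin n → ℕ) : Set (Der n) := {u | u.ord ≤ b u.var}

/-- Truncation at `b` as a homomorphism of algebras: it kills the derivatives outside
`boundedDers b`. -/
def truncHom (b : Fin n → ℕ) : DPoly k n →ₐ[k] DPoly k n :=
  aeval fun u : Der n => if u.ord ≤ b u.var then X u else 0

lemma truncate_eq_truncHom (b : Fin n → ℕ) (f : DPoly k n) : truncate b f = truncHom b f := by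
  conv_rhs => rw [f.as_sum, map_sum]
  rw [truncate, Finset.sum_filter]
  refine Finset.sum_congr rfl fun m _ => ?_
  rw [truncHom, aeval_monomial, Finsupp.prod]
  split_ifs with h
  · rw [monomial_eq, Finsupp.prod]
    exact congrArg _ (Finset.prod_congr rfl fun u hu => by rw [if_pos (h u hu)])
  · push Not at h
    obtain ⟨u, hu, hlt⟩ := h
    rw [Finset.prod_eq_zero hu, mul_zero]
    rw [if_neg (not_le.2 hlt), zero_pow (Finsupp.mem_support_iff.1 hu)]

lemma truncHom_eq_self {b : Fin n → ℕ} {f : DPoly k n} (hf : f ∈ supported k (boundedDers b)) :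
    truncHom b f = f := by
  have hle : supported k (boundedDers b) ≤ AlgHom.equalizer (truncHom b) (AlgHom.id k _) :=
    supported_le_iff.2 fun u (hu : u.ord ≤ b u.var) =>
      (AlgHom.mem_equalizer _ _ _).2 (by simp [truncHom, hu])
  exact (AlgHom.mem_equalizer _ _ _).1 (hle hf)

lemma mem_support_truncate {b : Fin n → ℕ} {f : DPoly k n} {m : Der n →₀ ℕ} :
    m ∈ (truncate b f).support ↔ m ∈ f.support ∧ ∀ u ∈ m.support, u ∈ boundedDers b := by
  simp only [truncate, mem_support_iff, coeff_sum, coeff_monomial, Finset.sum_ite_eq',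
    Finset.mem_filter, boundedDers, Set.mem_ofPred_eq]
  split_ifs with h
  · exact iff_of_true h.1 h
  · exact iff_of_false (fun h0 => h0 rfl) h

lemma support_truncate_subset (b : Fin n → ℕ) (f : DPoly k n) :
    (truncate b f).support ⊆ f.support :=
  fun _ hm => (mem_support_truncate.1 hm).1

lemma truncate_mem_supported (b : Fin n → ℕ) (f : DPoly k n) :
    truncate b f ∈ supported k (boundedDers b) := by
  refine mem_supported.2 fun u hu => ?_
  obtain ⟨m, hm, hum⟩ := (mem_vars_iff_mem_support u).1 hu
  exact (mem_support_truncate.1 hm).2 u hum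

end Truncation

section Derivation

variable {σ R : Type*} [CommRing R]

lemma coeff_sum_support_monomial {φ : R → R} (hφ : φ 0 = 0) (f : MvPolynomial σ R)
    (m : σ →₀ ℕ) : (∑ i ∈ f.support, monomial i (φ (f.coeff i))).coeff m = φ (f.coeff m) := by
  simp only [coeff_sum, coeff_monomial, Finset.sum_ite_eq', mem_support_iff, ite_not]
  split_ifs with h
  · rw [h, hφ]
  · rfl

/-- The derivation of a polynomial ring that applies a derivation `d` of the base ring to the
coefficients, and hence kills the variables. -/
def coeffDerivation (d : Derivation ℤ R R) :
    Derivation ℤ (MvPolynomial σ R) (MvPolynomial σ R) :=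
  have coeff_eq := coeff_sum_support_monomial (σ := σ) (map_zero d)
  Derivation.mk'
    (AddMonoidHom.mk' (fun f => ∑ m ∈ f.support, monomial m (d (f.coeff m))) fun f g => by
      ext m
      rw [coeff_add, coeff_eq, coeff_eq, coeff_eq, coeff_add, map_add]).toIntLinearMap
    fun f g => by
      ext m
      change (∑ i ∈ (f * g).support, monomial i (d ((f * g).coeff i))).coeff m =
        (f * (∑ i ∈ g.support, monomial i (d (g.coeff i))) +
          g * (∑ i ∈ f.support, monomial i (d (f.coeff i)))).coeff m
      rw [coeff_eq, mul_comm g, coeff_add, coeff_mul, coeff_mul, coeff_mul, map_sum,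
        ← Finset.sum_add_distrib]
      refine Finset.sum_congr rfl fun x _ => ?_
      rw [coeff_eq, coeff_eq, Derivation.leibniz, smul_eq_mul, smul_eq_mul, mul_comm (g.coeff _)]

lemma coeff_coeffDerivation (d : Derivation ℤ R R) (f : MvPolynomial σ R) (m : σ →₀ ℕ) :
    (coeffDerivation d f).coeff m = d (f.coeff m) :=
  coeff_sum_support_monomial (map_zero d) f m

lemma coeffDerivation_X (d : Derivation ℤ R R) (i : σ) :
    coeffDerivation d (X i : MvPolynomial σ R) = 0 := by
  ext m
  rw [coeff_coeffDerivation, coeff_X]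
  split_ifs <;> simp

lemma coeffDerivation_mem_supported (d : Derivation ℤ R R) {s : Set σ} {f : MvPolynomial σ R}
    (hf : f ∈ supported R s) : coeffDerivation d f ∈ supported R s := by
  have hsupp : (coeffDerivation d f).support ⊆ f.support := fun m => by
    simp only [mem_support_iff, coeff_coeffDerivation]
    exact mt fun h => by rw [h, map_zero]
  exact mem_supported.2
    ((Finset.coe_subset.2 (vars_subset_of_support_subset hsupp)).trans (mem_supported.1 hf))

lemma mkDerivation_apply_eq_sum_pderiv {M : Type*} [AddCommGroup M] [Module R M]
    [Module (MvPolynomial σ R) M] [IsScalarTower R (MvPolynomial σ R) M] (a : σ → M)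
    (f : MvPolynomial σ R) : mkDerivation R a f = ∑ i ∈ f.vars, pderiv i f • a i := by
  have sum_apply (D : σ → Derivation R (MvPolynomial σ R) M) (g : MvPolynomial σ R) :
      (∑ i ∈ f.vars, D i) g = ∑ i ∈ f.vars, D i g := by
    rw [← Derivation.coeFnAddMonoidHom_apply, map_sum, Finset.sum_apply]
    rfl
  have h : mkDerivation R a f =
      (∑ i ∈ f.vars, (LinearMap.toSpanSingleton (MvPolynomial σ R) M (a i)).compDer (pderiv i)) f :=
    derivation_eq_of_forall_mem_vars fun i hi => by
      simp [sum_apply, pderiv_X, Pi.single_apply, hi]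
  simpa [sum_apply] using h

variable {k : Type*} [Field k] [Differential k] {n : ℕ}

@[simp] lemma Der.shift_var (u : Der n) (j : ℕ) : (u.shift j).var = u.var := rfl

@[simp] lemma Der.shift_ord (u : Der n) (j : ℕ) : (u.shift j).ord = u.ord + j := rfl

lemma Der.shift_shift (u : Der n) (i j : ℕ) : (u.shift i).shift j = u.shift (i + j) := by
  ext <;> simp [add_assoc]

/-- The derivation `delta` of the ring of differential polynomials as a bundled `Derivation`. -/
def deltaDerivation : Derivation ℤ (DPoly k n) (DPoly k n) :=
  coeffDerivation Differential.deriv +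
    (mkDerivation k fun u : Der n => (X (u.shift 1) : DPoly k n)).restrictScalars ℤ

lemma delta_add (f g : DPoly k n) : delta (f + g) = delta f + delta g :=
  map_add deltaDerivation f g

lemma delta_sub (f g : DPoly k n) : delta (f - g) = delta f - delta g :=
  map_sub deltaDerivation f g

lemma delta_mul (f g : DPoly k n) : delta (f * g) = f * delta g + g * delta f :=
  deltaDerivation.leibniz f g

@[simp] lemma delta_zero : delta (0 : DPoly k n) = 0 := map_zero deltaDerivation

lemma delta_eq_sum_pderiv (f : DPoly k n) : delta f =
    coeffDerivation Differential.deriv f + ∑ u ∈ f.vars, pderiv u f * X (u.shift 1) :=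
  congrArg _ (mkDerivation_apply_eq_sum_pderiv _ f)

@[simp] lemma delta_X (u : Der n) : delta (X u : DPoly k n) = X (u.shift 1) := by
  simp [delta_eq_sum_pderiv, coeffDerivation_X]

lemma delta_mem_subalgebra {A : Subalgebra k (DPoly k n)} {s : Set (Der n)}
    (hX : ∀ w ∈ s, (X w : DPoly k n) ∈ A) (hX' : ∀ w ∈ s, (X (w.shift 1) : DPoly k n) ∈ A)
    {f : DPoly k n} (hf : f ∈ supported k s) : delta f ∈ A := by
  have hA : supported k s ≤ A := supported_le_iff.2 hX
  rw [delta_eq_sum_pderiv]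
  exact add_mem (hA (coeffDerivation_mem_supported _ hf)) <| sum_mem fun u hu =>
    mul_mem (hA (pderiv_mem_supported u hf)) (hX' u (mem_supported.1 hf hu))

lemma delta_sub_pderiv_mul_mem_subalgebra {A : Subalgebra k (DPoly k n)} {s : Set (Der n)}
    (u : Der n) (hX : ∀ w ∈ s, (X w : DPoly k n) ∈ A)
    (hX' : ∀ w ∈ s, w ≠ u → (X (w.shift 1) : DPoly k n) ∈ A)
    {f : DPoly k n} (hf : f ∈ supported k s) :
    delta f - pderiv u f * X (u.shift 1) ∈ A := by
  have hA : supported k s ≤ A := supported_le_iff.2 hX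
  have hsum : ∑ w ∈ f.vars, pderiv w f * X (w.shift 1) - pderiv u f * X (u.shift 1) =
      ∑ w ∈ f.vars.erase u, pderiv w f * X (w.shift 1) := by
    by_cases hu : u ∈ f.vars
    · rw [← Finset.sum_erase_add _ _ hu, add_sub_cancel_right]
    · rw [pderiv_eq_zero_of_notMem_vars hu, zero_mul, sub_zero, Finset.erase_eq_of_notMem hu]
  rw [delta_eq_sum_pderiv, add_sub_assoc, hsum]
  refine add_mem (hA (coeffDerivation_mem_supported _ hf)) <| sum_mem fun w hw => ?_
  obtain ⟨hwu, hw⟩ := Finset.mem_erase.1 hw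
  exact mul_mem (hA (pderiv_mem_supported w hf)) (hX' w (mem_supported.1 hf hw) hwu)

end Derivation

section Ranking

variable {n : ℕ} [LinearOrder (Der n)]

lemma IsRanking.lt_shift (hR : IsRanking n) (u : Der n) {j : ℕ} (hj : 0 < j) : u < u.shift j := by
  refine lt_of_le_of_ne (hR.le_shift u j) fun h => ?_
  have := congrArg Der.ord h
  simp only [Der.shift_ord] at this
  lia

lemma IsRanking.shift_lt_shift (hR : IsRanking n) {u v : Der n} (h : u < v) (j : ℕ) :
    u.shift j < v.shift j := by
  refine lt_of_le_of_ne (hR.shift_le_shift u v j h.le) fun he => h.ne ?_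
  simpa [Der.shift, Der.ext_iff] using he

lemma IsRanking.monotone_mk (hR : IsRanking n) (y : Fin n) : Monotone (Der.mk y) := by
  intro i j hij
  simpa [Der.shift, hij] using hR.le_shift ⟨y, i⟩ (j - i)

lemma IsRanking.wellFoundedLT (hR : IsRanking n) : WellFoundedLT (Der n) := by
  have hpwo : (⋃ y ∈ (Finset.univ : Finset (Fin n)), Der.mk y '' Set.univ).IsPWO :=
    (Finset.isPWO_bUnion _).2 fun y _ =>
      (Set.isPWO_univ_iff.2 inferInstance).image_of_monotone (hR.monotone_mk y)
  refine Set.isWF_univ_iff.1 (hpwo.isWF.mono fun u _ => ?_)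
  exact Set.mem_biUnion (Finset.mem_univ u.var) ⟨u.ord, trivial, rfl⟩

end Ranking


section Leaders

variable {k : Type*} [Field k] {n : ℕ} [LinearOrder (Der n)] {f g : DPoly k n} {u : Der n}

lemma ld_eq_coe_iff : ld f = u ↔ u ∈ f.vars ∧ ∀ w ∈ f.vars, w ≤ u := by
  constructor
  · exact fun h => ⟨Finset.mem_of_max h, fun w hw => Finset.le_max_of_eq hw h⟩
  · rintro ⟨hmem, hle⟩
    exact le_antisymm (Finset.max_le fun w hw => WithBot.coe_le_coe.2 (hle w hw))
      (Finset.le_max hmem)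

lemma mem_vars_of_ld_eq (h : ld f = u) : u ∈ f.vars :=
  (ld_eq_coe_iff.1 h).1

lemma vars_nonempty_of_ld_eq (h : ld f = u) : f.vars.Nonempty :=
  ⟨u, mem_vars_of_ld_eq h⟩

lemma le_of_ld_eq (h : ld f = u) {w : Der n} (hw : w ∈ f.vars) : w ≤ u :=
  (ld_eq_coe_iff.1 h).2 w hw

lemma mem_supported_Iic_of_ld_eq (h : ld f = u) : f ∈ supported k (Set.Iic u) :=
  mem_supported.2 fun _ hw => le_of_ld_eq h hw

lemma ld_eq_bot_iff : ld f = ⊥ ↔ IsConst f := by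
  rw [isConst_iff_vars_eq_empty, ld, Finset.max_eq_bot]

lemma exists_ld_eq (h : ¬ IsConst f) : ∃ u : Der n, ld f = u := by
  rw [← ld_eq_bot_iff] at h
  exact ⟨_, (WithBot.coe_unbot _ h).symm⟩

lemma not_isConst_of_ld_eq (h : ld f = u) : ¬ IsConst f := by
  rw [← ld_eq_bot_iff, h]
  exact WithBot.coe_ne_bot

lemma max'_vars_eq_of_ld_eq (h : ld f = u) (hne : f.vars.Nonempty) : f.vars.max' hne = u := by
  rw [← WithBot.coe_inj, Finset.coe_max']
  exact h

lemma initial_eq_coeffOf (h : ld f = u) : initial f = coeffOf u (f.degreeOf u) f := by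
  rw [initial, dif_pos (vars_nonempty_of_ld_eq h), max'_vars_eq_of_ld_eq h]

lemma separant_eq_pderiv (h : ld f = u) : separant f = pderiv u f := by
  rw [separant, dif_pos (vars_nonempty_of_ld_eq h), max'_vars_eq_of_ld_eq h]

lemma lv_eq_var (h : ld f = u) : lv f = u.var := by
  rw [lv, h]
  rfl

lemma rk_eq_coe (h : ld f = u) :
    rk f = ((toLex (u, f.degreeOf u) : Der n ×ₗ ℕ) : WithBot (Der n ×ₗ ℕ)) := by
  rw [rk, h]
  rfl

lemma rk_eq_bot_iff : rk f = ⊥ ↔ IsConst f := by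
  rw [rk, WithBot.map_eq_bot_iff, ld_eq_bot_iff]

lemma ld_eq_of_rk_eq (h : ld f = u) (hr : rk g = rk f) :
    ld g = u ∧ g.degreeOf u = f.degreeOf u := by
  have hg : ¬ IsConst g := by
    rw [← rk_eq_bot_iff, hr, rk_eq_bot_iff]
    exact not_isConst_of_ld_eq h
  obtain ⟨w, hw⟩ := exists_ld_eq hg
  rw [rk_eq_coe h, rk_eq_coe hw, WithBot.coe_inj, EmbeddingLike.apply_eq_iff_eq,
    Prod.mk.injEq] at hr
  obtain ⟨rfl, hdeg⟩ := hr
  exact ⟨hw, hdeg⟩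

lemma rk_le_rk_iff (h : ld f = u) :
    rk g ≤ rk f ↔ g ∈ supported k (Set.Iic u) ∧ g.degreeOf u ≤ f.degreeOf u := by
  by_cases hg : IsConst g
  · rw [rk_eq_bot_iff.2 hg]
    obtain ⟨c, rfl⟩ := hg
    simpa using Subalgebra.algebraMap_mem (supported k (Set.Iic u)) c
  obtain ⟨w, hw⟩ := exists_ld_eq hg
  rw [rk_eq_coe h, rk_eq_coe hw, WithBot.coe_le_coe, Prod.Lex.toLex_le_toLex]
  constructor
  · rintro (hlt | ⟨rfl, hdeg⟩)
    · refine ⟨supported_mono (Set.Iic_subset_Iic.2 hlt.le) (mem_supported_Iic_of_ld_eq hw), ?_⟩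
      rw [degreeOf_eq_zero_of_mem_supported (mem_supported_Iic_of_ld_eq hw) hlt.not_ge]
      exact Nat.zero_le _
    · exact ⟨mem_supported_Iic_of_ld_eq hw, hdeg⟩
  · rintro ⟨hmem, hdeg⟩
    rcases (show w ≤ u from mem_supported.1 hmem (mem_vars_of_ld_eq hw)).lt_or_eq with hlt | rfl
    · exact Or.inl hlt
    · exact Or.inr ⟨rfl, hdeg⟩

lemma rk_lt_rk_of_degreeOf_lt (h : ld f = u) (hg : g ∈ supported k (Set.Iic u))
    (hd : g.degreeOf u < f.degreeOf u) : rk g < rk f :=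
  lt_of_le_of_ne ((rk_le_rk_iff h).2 ⟨hg, hd.le⟩) fun he => hd.ne (ld_eq_of_rk_eq h he).2

lemma rk_le_rk_of_support_subset (h : f.support ⊆ g.support) : rk f ≤ rk g := by
  by_cases hc : IsConst g
  · have hf : IsConst f := by
      rw [isConst_iff_vars_eq_empty] at hc ⊢
      exact Finset.subset_empty.1 (hc ▸ vars_subset_of_support_subset h)
    exact (rk_eq_bot_iff.2 hf).trans_le bot_le
  obtain ⟨u, hu⟩ := exists_ld_eq hc
  exact (rk_le_rk_iff hu).2 ⟨mem_supported.2 fun w hw =>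
    le_of_ld_eq hu (vars_subset_of_support_subset h hw), degreeOf_le_of_support_subset h u⟩

lemma rk_truncate_le (b : Fin n → ℕ) (f : DPoly k n) : rk (truncate b f) ≤ rk f :=
  rk_le_rk_of_support_subset (support_truncate_subset b f)

end Leaders

section ToPolynomialIn

variable {σ R : Type*} [CommSemiring R]

/-- A polynomial in several indeterminates regarded as a polynomial in the single indeterminate
`i`, the other ones being put into the coefficients. -/
def toPolynomialIn (i : σ) : MvPolynomial σ R →ₐ[R] Polynomial (MvPolynomial σ R) :=
  aeval fun j => if j = i then Polynomial.X else Polynomial.C (X j)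

@[simp] lemma toPolynomialIn_X_self (i : σ) :
    toPolynomialIn i (X i : MvPolynomial σ R) = Polynomial.X := by
  simp [toPolynomialIn]

lemma toPolynomialIn_of_mem_supported {i : σ} {f : MvPolynomial σ R}
    (hf : f ∈ supported R ({i}ᶜ : Set σ)) : toPolynomialIn i f = Polynomial.C f := by
  have hle : supported R ({i}ᶜ : Set σ) ≤
      AlgHom.equalizer (toPolynomialIn i) Polynomial.CAlgHom :=
    supported_le_iff.2 fun j hj =>
      (AlgHom.mem_equalizer _ _ _).2 (by simp [toPolynomialIn, show j ≠ i from hj])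
  exact (AlgHom.mem_equalizer _ _ _).1 (hle hf)

lemma eval_toPolynomialIn (i : σ) (f : MvPolynomial σ R) :
    (toPolynomialIn i f).eval (X i) = f := by
  have hid : ((Polynomial.aeval (X i : MvPolynomial σ R)).restrictScalars R).comp
      (toPolynomialIn i) = AlgHom.id R _ := by
    refine algHom_ext fun j => ?_
    by_cases hj : j = i <;> simp [toPolynomialIn, hj]
  simpa [Polynomial.coe_aeval_eq_eval] using DFunLike.congr_fun hid f

lemma toPolynomialIn_monomial (i : σ) (m : σ →₀ ℕ) (a : R) :
    toPolynomialIn i (monomial m a) =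
      Polynomial.C (monomial (m.erase i) a) * Polynomial.X ^ m i := by
  have hsplit : monomial m a = monomial (m.erase i) a * X i ^ m i := by
    rw [X_pow_eq_monomial, monomial_mul, mul_one, Finsupp.erase_add_single]
  have herase : monomial (m.erase i) a ∈ supported R ({i}ᶜ : Set σ) := by
    refine mem_supported.2 fun j hj hji => ?_
    obtain ⟨m', hm', hj⟩ := (mem_vars_iff_mem_support j).1 hj
    rw [Finset.mem_singleton.1 (support_monomial_subset hm'), Set.mem_singleton_iff.1 hji] at hj
    simp at hj
  rw [hsplit, map_mul, map_pow, toPolynomialIn_X_self, toPolynomialIn_of_mem_supported herase]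

lemma derivative_toPolynomialIn (i : σ) (f : MvPolynomial σ R) :
    Polynomial.derivative (toPolynomialIn i f) = toPolynomialIn i (pderiv i f) := by
  induction f using MvPolynomial.induction_on with
  | C c => simp [toPolynomialIn, Polynomial.algebraMap_apply]
  | add f g hf hg => simp only [map_add, hf, hg]
  | mul_X f j hf =>
    by_cases hj : j = i
    · subst hj
      simp [hf, mul_comm]
    · have hX : X j ∈ supported R ({i}ᶜ : Set σ) := supported_le_iff.1 le_rfl j hj
      simp [hf, toPolynomialIn_of_mem_supported hX, pderiv_X_of_ne hj, mul_comm]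

lemma degreeOf_pderiv_le (i j : σ) (f : MvPolynomial σ R) :
    (pderiv i f).degreeOf j ≤ f.degreeOf j := by
  rw [degreeOf_eq_sup]
  refine Finset.sup_le fun m hm => ?_
  rw [mem_support_iff, coeff_pderiv] at hm
  refine le_trans ?_ (monomial_le_degreeOf j (mem_support_iff.2 (left_ne_zero_of_mul hm)))
  simp

lemma degreeOf_pderiv_lt {i : σ} {f : MvPolynomial σ R} (h : i ∈ f.vars) :
    (pderiv i f).degreeOf i < f.degreeOf i := by
  rw [degreeOf_lt_iff (degreeOf_pos_iff.2 h)]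
  intro m hm
  rw [mem_support_iff, coeff_pderiv] at hm
  have hle := monomial_le_degreeOf i (mem_support_iff.2 (left_ne_zero_of_mul hm))
  rw [Finsupp.add_apply, Finsupp.single_eq_same] at hle
  lia

end ToPolynomialIn

section CoeffOf

variable {k : Type*} [Field k] {n : ℕ} (u : Der n) (t : ℕ) (f : DPoly k n)

lemma coeff_toPolynomialIn : (toPolynomialIn u f).coeff t = coeffOf u t f := by
  conv_lhs => rw [f.as_sum, map_sum, Polynomial.finsetSum_coeff]
  rw [coeffOf, Finset.sum_filter]
  refine Finset.sum_congr rfl fun m _ => ?_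
  rw [toPolynomialIn_monomial, Polynomial.coeff_C_mul_X_pow]
  exact if_congr eq_comm rfl rfl

lemma coeffOf_sub (g : DPoly k n) : coeffOf u t (f - g) = coeffOf u t f - coeffOf u t g := by
  simp only [← coeff_toPolynomialIn, map_sub, Polynomial.coeff_sub]

lemma coeff_coeffOf (m : Der n →₀ ℕ) : (coeffOf u t f).coeff m =
    if m u = 0 then f.coeff (m + Finsupp.single u t) else 0 := by
  have herase : ∀ m' ∈ f.support, (m' u = t ∧ m'.erase u = m ↔
      m u = 0 ∧ m' = m + Finsupp.single u t) := by
    refine fun m' _ => ⟨?_, ?_⟩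
    · rintro ⟨rfl, rfl⟩
      exact ⟨Finsupp.erase_same, (Finsupp.erase_add_single u m').symm⟩
    · rintro ⟨h0, rfl⟩
      refine ⟨by simp [h0], ?_⟩
      rw [Finsupp.erase_add, Finsupp.erase_single, add_zero,
        Finsupp.erase_of_notMem_support (by simpa using h0)]
  simp only [coeffOf, Finset.sum_filter, coeff_sum, apply_ite (coeff m), coeff_monomial, coeff_zero,
    ← ite_and]
  rw [Finset.sum_congr rfl fun m' hm' => if_congr (herase m' hm') rfl rfl]
  split_ifs with h0 <;> simp [h0, eq_comm]

variable {t f} in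
lemma add_single_mem_support_of_mem_support_coeffOf {m : Der n →₀ ℕ}
    (hm : m ∈ (coeffOf u t f).support) : m u = 0 ∧ m + Finsupp.single u t ∈ f.support := by
  rw [mem_support_iff, coeff_coeffOf] at hm
  exact ⟨by_contra fun h0 => hm (if_neg h0), mem_support_iff.2 fun h0 => hm (by simp [h0])⟩

lemma vars_coeffOf_subset [DecidableEq (Der n)] : (coeffOf u t f).vars ⊆ f.vars.erase u := by
  intro w hw
  obtain ⟨m, hm, hwm⟩ := (mem_vars_iff_mem_support _).1 hw
  obtain ⟨h0, hmf⟩ := add_single_mem_support_of_mem_support_coeffOf u hm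
  refine Finset.mem_erase.2 ⟨?_, (mem_vars_iff_mem_support _).2 ⟨_, hmf, ?_⟩⟩
  · rintro rfl
    exact Finsupp.mem_support_iff.1 hwm h0
  · simp only [Finsupp.mem_support_iff, Finsupp.add_apply] at hwm ⊢
    lia

lemma coeffOf_mem_supported_compl : coeffOf u t f ∈ supported k ({u}ᶜ : Set (Der n)) :=
  mem_supported.2 fun _ hw => Finset.ne_of_mem_erase (vars_coeffOf_subset u t f hw)

lemma degreeOf_coeffOf_le (w : Der n) : (coeffOf u t f).degreeOf w ≤ f.degreeOf w := by
  rw [degreeOf_eq_sup]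
  refine Finset.sup_le fun m hm => le_trans ?_
    (monomial_le_degreeOf w (add_single_mem_support_of_mem_support_coeffOf u hm).2)
  simp

lemma coeff_coeffOf_mul_X_pow (m : Der n →₀ ℕ) :
    (coeffOf u t f * X u ^ t).coeff m = if m u = t then f.coeff m else 0 := by
  rw [X_pow_eq_monomial, coeff_mul_monomial', mul_one]
  by_cases hle : Finsupp.single u t ≤ m
  · have htm : t ≤ m u := Finsupp.single_le_iff.1 hle
    rw [if_pos hle, coeff_coeffOf, tsub_add_cancel_of_le hle]
    refine if_congr ?_ rfl rfl
    simp only [Finsupp.tsub_apply, Finsupp.single_eq_same]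
    lia
  · rw [if_neg hle, if_neg fun h => hle (Finsupp.single_le_iff.2 h.ge)]

variable {f} in
lemma coeffOf_degreeOf_ne_zero (h : f ≠ 0) : coeffOf u (f.degreeOf u) f ≠ 0 := by
  obtain ⟨m, hm, hmu⟩ := Finset.exists_mem_eq_sup f.support (support_nonempty.2 h) (fun m => m u)
  rw [← degreeOf_eq_sup] at hmu
  intro h0
  have hcoeff := coeff_coeffOf_mul_X_pow u (f.degreeOf u) f m
  rw [h0, zero_mul, coeff_zero, if_pos hmu.symm] at hcoeff
  exact mem_support_iff.1 hm hcoeff.symm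

lemma natDegree_toPolynomialIn : (toPolynomialIn u f).natDegree = f.degreeOf u := by
  by_cases h : f = 0
  · simp [h]
  refine le_antisymm (Polynomial.natDegree_le_iff_coeff_eq_zero.2 fun t ht => ?_)
    (Polynomial.le_natDegree_of_ne_zero ?_)
  · rw [coeff_toPolynomialIn, ← support_eq_empty, Finset.eq_empty_iff_forall_notMem]
    intro m hm
    have hle := monomial_le_degreeOf u (add_single_mem_support_of_mem_support_coeffOf u hm).2
    rw [Finsupp.add_apply, Finsupp.single_eq_same] at hle
    lia
  · rw [coeff_toPolynomialIn]
    exact coeffOf_degreeOf_ne_zero u h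

lemma coeffOf_eq_zero_of_degreeOf_lt {t : ℕ} (h : f.degreeOf u < t) : coeffOf u t f = 0 := by
  rw [← coeff_toPolynomialIn]
  exact Polynomial.coeff_eq_zero_of_natDegree_lt (by rwa [natDegree_toPolynomialIn])

/-- What is left of `f` after removing its terms of highest degree in `u`. -/
def tailIn : DPoly k n := f - coeffOf u (f.degreeOf u) f * X u ^ f.degreeOf u

lemma coeffOf_mul_add_tailIn :
    coeffOf u (f.degreeOf u) f * X u ^ f.degreeOf u + tailIn u f = f :=
  add_sub_cancel _ _

lemma mem_support_tailIn {m : Der n →₀ ℕ} :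
    m ∈ (tailIn u f).support ↔ m ∈ f.support ∧ m u ≠ f.degreeOf u := by
  rw [mem_support_iff, mem_support_iff, tailIn, coeff_sub, coeff_coeffOf_mul_X_pow]
  split_ifs with h <;> simp [h]

lemma support_tailIn_subset : (tailIn u f).support ⊆ f.support :=
  fun _ hm => ((mem_support_tailIn u f).1 hm).1

variable {u f} in
lemma degreeOf_tailIn_lt (h : u ∈ f.vars) : (tailIn u f).degreeOf u < f.degreeOf u := by
  rw [degreeOf_lt_iff (degreeOf_pos_iff.2 h)]
  intro m hm
  obtain ⟨hmf, hne⟩ := (mem_support_tailIn u f).1 hm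
  exact lt_of_le_of_ne (monomial_le_degreeOf u hmf) hne

end CoeffOf

section RegularElements

variable {R : Type*} [CommRing R] {I : Ideal R}

lemma isSMulRegular_quotient_congr {s t : R} (h : s - t ∈ I) :
    IsSMulRegular (R ⧸ I) s ↔ IsSMulRegular (R ⧸ I) t := by
  have hsmul : ∀ x : R ⧸ I, s • x = t • x := fun x => by
    rw [Algebra.smul_def, Algebra.smul_def, Ideal.Quotient.algebraMap_eq,
      Ideal.Quotient.eq.2 h]
  simp only [IsSMulRegular, hsmul]

lemma isSMulRegular_of_mem_closure {M : Type*} [MulAction R M]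
    {S : Set R} (h : ∀ s ∈ S, IsSMulRegular M s) {t : R} (ht : t ∈ Submonoid.closure S) :
    IsSMulRegular M t := by
  induction ht using Submonoid.closure_induction with
  | mem s hs => exact h s hs
  | one => exact IsSMulRegular.one M
  | mul s t _ _ hs ht => exact hs.mul ht

end RegularElements

section Saturation

variable {k : Type*} [Field k] {n : ℕ} {I J : Ideal (DPoly k n)} {S T : Set (DPoly k n)}

lemma le_sat (I : Ideal (DPoly k n)) (S : Set (DPoly k n)) : I ≤ sat I S :=
  fun a ha => ⟨1, one_mem _, by rwa [one_mul]⟩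

lemma sat_mono (hI : I ≤ J) (hS : S ⊆ T) : sat I S ≤ sat J T :=
  fun _ ⟨s, hs, ha⟩ => ⟨s, Submonoid.closure_mono hS hs, hI ha⟩

lemma sat_le (hI : I ≤ J) (hS : ∀ s ∈ S, IsSMulRegular (DPoly k n ⧸ J) s) : sat I S ≤ J :=
  fun _ ⟨_, hs, ha⟩ =>
    mem_of_isSMulRegular_quotient_of_smul_mem (isSMulRegular_of_mem_closure hS hs) (hI ha)

lemma isSMulRegular_quotient_sat {s : DPoly k n} (hs : s ∈ Submonoid.closure S) :
    IsSMulRegular (DPoly k n ⧸ sat I S) s :=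
  (isSMulRegular_quotient_iff_mem_of_smul_mem _ s).2 fun x ⟨t, ht, hx⟩ =>
    ⟨t * s, mul_mem ht hs, by rwa [mul_assoc]⟩

lemma mem_sat_of_mul_mem_sat {s a : DPoly k n} (hs : s ∈ Submonoid.closure S)
    (ha : s * a ∈ sat I S) : a ∈ sat I S :=
  mem_of_isSMulRegular_quotient_of_smul_mem (isSMulRegular_quotient_sat hs) ha

lemma sat_isRadical (hI : I.IsRadical) (S : Set (DPoly k n)) : (sat I S).IsRadical := by
  rintro a ⟨m, s, hs, ha⟩
  refine ⟨s, hs, hI ⟨m + 1, ?_⟩⟩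
  have hmul := I.mul_mem_left (s ^ m * a) ha
  rwa [show s ^ m * a * (s * a ^ m) = (s * a) ^ (m + 1) by ring] at hmul

lemma sat_sat (h : S ⊆ T) : sat (sat I S) T = sat I T := by
  refine le_antisymm (fun a ⟨t, ht, s, hs, ha⟩ => ?_) (sat_mono (le_sat I S) le_rfl)
  exact ⟨s * t, mul_mem (Submonoid.closure_mono h hs) ht, by rwa [mul_assoc]⟩

end Saturation

section DifferentialIdeals

variable {k : Type*} [Field k] [Differential k] {n : ℕ}
  {F G : Set (DPoly k n)} {I : Ideal (DPoly k n)}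

lemma subset_diffIdeal (F : Set (DPoly k n)) : F ⊆ diffIdeal F :=
  fun _ hf => Ideal.mem_sInf.2 fun _ hI => hI.2 hf

lemma isDiffIdeal_diffIdeal (F : Set (DPoly k n)) : IsDiffIdeal (diffIdeal F) :=
  fun _ hf => Ideal.mem_sInf.2 fun _ hI => hI.1 _ (Ideal.mem_sInf.1 hf hI)

lemma diffIdeal_le (hI : IsDiffIdeal I) (h : F ⊆ I) : diffIdeal F ≤ I :=
  sInf_le ⟨hI, h⟩

lemma subset_radDiffIdeal (F : Set (DPoly k n)) : F ⊆ radDiffIdeal F :=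
  fun _ hf => Ideal.mem_sInf.2 fun _ hI => hI.2.2 hf

lemma isDiffIdeal_radDiffIdeal (F : Set (DPoly k n)) : IsDiffIdeal (radDiffIdeal F) :=
  fun _ hf => Ideal.mem_sInf.2 fun _ hI => hI.1 _ (Ideal.mem_sInf.1 hf hI)

lemma radDiffIdeal_isRadical (F : Set (DPoly k n)) : (radDiffIdeal F).IsRadical :=
  fun _ ⟨m, hm⟩ => Ideal.mem_sInf.2 fun _ hI => hI.2.1 ⟨m, Ideal.mem_sInf.1 hm hI⟩

lemma radDiffIdeal_le (hI : IsDiffIdeal I) (hr : I.IsRadical) (h : F ⊆ I) : radDiffIdeal F ≤ I :=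
  sInf_le ⟨hI, hr, h⟩

lemma radDiffIdeal_mono (h : F ⊆ G) : radDiffIdeal F ≤ radDiffIdeal G :=
  radDiffIdeal_le (isDiffIdeal_radDiffIdeal G) (radDiffIdeal_isRadical G)
    (h.trans (subset_radDiffIdeal G))

lemma isDiffIdeal_sat (hI : IsDiffIdeal I) (S : Set (DPoly k n)) : IsDiffIdeal (sat I S) := by
  rintro a ⟨s, hs, ha⟩
  refine ⟨s * s, mul_mem hs hs, ?_⟩
  have hmem := I.sub_mem (I.mul_mem_left s (hI _ ha)) (I.mul_mem_left (delta s) ha)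
  rw [delta_mul] at hmem
  rwa [show s * (s * delta a + a * delta s) - delta s * (s * a) = s * s * delta a by ring] at hmem

lemma iterate_delta_mem (hI : IsDiffIdeal I) {f : DPoly k n} (hf : f ∈ I) (j : ℕ) :
    delta^[j] f ∈ I := by
  induction j with
  | zero => exact hf
  | succ j ih =>
    rw [Function.iterate_succ_apply']
    exact hI _ ih

lemma isDiffIdeal_span (h : ∀ f ∈ F, delta f ∈ Ideal.span F) : IsDiffIdeal (Ideal.span F) := by
  intro x hx
  induction hx using Submodule.span_induction with
  | mem f hf => exact h f hf
  | zero => rw [delta_zero]; exact zero_mem _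
  | add x y _ _ hx hy =>
    rw [delta_add]
    exact add_mem hx hy
  | smul a x hx hdx =>
    rw [smul_eq_mul, delta_mul]
    exact add_mem (Ideal.mul_mem_left _ _ hdx) (Ideal.mul_mem_right _ _ hx)

lemma diffIdeal_eq_span (F : Set (DPoly k n)) :
    diffIdeal F = Ideal.span {x | ∃ f ∈ F, ∃ j, x = delta^[j] f} := by
  refine le_antisymm (diffIdeal_le (isDiffIdeal_span ?_) ?_) (Ideal.span_le.2 ?_)
  · rintro _ ⟨f, hf, j, rfl⟩
    exact Ideal.subset_span ⟨f, hf, j + 1, (Function.iterate_succ_apply' ..).symm⟩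
  · exact fun f hf => Ideal.subset_span ⟨f, hf, 0, rfl⟩
  · rintro _ ⟨f, hf, j, rfl⟩
    exact iterate_delta_mem (isDiffIdeal_diffIdeal F) (subset_diffIdeal F hf) j

lemma delta_mul_mem_of_mul_mem (hI : IsDiffIdeal I) (hr : I.IsRadical) {a b : DPoly k n}
    (h : a * b ∈ I) : delta a * b ∈ I := by
  refine hr ⟨2, ?_⟩
  have hmem := I.sub_mem (I.mul_mem_left (delta a * b) (hI _ h))
    (I.mul_mem_left (delta a * delta b) h)
  rw [delta_mul] at hmem
  rwa [show delta a * b * (a * delta b + b * delta a) - delta a * delta b * (a * b) =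
    (delta a * b) ^ 2 by ring] at hmem

lemma mul_mem_of_mem_radDiffIdeal (hI : IsDiffIdeal I) (hr : I.IsRadical) {y : DPoly k n}
    (hF : ∀ f ∈ F, f * y ∈ I) {z : DPoly k n} (hz : z ∈ radDiffIdeal F) : z * y ∈ I := by
  let J : Ideal (DPoly k n) := Submodule.comap (LinearMap.mulRight (DPoly k n) y) I
  have hJ : radDiffIdeal F ≤ J := by
    refine radDiffIdeal_le (fun a ha => delta_mul_mem_of_mul_mem hI hr ha) ?_ hF
    rintro a ⟨m, hm : a ^ m * y ∈ I⟩
    refine hr ⟨m + 1, ?_⟩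
    have hmul := I.mul_mem_left (a * y ^ m) hm
    rwa [show a * y ^ m * (a ^ m * y) = (a * y) ^ (m + 1) by ring] at hmul
  exact hJ hz

lemma mem_sat_radDiffIdeal_of_mem_insert {H : Set (DPoly k n)} {e y : DPoly k n}
    (hey : e * y ∈ sat (radDiffIdeal F) H) (hy : y ∈ sat (radDiffIdeal (insert e F)) H) :
    y ∈ sat (radDiffIdeal F) H := by
  have hr := sat_isRadical (radDiffIdeal_isRadical F) H
  obtain ⟨s, hs, hsy⟩ := hy
  have hmul : s * y * y ∈ sat (radDiffIdeal F) H := by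
    refine mul_mem_of_mem_radDiffIdeal (isDiffIdeal_sat (isDiffIdeal_radDiffIdeal F) H) hr ?_ hsy
    rintro f (rfl | hf)
    · exact hey
    · exact Ideal.mul_mem_right _ _ (le_sat _ _ (subset_radDiffIdeal F hf))
  refine hr ⟨2, ?_⟩
  rw [pow_two]
  exact mem_sat_of_mul_mem_sat hs (by rwa [← mul_assoc])

lemma mem_sat_radDiffIdeal_of_forall_mem_insert {H E : Set (DPoly k n)} {y : DPoly k n}
    (hy : y ∈ sat (radDiffIdeal F) (H ∪ E))
    (hE : ∀ e ∈ E, IsUnit e ∨ y ∈ sat (radDiffIdeal (insert e F)) H) :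
    y ∈ sat (radDiffIdeal F) H := by
  obtain ⟨t, ht, hty⟩ := hy
  replace hty := le_sat _ H hty
  induction ht using Submonoid.closure_induction generalizing y with
  | mem e he =>
    rcases he with he | he
    · exact mem_sat_of_mul_mem_sat (Submonoid.subset_closure he) hty
    · rcases hE e he with hu | hins
      · exact (Ideal.unit_mul_mem_iff_mem _ hu).1 hty
      · exact mem_sat_radDiffIdeal_of_mem_insert hty hins
  | one => rwa [one_mul] at hty
  | mul a b _ _ iha ihb =>
    refine ihb hE (iha (fun e he => ?_) (by rwa [← mul_assoc]))
    exact (hE e he).imp_right fun h => Ideal.mul_mem_left _ _ h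

end DifferentialIdeals

section Initials

variable {k : Type*} [Field k] {n : ℕ} [LinearOrder (Der n)]

lemma initial_mem_initSep {A : Finset (DPoly k n)} {d : DPoly k n} (h : d ∈ A) :
    initial d ∈ initSep A :=
  Finset.mem_union_left _ (Finset.mem_image_of_mem _ h)

lemma separant_mem_initSep {A : Finset (DPoly k n)} {d : DPoly k n} (h : d ∈ A) :
    separant d ∈ initSep A :=
  Finset.mem_union_right _ (Finset.mem_image_of_mem _ h)

lemma mem_initSep {A : Finset (DPoly k n)} {x : DPoly k n} :
    x ∈ initSep A ↔ ∃ d ∈ A, x = initial d ∨ x = separant d := by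
  simp only [initSep, Finset.mem_union, Finset.mem_image, and_or_left, exists_or, eq_comm]

lemma initSep_mono {A B : Finset (DPoly k n)} (h : A ⊆ B) : initSep A ⊆ initSep B :=
  Finset.union_subset_union (Finset.image_subset_image h) (Finset.image_subset_image h)

lemma vars_initial_subset (f : DPoly k n) : (initial f).vars ⊆ f.vars := by
  rw [initial]
  split_ifs with hne
  · exact (vars_coeffOf_subset _ _ f).trans (Finset.erase_subset _ _)
  · rw [vars_0]
    exact Finset.empty_subset _

lemma vars_separant_subset (f : DPoly k n) : (separant f).vars ⊆ f.vars := by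
  rw [separant]
  split_ifs with hne
  · exact vars_pderiv_subset _ f
  · rw [vars_0]
    exact Finset.empty_subset _

lemma initSep_mem_supported {S : Set (Der n)} {A : Finset (DPoly k n)}
    (hA : ∀ d ∈ A, d ∈ supported k S) {x : DPoly k n} (hx : x ∈ initSep A) :
    x ∈ supported k S := by
  obtain ⟨d, hd, rfl | rfl⟩ := mem_initSep.1 hx
  · exact mem_supported.2
      ((Finset.coe_subset.2 (vars_initial_subset d)).trans (mem_supported.1 (hA d hd)))
  · exact mem_supported.2
      ((Finset.coe_subset.2 (vars_separant_subset d)).trans (mem_supported.1 (hA d hd)))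

lemma closure_initSep_mem_supported {S : Set (Der n)} {A : Finset (DPoly k n)}
    (hA : ∀ d ∈ A, d ∈ supported k S) {x : DPoly k n}
    (hx : x ∈ Submonoid.closure (initSep A : Set (DPoly k n))) : x ∈ supported k S :=
  (Submonoid.closure_le (S := (supported k S).toSubmonoid)).2
    (fun _ hy => initSep_mem_supported hA hy) hx

lemma initial_mem_supported_Iio {f : DPoly k n} {u : Der n} (h : ld f = u) :
    initial f ∈ supported k (Set.Iio u) := by
  rw [initial_eq_coeffOf h]
  refine mem_supported.2 fun w hw => ?_
  obtain ⟨hne, hwf⟩ := Finset.mem_erase.1 (vars_coeffOf_subset u _ f hw)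
  exact lt_of_le_of_ne (le_of_ld_eq h hwf) hne

lemma separant_mem_supported_Iic {f : DPoly k n} {u : Der n} (h : ld f = u) :
    separant f ∈ supported k (Set.Iic u) :=
  mem_supported.2 fun _ hw => le_of_ld_eq h (vars_separant_subset f hw)

lemma initial_ne_zero {f : DPoly k n} (h : ¬ IsConst f) : initial f ≠ 0 := by
  obtain ⟨u, hu⟩ := exists_ld_eq h
  rw [initial_eq_coeffOf hu]
  refine coeffOf_degreeOf_ne_zero u ?_
  rintro rfl
  exact h ⟨0, (map_zero _).symm⟩

lemma separant_ne_zero [CharZero k] {f : DPoly k n} (h : ¬ IsConst f) : separant f ≠ 0 := by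
  obtain ⟨u, hu⟩ := exists_ld_eq h
  rw [separant_eq_pderiv hu]
  exact pderiv_ne_zero (mem_vars_of_ld_eq hu)

lemma rk_initial_lt {f : DPoly k n} (h : ¬ IsConst f) : rk (initial f) < rk f := by
  obtain ⟨u, hu⟩ := exists_ld_eq h
  have hini := initial_mem_supported_Iio hu
  refine rk_lt_rk_of_degreeOf_lt hu (supported_mono Set.Iio_subset_Iic_self hini) ?_
  rw [degreeOf_eq_zero_of_mem_supported hini Set.self_notMem_Iio]
  exact degreeOf_pos_iff.2 (mem_vars_of_ld_eq hu)

lemma rk_separant_lt {f : DPoly k n} (h : ¬ IsConst f) : rk (separant f) < rk f := by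
  obtain ⟨u, hu⟩ := exists_ld_eq h
  refine rk_lt_rk_of_degreeOf_lt hu (separant_mem_supported_Iic hu) ?_
  rw [separant_eq_pderiv hu]
  exact degreeOf_pderiv_lt (mem_vars_of_ld_eq hu)

end Initials

section Autoreduced

variable {k : Type*} [Field k] {n : ℕ} [LinearOrder (Der n)] {f f' g : DPoly k n} {u w : Der n}
  {A B : Finset (DPoly k n)}

lemma PartReduced.of_vars_subset (h : PartReduced f g) (hv : f'.vars ⊆ f.vars) :
    PartReduced f' g :=
  fun u hu j hj hm => h u hu j hj (hv hm)

lemma Reduced.of_vars_subset_of_degreeOf_le (h : Reduced f g) (hv : f'.vars ⊆ f.vars)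
    (hd : ∀ u, f'.degreeOf u ≤ f.degreeOf u) : Reduced f' g :=
  ⟨h.1.of_vars_subset hv, fun u hu => (hd u).trans_lt (h.2 u hu)⟩

lemma Reduced.truncate (h : Reduced f g) (b : Fin n → ℕ) : Reduced (truncate b f) g :=
  h.of_vars_subset_of_degreeOf_le (vars_subset_of_support_subset (support_truncate_subset b f))
    fun u => degreeOf_le_of_support_subset (support_truncate_subset b f) u

lemma Reduced.initial (h : Reduced f g) (hc : ¬ IsConst f) : Reduced (initial f) g := by
  refine h.of_vars_subset_of_degreeOf_le (vars_initial_subset f) fun w => ?_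
  obtain ⟨u, hu⟩ := exists_ld_eq hc
  rw [initial_eq_coeffOf hu]
  exact degreeOf_coeffOf_le u _ f w

lemma Reduced.separant (h : Reduced f g) (hc : ¬ IsConst f) : Reduced (separant f) g := by
  refine h.of_vars_subset_of_degreeOf_le (vars_separant_subset f) fun w => ?_
  obtain ⟨u, hu⟩ := exists_ld_eq hc
  rw [separant_eq_pderiv hu]
  exact degreeOf_pderiv_le u w f

lemma PartReduced.ord_le (h : PartReduced f g) (hf : w ∈ f.vars) (hg : ld g = u)
    (hv : w.var = u.var) : w.ord ≤ u.ord := by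
  by_contra! hlt
  refine h u hg (w.ord - u.ord) (by lia) ?_
  rwa [show u.shift (w.ord - u.ord) = w by ext <;> simp [hv]; lia]

lemma partReduced_self (hR : IsRanking n) (f : DPoly k n) : PartReduced f f :=
  fun u hu _ hj hm => (le_of_ld_eq hu hm).not_gt (hR.lt_shift u hj)

lemma Autoreduced.subset (hB : Autoreduced B) (h : A ⊆ B) : Autoreduced A :=
  ⟨fun f hf => hB.1 f (h hf), fun f hf g hg => hB.2 f (h hf) g (h hg)⟩

lemma Autoreduced.partReduced (hR : IsRanking n) (hA : Autoreduced A) (hf : f ∈ A) (hg : g ∈ A) :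
    PartReduced f g := by
  rcases eq_or_ne f g with rfl | h
  · exact partReduced_self hR f
  · exact (hA.2 f hf g hg h).1

lemma Autoreduced.eq_of_var_eq (hA : Autoreduced A) (hf : f ∈ A) (hg : g ∈ A) (hu : ld f = u)
    (hw : ld g = w) (h : u.var = w.var) : f = g := by
  by_contra hne
  have hfg := hA.2 f hf g hg hne
  have hgf := hA.2 g hg f hf (Ne.symm hne)
  obtain rfl : u = w := Der.ext h (le_antisymm (hfg.1.ord_le (mem_vars_of_ld_eq hu) hw h)
    (hgf.1.ord_le (mem_vars_of_ld_eq hw) hu h.symm))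
  exact lt_asymm (hfg.2 u hw) (hgf.2 u hu)

lemma Autoreduced.eq_of_shift_eq (hA : Autoreduced A) (hf : f ∈ A) (hg : g ∈ A) (hu : ld f = u)
    (hw : ld g = w) {i j : ℕ} (h : u.shift i = w.shift j) : f = g ∧ i = j := by
  have hvar : u.var = w.var := by simpa using congrArg Der.var h
  obtain rfl := hA.eq_of_var_eq hf hg hu hw hvar
  obtain rfl : u = w := WithBot.coe_inj.1 (hu.symm.trans hw)
  exact ⟨rfl, by simpa using congrArg Der.ord h⟩

end Autoreduced

section Elimination

variable {σ R : Type*} [CommRing R] {i : σ} {s r y : MvPolynomial σ R}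
  {M : Set (MvPolynomial σ R)}

lemma exists_pow_mul_mem_span_of_mem_span_insert (hs : s ∈ supported R ({i}ᶜ : Set σ))
    (hr : r ∈ supported R ({i}ᶜ : Set σ)) (hM : ∀ m ∈ M, m ∈ supported R ({i}ᶜ : Set σ))
    (hy : y ∈ supported R ({i}ᶜ : Set σ)) (h : y ∈ Ideal.span (insert (s * X i + r) M)) :
    ∃ N : ℕ, s ^ N * y ∈ Ideal.span M := by
  let L := Localization.Away s
  -- Solving `s * X i + r = 0` for `X i` over `L` kills the extra generator.
  let root : L := -IsLocalization.mk' L r (⟨s, Submonoid.mem_powers s⟩ : Submonoid.powers s)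
  let φ : MvPolynomial σ R →+* L := (Polynomial.eval₂RingHom (algebraMap _ L) root).comp
    (toPolynomialIn i).toRingHom
  have hφ : ∀ f ∈ supported R ({i}ᶜ : Set σ), φ f = algebraMap _ L f := by
    intro f hf
    simp [φ, toPolynomialIn_of_mem_supported hf]
  have hφp : φ (s * X i + r) = 0 := by
    have hX : φ (X i) = root := by simp [φ]
    rw [map_add, map_mul, hφ s hs, hφ r hr, hX, mul_neg, IsLocalization.mk'_spec'_mk,
      neg_add_cancel]
  have hle : Ideal.span (insert (s * X i + r) M) ≤
      ((Ideal.span M).map (algebraMap _ L)).comap φ := by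
    refine Ideal.span_le.2 (Set.insert_subset ?_ fun m hm => ?_)
    · rw [SetLike.mem_coe, Ideal.mem_comap, hφp]
      exact zero_mem _
    · rw [SetLike.mem_coe, Ideal.mem_comap, hφ m (hM m hm)]
      exact Ideal.mem_map_of_mem _ (Ideal.subset_span hm)
  have hyL : algebraMap _ L y ∈ (Ideal.span M).map (algebraMap _ L) := by
    rw [← hφ y hy]
    exact hle h
  obtain ⟨_, ⟨N, rfl⟩, hN⟩ :=
    (IsLocalization.algebraMap_mem_map_algebraMap_iff (Submonoid.powers s) L _ y).1 hyL
  exact ⟨N, hN⟩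

end Elimination

section CoefficientIdeals

variable {k : Type*} [Field k] {n : ℕ} {u : Der n} {f : DPoly k n} {I : Ideal (DPoly k n)}

lemma coeffOf_mem_span {M : Set (DPoly k n)} (hM : ∀ m ∈ M, m ∈ supported k ({u}ᶜ : Set (Der n)))
    (hf : f ∈ Ideal.span M) (t : ℕ) : coeffOf u t f ∈ Ideal.span M := by
  have hle : Ideal.span M ≤ ((Ideal.span M).map Polynomial.C).comap (toPolynomialIn u) := by
    refine Ideal.span_le.2 fun m hm => ?_
    rw [SetLike.mem_coe, Ideal.mem_comap, toPolynomialIn_of_mem_supported (hM m hm)]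
    exact Ideal.mem_map_of_mem _ (Ideal.subset_span hm)
  rw [← coeff_toPolynomialIn]
  exact Ideal.mem_map_C_iff.1 (hle hf) t

lemma coeffOf_mul_of_mem_supported {g : DPoly k n} (hg : g ∈ supported k ({u}ᶜ : Set (Der n)))
    (f : DPoly k n) (t : ℕ) : coeffOf u t (g * f) = g * coeffOf u t f := by
  rw [← coeff_toPolynomialIn, map_mul, toPolynomialIn_of_mem_supported hg, Polynomial.coeff_C_mul,
    coeff_toPolynomialIn]

lemma mem_of_forall_coeffOf_mem (h : ∀ t, coeffOf u t f ∈ I) : f ∈ I := by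
  rw [← eval_toPolynomialIn u f, Polynomial.eval_eq_sum_range]
  exact sum_mem fun t _ => I.mul_mem_right _ (coeff_toPolynomialIn u t f ▸ h t)

lemma pderiv_mem_of_forall_coeffOf_mem (h : ∀ t, coeffOf u t f ∈ I) : pderiv u f ∈ I := by
  refine mem_of_forall_coeffOf_mem (u := u) fun t => ?_
  rw [← coeff_toPolynomialIn, ← derivative_toPolynomialIn, Polynomial.coeff_derivative,
    coeff_toPolynomialIn]
  exact I.mul_mem_right _ (h _)

end CoefficientIdeals

section Rosenfeld

variable {k : Type*} [Field k] [Differential k] {n : ℕ} [LinearOrder (Der n)]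
  {D D' : Finset (DPoly k n)} {B B' : Set (Der n)} {d f x : DPoly k n} {u v : Der n} {j : ℕ}

lemma delta_mem_supported_Iio (hR : IsRanking n) (hf : f ∈ supported k (Set.Iio v)) :
    delta f ∈ supported k (Set.Iio (v.shift 1)) :=
  delta_mem_subalgebra (fun _ hw => X_mem_supported.2 (lt_of_lt_of_le hw (hR.le_shift v 1)))
    (fun _ hw => X_mem_supported.2 (hR.shift_lt_shift (Set.mem_Iio.1 hw) 1)) hf

lemma exists_iterate_delta_eq (hR : IsRanking n) (hu : ld d = u) (hj : 0 < j) :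
    ∃ r ∈ supported k (Set.Iio (u.shift j)), delta^[j] d = separant d * X (u.shift j) + r := by
  induction j, hj using Nat.le_induction with
  | base =>
    refine ⟨delta d - pderiv u d * X (u.shift 1), ?_, ?_⟩
    · refine delta_sub_pderiv_mul_mem_subalgebra u (s := Set.Iic u)
        (fun w hw => X_mem_supported.2 ?_) (fun w hw hne => X_mem_supported.2 ?_)
        (mem_supported_Iic_of_ld_eq hu)
      · exact lt_of_le_of_lt hw (hR.lt_shift u one_pos)
      · exact hR.shift_lt_shift (lt_of_le_of_ne hw hne) 1
    · rw [separant_eq_pderiv hu, Function.iterate_one, add_sub_cancel]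
  | succ j hj ih =>
    obtain ⟨r, hr, h⟩ := ih
    have hs : separant d ∈ supported k (Set.Iio (u.shift j)) :=
      supported_mono (fun w hw => lt_of_le_of_lt hw (hR.lt_shift u hj))
        (separant_mem_supported_Iic hu)
    have hX : (X (u.shift j) : DPoly k n) ∈ supported k (Set.Iio ((u.shift j).shift 1)) :=
      X_mem_supported.2 (hR.lt_shift _ one_pos)
    rw [← Der.shift_shift]
    refine ⟨X (u.shift j) * delta (separant d) + delta r, add_mem
      (mul_mem hX (delta_mem_supported_Iio hR hs)) (delta_mem_supported_Iio hR hr), ?_⟩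
    rw [Function.iterate_succ_apply', h, delta_add, delta_mul, delta_X]
    ring

/-- The elements of `D`, together with those of their proper derivatives whose leader lies in
`B`. -/
def prolongation (D : Finset (DPoly k n)) (B : Set (Der n)) : Set (DPoly k n) :=
  D ∪ {x | ∃ d ∈ D, ∃ (u : Der n) (j : ℕ), ld d = u ∧ 0 < j ∧ u.shift j ∈ B ∧ x = delta^[j] d}

lemma prolongation_mono (D : Finset (DPoly k n)) (h : B ⊆ B') :
    prolongation D B ⊆ prolongation D B' :=
  Set.union_subset_union_right _ fun _ ⟨d, hd, u, j, hu, hj, hB, hx⟩ =>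
    ⟨d, hd, u, j, hu, hj, h hB, hx⟩

lemma prolongation_empty (D : Finset (DPoly k n)) : prolongation D ∅ = D := by
  simp [prolongation]

lemma mem_supported_compl_of_mem_prolongation (hR : IsRanking n)
    (hD : ∀ d ∈ D, d ∈ supported k ({v}ᶜ : Set (Der n))) (hB : B ⊆ Set.Iio v)
    (hx : x ∈ prolongation D B) : x ∈ supported k ({v}ᶜ : Set (Der n)) := by
  rcases hx with hx | ⟨d, hd, u, j, hu, hj, huB, rfl⟩
  · exact hD x hx
  obtain ⟨r, hr, hdj⟩ := exists_iterate_delta_eq hR hu hj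
  have hlt : u.shift j < v := hB huB
  rw [hdj]
  exact add_mem
    (mul_mem (initSep_mem_supported hD (separant_mem_initSep hd))
      (X_mem_supported.2 hlt.ne))
    (supported_mono (fun w (hw : w < _) => (hw.trans hlt).ne) hr)

lemma prolongation_insert_shift_subset (hD : Autoreduced D) (hd : d ∈ D) (hu : ld d = u) :
    prolongation D (insert (u.shift j) B) ⊆ insert (delta^[j] d) (prolongation D B) := by
  rintro x (hx | ⟨d', hd', u', i, hu', hi, h | h, rfl⟩)
  · exact Or.inr (Or.inl hx)
  · obtain ⟨rfl, rfl⟩ := hD.eq_of_shift_eq hd' hd hu' hu h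
    exact Or.inl rfl
  · exact Or.inr (Or.inr ⟨d', hd', u', i, hu', hi, h, rfl⟩)

lemma prolongation_insert_subset
    (h : ∀ d ∈ D, ∀ u : Der n, ld d = u → ∀ j, 0 < j → u.shift j ≠ v) :
    prolongation D (insert v B) ⊆ prolongation D B := by
  rintro x (hx | ⟨d, hd, u, j, hu, hj, huB, rfl⟩)
  · exact Or.inl hx
  · exact Or.inr ⟨d, hd, u, j, hu, hj, huB.resolve_left (h d hd u hu j hj), rfl⟩

lemma exists_finset_mem_span_prolongation (hD : ∀ d ∈ D, ¬ IsConst d)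
    (hx : x ∈ diffIdeal (D : Set (DPoly k n))) :
    ∃ T : Finset (Der n), x ∈ Ideal.span (prolongation D T) := by
  rw [diffIdeal_eq_span] at hx
  induction hx using Submodule.span_induction with
  | mem x hx =>
    obtain ⟨d, hd, j, rfl⟩ := hx
    rcases Nat.eq_zero_or_pos j with rfl | hj
    · exact ⟨∅, Ideal.subset_span (Or.inl hd)⟩
    · obtain ⟨u, hu⟩ := exists_ld_eq (hD d hd)
      exact ⟨{u.shift j}, Ideal.subset_span (Or.inr ⟨d, hd, u, j, hu, hj, by simp, rfl⟩)⟩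
  | zero => exact ⟨∅, zero_mem _⟩
  | add x y _ _ hx hy =>
    obtain ⟨T, hT⟩ := hx
    obtain ⟨T', hT'⟩ := hy
    exact ⟨T ∪ T', add_mem
      (Ideal.span_mono (prolongation_mono D (Finset.coe_subset.2 Finset.subset_union_left)) hT)
      (Ideal.span_mono (prolongation_mono D (Finset.coe_subset.2 Finset.subset_union_right)) hT')⟩
  | smul a x _ hx =>
    obtain ⟨T, hT⟩ := hx
    exact ⟨T, Ideal.mul_mem_left _ _ hT⟩

lemma exists_mul_mem_span_prolongation_of_insert (hR : IsRanking n) (hD : Autoreduced D)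
    (hB : B ⊆ Set.Iio v) {s : DPoly k n}
    (hs : s ∈ Submonoid.closure (initSep D : Set (DPoly k n)))
    (hsx : s * x ∈ Ideal.span (prolongation D (insert v B)))
    (hfree : ∀ d ∈ D, ∀ u : Der n, ld d = u → ∀ j, 0 < j → u.shift j = v → v ∉ x.vars) :
    ∃ t ∈ Submonoid.closure (initSep D : Set (DPoly k n)),
      t * x ∈ Ideal.span (prolongation D B) := by
  by_cases hv : ∀ d ∈ D, ∀ u : Der n, ld d = u → ∀ j, 0 < j → u.shift j ≠ v
  · exact ⟨s, hs, Ideal.span_mono (prolongation_insert_subset hv) hsx⟩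
  push Not at hv
  obtain ⟨d, hd, u, hu, j, hj, rfl⟩ := hv
  have hDv : ∀ d' ∈ D, d' ∈ supported k ({u.shift j}ᶜ : Set (Der n)) := fun d' hd' =>
    mem_supported.2 fun w hw hwu => hD.partReduced hR hd' hd u hu j hj (hwu ▸ hw)
  obtain ⟨r, hr, hdj⟩ := exists_iterate_delta_eq hR hu hj
  have hspan := Ideal.span_mono (prolongation_insert_shift_subset hD hd hu) hsx
  rw [hdj] at hspan
  have hxv : x ∈ supported k ({u.shift j}ᶜ : Set (Der n)) :=
    mem_supported.2 fun w hw hwu => hfree d hd u hu j hj rfl (hwu ▸ hw)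
  obtain ⟨N, hN⟩ := exists_pow_mul_mem_span_of_mem_span_insert
    (initSep_mem_supported hDv (separant_mem_initSep hd))
    (supported_mono (fun w (hw : w < _) => hw.ne) hr)
    (fun m hm => mem_supported_compl_of_mem_prolongation hR hDv hB hm)
    (mul_mem (closure_initSep_mem_supported hDv hs) hxv) hspan
  refine ⟨separant d ^ N * s,
    mul_mem (pow_mem (Submonoid.subset_closure (separant_mem_initSep hd)) N) hs, ?_⟩
  rwa [mul_assoc]

/-- The differential ideal `[D] : H_D^∞`. -/
def regIdeal (D : Finset (DPoly k n)) : Ideal (DPoly k n) :=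
  sat (diffIdeal (D : Set (DPoly k n))) (initSep D)

lemma isDiffIdeal_regIdeal (D : Finset (DPoly k n)) : IsDiffIdeal (regIdeal D) :=
  isDiffIdeal_sat (isDiffIdeal_diffIdeal _) _

lemma mem_regIdeal_of_mem (h : d ∈ D) : d ∈ regIdeal D :=
  le_sat _ _ (subset_diffIdeal _ h)

lemma regIdeal_le {I : Ideal (DPoly k n)} (hI : IsDiffIdeal I) (hD : ∀ d ∈ D, d ∈ I)
    (hH : ∀ h ∈ initSep D, IsSMulRegular (DPoly k n ⧸ I) h) : regIdeal D ≤ I :=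
  sat_le (diffIdeal_le hI hD) hH

lemma sat_span_prolongation_le_regIdeal (D : Finset (DPoly k n)) (B : Set (Der n)) :
    sat (Ideal.span (prolongation D B)) (initSep D) ≤ regIdeal D := by
  refine sat_mono (Ideal.span_le.2 ?_) le_rfl
  rintro x (hx | ⟨d, hd, u, j, -, -, -, rfl⟩)
  · exact subset_diffIdeal _ hx
  · exact iterate_delta_mem (isDiffIdeal_diffIdeal _) (subset_diffIdeal _ hd) j

theorem mem_sat_span_prolongation_of_mem_regIdeal (hR : IsRanking n) (hD : Autoreduced D)
    (hB : IsLowerSet B) (hx : x ∈ regIdeal D)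
    (hfree : ∀ d ∈ D, ∀ u : Der n, ld d = u → ∀ j, 0 < j → u.shift j ∉ B → u.shift j ∉ x.vars) :
    x ∈ sat (Ideal.span (prolongation D B)) (initSep D) := by
  obtain ⟨s, hs, hsx⟩ := hx
  obtain ⟨T, hT⟩ := exists_finset_mem_span_prolongation hD.1 hsx
  replace hT : s * x ∈ Ideal.span (prolongation D (B ∪ T)) :=
    Ideal.span_mono (prolongation_mono D Set.subset_union_right) hT
  clear hsx
  -- The derivatives with the highest leaders outside `B` are eliminated first.
  induction T using Finset.induction_on_max generalizing s with
  | empty => exact ⟨s, hs, by simpa using hT⟩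
  | insert v T hTv ih =>
    rw [Finset.coe_insert, Set.union_insert] at hT
    by_cases hvB : v ∈ B
    · rw [Set.insert_eq_of_mem (Set.mem_union_left _ hvB)] at hT
      exact ih s hs hT
    have hlt : B ∪ T ⊆ Set.Iio v := by
      rintro w (hw | hw)
      · exact lt_of_not_ge fun hle => hvB (hB hle hw)
      · exact hTv w hw
    obtain ⟨t, ht, htx⟩ := exists_mul_mem_span_prolongation_of_insert hR hD hlt hs hT
      fun d hd u hu j hj huv => huv ▸ hfree d hd u hu j hj (huv ▸ hvB)
    exact ih t ht htx

theorem mem_sat_span_of_mem_regIdeal (hR : IsRanking n) (hD : Autoreduced D)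
    (hx : x ∈ regIdeal D) (hpart : ∀ d ∈ D, PartReduced x d) :
    x ∈ sat (Ideal.span (D : Set (DPoly k n))) (initSep D) := by
  have h := mem_sat_span_prolongation_of_mem_regIdeal hR hD isLowerSet_empty hx
    fun d hd u hu j hj _ => hpart d hd u hu j hj
  rwa [prolongation_empty] at h

theorem coeffOf_mem_regIdeal (hR : IsRanking n) (hD : Autoreduced D)
    (hDu : ∀ d ∈ D, ∀ w : Der n, ld d = w → w < u ∧ w.var ≠ u.var) (hx : x ∈ regIdeal D)
    (hxu : x ∈ supported k (Set.Iic u)) (t : ℕ) : coeffOf u t x ∈ regIdeal D := by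
  have hDfree : ∀ d ∈ D, d ∈ supported k ({u}ᶜ : Set (Der n)) := fun d hd => by
    obtain ⟨w, hw⟩ := exists_ld_eq (hD.1 d hd)
    exact mem_supported.2 fun v hv =>
      ((le_of_ld_eq hw hv).trans_lt (hDu d hd w hw).1).ne
  obtain ⟨s, hs, hsx⟩ := mem_sat_span_prolongation_of_mem_regIdeal hR hD (isLowerSet_Iio u) hx
    fun d hd w hw j _ hnot hm => hnot (lt_of_le_of_ne (mem_supported.1 hxu hm) fun h =>
      (hDu d hd w hw).2 (by rw [← h, Der.shift_var]))
  have hcoeff := coeffOf_mem_span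
    (fun m hm => mem_supported_compl_of_mem_prolongation hR hDfree subset_rfl hm) hsx t
  rw [coeffOf_mul_of_mem_supported (closure_initSep_mem_supported hDfree hs)] at hcoeff
  exact sat_span_prolongation_le_regIdeal D (Set.Iio u) ⟨s, hs, hcoeff⟩

end Rosenfeld

section PseudoDivision

variable {k : Type*} [Field k] {n : ℕ} {v : Der n} {f i r : DPoly k n} {e : ℕ}

lemma exists_pseudoDivision_step (hi : i.degreeOf v = 0) (hr : r.degreeOf v < e)
    (hv : v ∈ f.vars) (hef : e ≤ f.degreeOf v) :
    ∃ q, (i * f - q * (i * X v ^ e + r)).degreeOf v < f.degreeOf v ∧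
      ∀ w ≠ v, i.degreeOf w = 0 → r.degreeOf w = 0 →
        (i * f - q * (i * X v ^ e + r)).degreeOf w ≤ f.degreeOf w := by
  set c := coeffOf v (f.degreeOf v) f
  set q := c * X v ^ (f.degreeOf v - e)
  have hcancel : i * f - q * (i * X v ^ e + r) = i * tailIn v f - q * r := by
    have hqX : q * X v ^ e = c * X v ^ f.degreeOf v := by
      rw [mul_assoc, ← pow_add, Nat.sub_add_cancel hef]
    linear_combination -i * hqX - i * coeffOf_mul_add_tailIn v f
  have hq (w : Der n) := degreeOf_mul_le w c (X v ^ (f.degreeOf v - e))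
  refine ⟨q, ?_, fun w hw hiw hrw => ?_⟩ <;> rw [hcancel]
  · have hcv : c.degreeOf v = 0 :=
      degreeOf_eq_zero_of_mem_supported (coeffOf_mem_supported_compl v _ f) (by simp)
    have hqv := hq v
    rw [hcv, degreeOf_X_self_pow] at hqv
    have htail := degreeOf_tailIn_lt hv
    refine (degreeOf_sub_le _ _ _).trans_lt (max_lt ?_ ?_)
    · exact (degreeOf_mul_le _ _ _).trans_lt (by lia)
    · exact (degreeOf_mul_le _ _ _).trans_lt (by lia)
  · have hcw : c.degreeOf w ≤ f.degreeOf w := degreeOf_coeffOf_le v _ f w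
    have hqw := hq w
    rw [degreeOf_X_pow_of_ne _ hw] at hqw
    have htail := degreeOf_le_of_support_subset (support_tailIn_subset v f) w
    refine (degreeOf_sub_le _ _ _).trans (max_le ?_ ?_)
    · exact (degreeOf_mul_le _ _ _).trans (by lia)
    · exact (degreeOf_mul_le _ _ _).trans (by lia)

lemma exists_pseudoDivision (hi : i.degreeOf v = 0) (hr : r.degreeOf v < e) (f : DPoly k n) :
    ∃ (N : ℕ) (q : DPoly k n), (i ^ N * f - q * (i * X v ^ e + r)).degreeOf v < e ∧
      ∀ w ≠ v, i.degreeOf w = 0 → r.degreeOf w = 0 →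
        (i ^ N * f - q * (i * X v ^ e + r)).degreeOf w ≤ f.degreeOf w := by
  induction hd : f.degreeOf v using Nat.strong_induction_on generalizing f with
  | _ t ih =>
  subst hd
  rcases lt_or_ge (f.degreeOf v) e with hlt | hef
  · exact ⟨0, 0, by simpa using hlt, fun w _ _ _ => by simp⟩
  obtain ⟨q, hqv, hqw⟩ := exists_pseudoDivision_step hi hr (degreeOf_pos_iff.1 (by lia)) hef
  obtain ⟨N, q', hv, hw⟩ := ih _ hqv _ rfl
  have hcomp : i ^ (N + 1) * f - (i ^ N * q + q') * (i * X v ^ e + r) =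
      i ^ N * (i * f - q * (i * X v ^ e + r)) - q' * (i * X v ^ e + r) := by ring
  refine ⟨N + 1, i ^ N * q + q', by rwa [hcomp], fun w hne hiw hrw => ?_⟩
  rw [hcomp]
  exact (hw w hne hiw hrw).trans (hqw w hne hiw hrw)

end PseudoDivision

section Remainder

variable {k : Type*} [Field k] {n : ℕ} [LinearOrder (Der n)] {D : Finset (DPoly k n)}
  {d f g : DPoly k n} {v w : Der n}

/-- The polynomial `f` is reduced with respect to `D` as far as the derivative `w` is concerned. -/
def ReducedAt (D : Finset (DPoly k n)) (f : DPoly k n) (w : Der n) : Prop :=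
  ∀ d ∈ D, ∀ u : Der n, ld d = u →
    (∀ j, 0 < j → w = u.shift j → w ∉ f.vars) ∧ (w = u → f.degreeOf w < d.degreeOf w)

lemma reduced_of_forall_reducedAt (h : ∀ w, ReducedAt D f w) (hd : d ∈ D) : Reduced f d :=
  ⟨fun u hu j hj => (h _ d hd u hu).1 j hj rfl, fun u hu => (h u d hd u hu).2 rfl⟩

lemma ReducedAt.of_degreeOf_le (h : ReducedAt D f w) (hd : g.degreeOf w ≤ f.degreeOf w) :
    ReducedAt D g w := by
  refine fun d hd' u hu => ⟨fun j hj hw => ?_, fun hw => hd.trans_lt ((h d hd' u hu).2 hw)⟩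
  have hf := (h d hd' u hu).1 j hj hw
  rw [← degreeOf_eq_zero_iff_notMem_vars] at hf ⊢
  lia

lemma reducedAt_of_notMem_vars (h : w ∉ f.vars) : ReducedAt D f w := by
  refine fun d _ u hu => ⟨fun _ _ _ => h, ?_⟩
  rintro rfl
  rw [degreeOf_eq_zero_iff_notMem_vars.2 h]
  exact degreeOf_pos_iff.2 (mem_vars_of_ld_eq hu)

lemma Autoreduced.reducedAt_of_degreeOf_lt (hR : IsRanking n) (hD : Autoreduced D) (hd : d ∈ D)
    (hv : ld d = v) (h : g.degreeOf v < d.degreeOf v) : ReducedAt D g v := by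
  refine fun d' hd' u hu => ⟨?_, ?_⟩
  · rintro j hj rfl
    obtain rfl := hD.eq_of_var_eq hd' hd hu hv rfl
    exact absurd (WithBot.coe_inj.1 (hu.symm.trans hv)) (hR.lt_shift u hj).ne
  · rintro rfl
    rwa [hD.eq_of_var_eq hd' hd hu hv rfl]

lemma exists_forall_gt_reducedAt_and_not_reducedAt (h : ¬ ∀ w, ReducedAt D f w) :
    ∃ v ∈ f.vars, ¬ ReducedAt D f v ∧ ∀ w, v < w → ReducedAt D f w := by
  have mem_vars {w : Der n} (hw : ¬ ReducedAt D f w) : w ∈ f.vars :=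
    by_contra fun hf => hw (reducedAt_of_notMem_vars hf)
  push Not at h
  obtain ⟨w, hw⟩ := h
  obtain ⟨v, hv, hmax⟩ := Finset.exists_max_image (f.vars.filter fun w => ¬ ReducedAt D f w) id
    ⟨w, Finset.mem_filter.2 ⟨mem_vars hw, hw⟩⟩
  obtain ⟨hvf, hv⟩ := Finset.mem_filter.1 hv
  refine ⟨v, hvf, hv, fun w hlt => by_contra fun hw => ?_⟩
  exact hlt.not_ge (hmax w (Finset.mem_filter.2 ⟨mem_vars hw, hw⟩))

variable [Differential k]

lemma exists_initSep_mul_X_pow_add_mem_diffIdeal (hR : IsRanking n) (hD : Autoreduced D)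
    (hv : ¬ ReducedAt D f v) :
    ∃ i ∈ initSep D, ∃ r e, i * X v ^ e + r ∈ diffIdeal (D : Set (DPoly k n)) ∧
      i ∈ supported k (Set.Iio v) ∧ r ∈ supported k (Set.Iic v) ∧ r.degreeOf v < e ∧
      ∀ g : DPoly k n, g.degreeOf v < e → ReducedAt D g v := by
  unfold ReducedAt at hv
  push Not at hv
  obtain ⟨d, hd, u, hu, hbad⟩ := hv
  by_cases hproper : ∃ j, 0 < j ∧ v = u.shift j
  · obtain ⟨j, hj, rfl⟩ := hproper
    obtain ⟨r, hr, hdj⟩ := exists_iterate_delta_eq hR hu hj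
    refine ⟨separant d, separant_mem_initSep hd, r, 1, ?_, ?_,
      supported_mono Set.Iio_subset_Iic_self hr, ?_, fun g hg => ?_⟩
    · rw [pow_one, ← hdj]
      exact iterate_delta_mem (isDiffIdeal_diffIdeal _) (subset_diffIdeal _ hd) _
    · exact supported_mono (Set.Iic_subset_Iio.2 (hR.lt_shift u hj))
        (separant_mem_supported_Iic hu)
    · rw [degreeOf_eq_zero_of_mem_supported hr (by simp)]
      exact one_pos
    · exact reducedAt_of_notMem_vars (degreeOf_eq_zero_iff_notMem_vars.1 (by lia))
  · obtain ⟨rfl, -⟩ := hbad fun j hj hw => absurd ⟨j, hj, hw⟩ hproper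
    refine ⟨initial d, initial_mem_initSep hd, tailIn v d, d.degreeOf v, ?_,
      initial_mem_supported_Iio hu, ?_, degreeOf_tailIn_lt (mem_vars_of_ld_eq hu),
      fun g hg => hD.reducedAt_of_degreeOf_lt hR hd hu hg⟩
    · rw [initial_eq_coeffOf hu, coeffOf_mul_add_tailIn]
      exact subset_diffIdeal _ hd
    · exact mem_supported.2 fun w hw =>
        le_of_ld_eq hu (vars_subset_of_support_subset (support_tailIn_subset v d) hw)

lemma exists_reducedAt (hR : IsRanking n) (hD : Autoreduced D) (f : DPoly k n) (v : Der n) :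
    ∃ h ∈ Submonoid.closure (initSep D : Set (DPoly k n)), ∃ g : DPoly k n,
      h * f - g ∈ diffIdeal (D : Set (DPoly k n)) ∧ ReducedAt D g v ∧
      ∀ w, v ≤ w → g.degreeOf w ≤ f.degreeOf w := by
  by_cases hv : ReducedAt D f v
  · exact ⟨1, one_mem _, f, by simp, hv, fun _ _ => le_rfl⟩
  obtain ⟨i, hiD, r, e, hmem, hi, hr, hre, hred⟩ :=
    exists_initSep_mul_X_pow_add_mem_diffIdeal hR hD hv
  obtain ⟨N, q, hgv, hgw⟩ := exists_pseudoDivision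
    (degreeOf_eq_zero_of_mem_supported hi (Set.self_notMem_Iio)) hre f
  refine ⟨i ^ N, pow_mem (Submonoid.subset_closure hiD) N, _, ?_, hred _ hgv, fun w hw => ?_⟩
  · rw [sub_sub_cancel]
    exact Ideal.mul_mem_left _ _ hmem
  · rcases hw.eq_or_lt with rfl | hlt
    · exact hgv.le.trans (not_lt.1 fun hlt => hv (hred f hlt))
    · exact hgw w hlt.ne' (degreeOf_eq_zero_of_mem_supported hi hlt.not_gt)
        (degreeOf_eq_zero_of_mem_supported hr hlt.not_ge)

lemma exists_forall_reducedAt (hR : IsRanking n) (hD : Autoreduced D)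
    (hf : ∀ w, v < w → ReducedAt D f w) :
    ∃ h ∈ Submonoid.closure (initSep D : Set (DPoly k n)), ∃ g : DPoly k n,
      h * f - g ∈ diffIdeal (D : Set (DPoly k n)) ∧ (∀ w, ReducedAt D g w) ∧
      ∀ w, v ≤ w → g.degreeOf w ≤ f.degreeOf w := by
  have := hR.wellFoundedLT
  induction v using WellFoundedLT.induction generalizing f with
  | _ v ih =>
  obtain ⟨h, hh, g, hg, hgv, hdeg⟩ := exists_reducedAt hR hD f v
  have hgred (w : Der n) (hw : v ≤ w) : ReducedAt D g w := by
    rcases hw.eq_or_lt with rfl | hlt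
    · exact hgv
    · exact (hf w hlt).of_degreeOf_le (hdeg w hw)
  by_cases hall : ∀ w, ReducedAt D g w
  · exact ⟨h, hh, g, hg, hall, hdeg⟩
  obtain ⟨v', -, hbad, hgood⟩ := exists_forall_gt_reducedAt_and_not_reducedAt hall
  have hlt : v' < v := not_le.1 fun hle => hbad (hgred v' hle)
  obtain ⟨h', hh', g', hg', hred', hdeg'⟩ := ih v' hlt hgood
  refine ⟨h' * h, mul_mem hh' hh, g', ?_, hred', fun w hw => ?_⟩
  · rw [show h' * h * f - g' = h' * (h * f - g) + (h' * g - g') by ring]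
    exact add_mem (Ideal.mul_mem_left _ _ hg) hg'
  · exact (hdeg' w (hlt.le.trans hw)).trans (hdeg w hw)

theorem exists_isDiffRem_rk_le (hR : IsRanking n) (hD : Autoreduced D) (f : DPoly k n) :
    ∃ g, IsDiffRem D f g ∧ rk g ≤ rk f := by
  by_cases hc : IsConst f
  · refine ⟨f, ⟨fun d hd => reduced_of_forall_reducedAt (fun w => reducedAt_of_notMem_vars ?_) hd,
      1, one_mem _, by simp⟩, le_rfl⟩
    simp [isConst_iff_vars_eq_empty.1 hc]
  obtain ⟨u, hu⟩ := exists_ld_eq hc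
  have hgt {w : Der n} (hw : u < w) : w ∉ f.vars := fun hm => (le_of_ld_eq hu hm).not_gt hw
  obtain ⟨h, hh, g, hg, hred, hdeg⟩ :=
    exists_forall_reducedAt hR hD fun w hw => reducedAt_of_notMem_vars (hgt hw)
  refine ⟨g, ⟨fun d hd => reduced_of_forall_reducedAt hred hd, h, hh, le_sat _ _ hg⟩,
    (rk_le_rk_iff hu).2 ⟨mem_supported.2 fun w hw => not_lt.1 fun hlt => ?_, hdeg u le_rfl⟩⟩
  refine degreeOf_eq_zero_iff_notMem_vars.1 (Nat.eq_zero_of_le_zero ?_) hw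
  exact (hdeg w hlt.le).trans (degreeOf_eq_zero_iff_notMem_vars.2 (hgt hlt)).le

end Remainder

section Lazard

lemma dvd_derivative_mul_of_dvd_pow {K : Type*} [Field K] {p x : Polynomial K} {m : ℕ}
    (h : p ∣ x ^ m) : p ∣ Polynomial.derivative p * x := by
  rcases eq_or_ne p 0 with rfl | hp
  · simp
  have hrad : UniqueFactorizationMonoid.radical p ∣ x :=
    (UniqueFactorizationMonoid.exists_dvd_pow_iff_radical_dvd hp).1 ⟨m, h⟩
  conv_lhs => rw [← EuclideanDomain.divRadical_mul_radical (a := p)]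
  exact mul_dvd_mul (divRadical_dvd_derivative p) hrad

variable {k : Type*} [Field k] {n : ℕ} [LinearOrder (Der n)] {D s : Finset (DPoly k n)}
  {d z c q : DPoly k n} {u : Der n} {M : ℕ}

lemma map_toPolynomialIn_eq_zero {K : Type*} [Field K] (ψ : DPoly k n →+* K) (hu : ld d = u)
    (hi : ψ (initial d) ≠ 0) (hs : ∀ f ∈ s, f ∈ supported k ({u}ᶜ : Set (Der n)))
    (hψs : ∀ f ∈ s, ψ f = 0) (hz : z ^ M ∈ Ideal.span (insert d s : Finset (DPoly k n)))
    (hdeg : (c * (separant d * z) - q * d).degreeOf u < d.degreeOf u) :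
    (toPolynomialIn u (c * (separant d * z) - q * d)).map ψ = 0 := by
  obtain ⟨φ, hφ⟩ : ∃ φ : DPoly k n →+* Polynomial K, ∀ y, φ y = (toPolynomialIn u y).map ψ :=
    ⟨(Polynomial.mapRingHom ψ).comp (toPolynomialIn u).toRingHom, fun _ => rfl⟩
  have hdvd_pow : φ d ∣ φ z ^ M := by
    rw [← map_pow]
    rw [Finset.coe_insert] at hz
    obtain ⟨a, y, hy, hay⟩ := Ideal.mem_span_insert.1 hz
    have hspan : Ideal.span (s : Set (DPoly k n)) ≤ RingHom.ker φ := Ideal.span_le.2 fun f hf => by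
      rw [SetLike.mem_coe, RingHom.mem_ker, hφ, toPolynomialIn_of_mem_supported (hs f hf),
        Polynomial.map_C, hψs f hf, map_zero]
    have hy0 : φ y = 0 := hspan hy
    rw [hay, map_add, map_mul, hy0, add_zero]
    exact dvd_mul_left _ _
  have hderiv : Polynomial.derivative (φ d) = φ (separant d) := by
    rw [hφ, hφ, Polynomial.derivative_map, derivative_toPolynomialIn, separant_eq_pderiv hu]
  have hdvd : φ d ∣ φ (c * (separant d * z) - q * d) := by
    rw [map_sub, map_mul, map_mul, map_mul, ← hderiv]
    exact dvd_sub ((dvd_derivative_mul_of_dvd_pow hdvd_pow).mul_left _) (dvd_mul_left _ _)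
  have hlead : (φ d).coeff (d.degreeOf u) ≠ 0 := by
    rw [hφ, Polynomial.coeff_map, coeff_toPolynomialIn, ← initial_eq_coeffOf hu]
    exact hi
  rw [← hφ]
  refine Polynomial.eq_zero_of_dvd_of_natDegree_lt hdvd ?_
  calc (φ (c * (separant d * z) - q * d)).natDegree
      ≤ (c * (separant d * z) - q * d).degreeOf u := by
        rw [hφ, ← natDegree_toPolynomialIn]
        exact Polynomial.natDegree_map_le
    _ < d.degreeOf u := hdeg
    _ ≤ (φ d).natDegree := Polynomial.le_natDegree_of_ne_zero hlead

lemma initial_mul_mem_of_isRadical {J : Ideal (DPoly k n)} (hJ : J.IsRadical) (hu : ld d = u)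
    (hs : ∀ f ∈ s, f ∈ supported k ({u}ᶜ : Set (Der n))) (hsJ : ∀ f ∈ s, f ∈ J)
    (hz : z ^ M ∈ Ideal.span (insert d s : Finset (DPoly k n)))
    (hdeg : (c * (separant d * z) - q * d).degreeOf u < d.degreeOf u) :
    initial d * (c * (separant d * z) - q * d) ∈ J := by
  have hi : initial d ∈ supported k ({u}ᶜ : Set (Der n)) :=
    supported_mono (fun _ => ne_of_lt) (initial_mem_supported_Iio hu)
  refine mem_of_forall_coeffOf_mem (u := u) fun t => ?_
  rw [coeffOf_mul_of_mem_supported hi, ← hJ.radical, Ideal.radical_eq_sInf, Ideal.mem_sInf]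
  rintro P ⟨hJP, hP⟩
  by_cases hiP : initial d ∈ P
  · exact P.mul_mem_right _ hiP
  refine P.mul_mem_left _ ?_
  let ψ : DPoly k n →+* FractionRing (DPoly k n ⧸ P) :=
    (algebraMap (DPoly k n ⧸ P) (FractionRing (DPoly k n ⧸ P))).comp (Ideal.Quotient.mk P)
  have hψ (y : DPoly k n) : ψ y = 0 ↔ y ∈ P := by
    rw [← Ideal.Quotient.eq_zero_iff_mem]
    exact FaithfulSMul.algebraMap_eq_zero_iff (DPoly k n ⧸ P) (FractionRing (DPoly k n ⧸ P))
  have hzero := map_toPolynomialIn_eq_zero ψ hu (fun h => hiP ((hψ _).1 h)) hs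
    (fun f hf => (hψ f).2 (hJP (hsJ f hf))) hz hdeg
  rw [← hψ, ← coeff_toPolynomialIn, ← Polynomial.coeff_map, hzero, Polynomial.coeff_zero]

lemma sat_span_insert_isRadical (hu : ld d = u)
    (hs : ∀ f ∈ s, f ∈ supported k ({u}ᶜ : Set (Der n)))
    (hJ : (sat (Ideal.span (s : Set (DPoly k n))) (initSep s)).IsRadical) :
    (sat (Ideal.span (insert d s : Finset (DPoly k n)))
      (initSep (insert d s) : Set (DPoly k n))).IsRadical := by
  set S := sat (Ideal.span (insert d s : Finset (DPoly k n)))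
    (initSep (insert d s) : Set (DPoly k n))
  have hcl {y : DPoly k n} (hy : y ∈ initSep (insert d s)) :
      y ∈ Submonoid.closure (initSep (insert d s) : Set (DPoly k n)) := Submonoid.subset_closure hy
  have hdS : d ∈ S := le_sat _ _ (Ideal.subset_span (by simp))
  have hJS : sat (Ideal.span (s : Set (DPoly k n))) (initSep s) ≤ S :=
    sat_mono (Ideal.span_mono (by simp)) (by simpa using initSep_mono (Finset.subset_insert d s))
  rintro x ⟨m, h, hh, hx⟩
  have hz : (h * x) ^ (m + 1) ∈ Ideal.span (insert d s : Finset (DPoly k n)) := by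
    rw [show (h * x) ^ (m + 1) = h ^ m * x * (h * x ^ m) by ring]
    exact Ideal.mul_mem_left _ _ hx
  obtain ⟨N, q, hdeg, -⟩ := exists_pseudoDivision
    (degreeOf_eq_zero_of_mem_supported (initial_mem_supported_Iio hu) Set.self_notMem_Iio)
    (degreeOf_tailIn_lt (mem_vars_of_ld_eq hu)) (separant d * (h * x))
  rw [initial_eq_coeffOf hu, coeffOf_mul_add_tailIn, ← initial_eq_coeffOf hu] at hdeg
  have hrem := hJS (initial_mul_mem_of_isRadical hJ hu hs
    (fun f hf => le_sat _ _ (Ideal.subset_span hf)) hz hdeg)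
  have hmem := add_mem hrem (S.mul_mem_left (initial d * q) hdS)
  rw [show initial d * (initial d ^ N * (separant d * (h * x)) - q * d) + initial d * q * d =
    initial d ^ (N + 1) * separant d * h * x by ring] at hmem
  refine mem_sat_of_mul_mem_sat (mul_mem (mul_mem (pow_mem ?_ _) ?_) hh) hmem
  · exact hcl (initial_mem_initSep (Finset.mem_insert_self d s))
  · exact hcl (separant_mem_initSep (Finset.mem_insert_self d s))

lemma sat_span_isRadical (hD : Autoreduced D) :
    (sat (Ideal.span (D : Set (DPoly k n))) (initSep D)).IsRadical := by
  induction D using Finset.induction_on_max_value (ld (k := k) (n := n)) with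
  | empty => exact sat_isRadical (by simpa using Ideal.isRadical_bot) _
  | insert d s hds hmax ih =>
    have hd := Finset.mem_insert_self d s
    obtain ⟨u, hu⟩ := exists_ld_eq (hD.1 d hd)
    refine sat_span_insert_isRadical hu (fun f hf => ?_) (ih (hD.subset (Finset.subset_insert d s)))
    have hfD := Finset.mem_insert_of_mem (a := f) (b := d) hf
    obtain ⟨w, hw⟩ := exists_ld_eq (hD.1 f hfD)
    have hle : w ≤ u := WithBot.coe_le_coe.1 (hw ▸ hu ▸ hmax f hf)
    have hne : w ≠ u := by
      rintro rfl
      exact hds (hD.eq_of_var_eq hd hfD hu hw rfl ▸ hf)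
    exact supported_mono (fun _ hv => (lt_of_le_of_lt hv (lt_of_le_of_ne hle hne)).ne)
      (mem_supported_Iic_of_ld_eq hw)

/-- **Lazard's lemma**. -/
theorem regIdeal_isRadical [Differential k] (hR : IsRanking n) (hD : Autoreduced D) :
    (regIdeal D).IsRadical := by
  rintro x ⟨m, hm⟩
  obtain ⟨g, ⟨hred, h, hh, hg⟩, -⟩ := exists_isDiffRem_rk_le hR hD x
  have hgm : g ^ m ∈ regIdeal D := by
    refine ((regIdeal D).sub_mem_iff_right (x := (h * x) ^ m) ?_).1 ?_
    · rw [mul_pow]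
      exact Ideal.mul_mem_left _ _ hm
    · exact Ideal.mem_of_dvd _ (sub_dvd_pow_sub_pow _ _ m) hg
  have hgS : g ∈ sat (Ideal.span (D : Set (DPoly k n))) (initSep D) :=
    sat_span_isRadical hD ⟨m, mem_sat_span_of_mem_regIdeal hR hD hgm fun d hd =>
      (hred d hd).1.of_vars_subset (vars_pow g m)⟩
  have hgD : g ∈ regIdeal D := sat_mono (Ideal.span_le.2 (subset_diffIdeal _)) le_rfl hgS
  exact mem_sat_of_mul_mem_sat hh (((regIdeal D).sub_mem_iff_left hgD).1 hg)

end Lazard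

section fractions

variable {k R : Type*} [CommRing k] [CommRing R] [Algebra k R]

/-- The multiplicative set of the elements that are not zero divisors modulo `I`. -/
def regularMod (I : Ideal R) : Submonoid R where
  carrier := {s | IsSMulRegular (R ⧸ I) s}
  one_mem' := IsSMulRegular.one _
  mul_mem' := IsSMulRegular.mul

/-- The elements that are congruent modulo `I` to a fraction `p / s` with `p` in the subalgebra `P`
and `s` in both `P` and the multiplicative set `M`. -/
def fracSubalgebra (P : Subalgebra k R) (M : Submonoid R) (I : Ideal R) : Subalgebra k R where
  carrier := {x | ∃ s ∈ P, s ∈ M ∧ ∃ p ∈ P, s * x - p ∈ I}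
  mul_mem' := by
    rintro x y ⟨s, hs, hsM, p, hp, hx⟩ ⟨t, ht, htM, q, hq, hy⟩
    refine ⟨s * t, mul_mem hs ht, mul_mem hsM htM, p * q, mul_mem hp hq, ?_⟩
    rw [show s * t * (x * y) - p * q = t * y * (s * x - p) + p * (t * y - q) by ring]
    exact add_mem (Ideal.mul_mem_left _ _ hx) (Ideal.mul_mem_left _ _ hy)
  add_mem' := by
    rintro x y ⟨s, hs, hsM, p, hp, hx⟩ ⟨t, ht, htM, q, hq, hy⟩
    refine ⟨s * t, mul_mem hs ht, mul_mem hsM htM, t * p + s * q,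
      add_mem (mul_mem ht hp) (mul_mem hs hq), ?_⟩
    rw [show s * t * (x + y) - (t * p + s * q) = t * (s * x - p) + s * (t * y - q) by ring]
    exact add_mem (Ideal.mul_mem_left _ _ hx) (Ideal.mul_mem_left _ _ hy)
  algebraMap_mem' c := ⟨1, one_mem _, one_mem _, _, P.algebraMap_mem c, by simp⟩

variable {P Q : Subalgebra k R} {M : Submonoid R} {I : Ideal R}

lemma mem_iff_mem_of_mul_sub_mem {x c d : R} (hx : x ∈ regularMod I) (h : x * c - d ∈ I) :
    c ∈ I ↔ d ∈ I :=
  ⟨fun hc => (I.sub_mem_iff_right (I.mul_mem_left x hc)).1 h, fun hd =>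
    mem_of_isSMulRegular_quotient_of_smul_mem hx ((I.sub_mem_iff_left hd).1 h)⟩

lemma mem_regularMod_iff_of_mul_sub_mem {x c d : R} (hx : x ∈ regularMod I)
    (h : x * c - d ∈ I) : c ∈ regularMod I ↔ d ∈ regularMod I :=
  (IsSMulRegular.mul_iff_right hx).symm.trans (isSMulRegular_quotient_congr h)

lemma le_fracSubalgebra (P : Subalgebra k R) (M : Submonoid R) (I : Ideal R) :
    P ≤ fracSubalgebra P M I :=
  fun p hp => ⟨1, one_mem _, one_mem _, p, hp, by simp⟩

lemma fracSubalgebra_mono (h : P ≤ Q) : fracSubalgebra P M I ≤ fracSubalgebra Q M I :=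
  fun _ ⟨s, hs, hsM, p, hp, hx⟩ => ⟨s, h hs, hsM, p, h hp, hx⟩

lemma mem_fracSubalgebra_of_mem {x : R} (hx : x ∈ I) : x ∈ fracSubalgebra P M I :=
  ⟨1, one_mem _, one_mem _, 0, zero_mem _, by simpa using hx⟩

lemma mem_fracSubalgebra_of_mul_mem {q x : R} (hq : q ∈ P) (hqM : q ∈ M)
    (h : q * x ∈ fracSubalgebra P M I) : x ∈ fracSubalgebra P M I := by
  obtain ⟨s, hs, hsM, p, hp, hx⟩ := h
  exact ⟨s * q, mul_mem hs hq, mul_mem hsM hqM, p, hp, by rwa [mul_assoc]⟩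

/-- The elements of `I` whose derivative also lies in `I`; a congruence modulo this ideal may be
differentiated to a congruence modulo `I`. -/
def derivIdeal (D : Derivation k R R) (I : Ideal R) : Ideal R where
  carrier := {x | x ∈ I ∧ D x ∈ I}
  zero_mem' := by simp
  add_mem' hx hy := ⟨add_mem hx.1 hy.1, by rw [map_add]; exact add_mem hx.2 hy.2⟩
  smul_mem' a x hx := ⟨I.mul_mem_left a hx.1, by
    rw [smul_eq_mul, D.leibniz]
    exact add_mem (I.mul_mem_left a hx.2) (I.mul_mem_right _ hx.1)⟩

variable {σ : Type*} {S₀ S T : Set σ} {u : σ} {M : Submonoid (MvPolynomial σ k)}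
  {I : Ideal (MvPolynomial σ k)}

lemma supported_le_fracSubalgebra_derivIdeal (hu : u ∉ S₀)
    (hS : ∀ w ∈ S, w ≠ u → X w ∈ fracSubalgebra (supported k S₀) M I) :
    supported k S ≤ fracSubalgebra (supported k (insert u S₀)) M (derivIdeal (pderiv u) I) := by
  refine supported_le_iff.2 fun w hw => ?_
  rcases eq_or_ne w u with rfl | hwu
  · exact le_fracSubalgebra _ _ _ (Algebra.subset_adjoin ⟨w, Set.mem_insert _ _, rfl⟩)
  obtain ⟨s, hs, hsM, p, hp, hsp⟩ := hS w hw hwu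
  have hle : supported k S₀ ≤ supported k (insert u S₀) := supported_mono (Set.subset_insert u S₀)
  have hfree : ∀ q ∈ supported k S₀, pderiv u q = 0 := fun q hq =>
    pderiv_eq_zero_of_mem_supported (supported_mono (Set.subset_compl_singleton_iff.2 hu) hq)
  refine ⟨s, hle hs, hsM, p, hle hp, hsp, ?_⟩
  rw [map_sub, pderiv_mul, hfree s hs, hfree p hp, pderiv_X_of_ne hwu]
  simp

/-- The polynomials congruent modulo `I` to a fraction in the variables `S` whose denominator is not
a zero divisor modulo `I`. -/
abbrev regFrac (S : Set σ) (I : Ideal (MvPolynomial σ k)) : Subalgebra k (MvPolynomial σ k) :=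
  fracSubalgebra (supported k S) (regularMod I) I

lemma regFrac_mono (h : S ⊆ T) : regFrac S I ≤ regFrac T I :=
  fracSubalgebra_mono (supported_mono h)

lemma X_mem_regFrac {w : σ} (hw : w ∈ S) : X w ∈ regFrac S I :=
  le_fracSubalgebra _ _ _ (Algebra.subset_adjoin ⟨w, hw, rfl⟩)

/-- The numerator `p` of `c` satisfies `∂p ≡ s ∂c`, where `s` is the denominator. -/
lemma exists_mem_pderiv_mem_regularMod (hu : u ∉ S₀) (hS : ∀ w ∈ S, w ≠ u → X w ∈ regFrac S₀ I)
    {c : MvPolynomial σ k} (hcI : c ∈ I) (hcS : c ∈ supported k S)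
    (hc : pderiv u c ∈ regularMod I) :
    ∃ p ∈ supported k (insert u S₀), p ∈ I ∧ pderiv u p ∈ regularMod I := by
  obtain ⟨s, -, hs, p, hp, hsp, hdsp⟩ := supported_le_fracSubalgebra_derivIdeal hu hS hcS
  refine ⟨p, hp, (I.sub_mem_iff_right (I.mul_mem_left s hcI)).1 hsp,
    (isSMulRegular_quotient_congr ?_).1 (hs.mul hc)⟩
  rw [map_sub, pderiv_mul, add_sub_assoc] at hdsp
  exact (I.add_mem_iff_right (I.mul_mem_left _ hcI)).1 hdsp

end fractions

section deltaFractions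

variable {k : Type*} [Field k] [Differential k] {n : ℕ} {S T : Set (Der n)}
  {I : Ideal (DPoly k n)}

lemma delta_mem_regFrac (hI : IsDiffIdeal I) (hST : S ⊆ T)
    (hX : ∀ w ∈ S, X (w.shift 1) ∈ regFrac T I) {f : DPoly k n} (hf : f ∈ regFrac S I) :
    delta f ∈ regFrac T I := by
  have hfT : f ∈ regFrac T I := regFrac_mono hST hf
  have hdelta : ∀ p ∈ supported k S, delta p ∈ regFrac T I := fun p hp =>
    delta_mem_subalgebra (fun w hw => X_mem_regFrac (hST hw)) hX hp
  obtain ⟨s, hs, hsM, p, hp, hsp⟩ := hf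
  refine mem_fracSubalgebra_of_mul_mem (supported_mono hST hs) hsM ?_
  have h := add_mem (mem_fracSubalgebra_of_mem (hI _ hsp))
    (sub_mem (hdelta p hp) (mul_mem hfT (hdelta s hs)))
  rwa [delta_sub, delta_mul, show s * delta f + f * delta s - delta p +
    (delta p - f * delta s) = s * delta f by ring] at h

lemma X_shift_mem_regFrac (hI : IsDiffIdeal I) (hST : S ⊆ T) {v : Der n}
    (hX : ∀ w ∈ S, w ≠ v → X (w.shift 1) ∈ regFrac T I) {p : DPoly k n} (hp : p ∈ supported k S)
    (hpI : p ∈ I) (hreg : pderiv v p ∈ regularMod I) : X (v.shift 1) ∈ regFrac T I := by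
  refine mem_fracSubalgebra_of_mul_mem (supported_mono hST (pderiv_mem_supported v hp)) hreg ?_
  have h := sub_mem (mem_fracSubalgebra_of_mem (hI _ hpI))
    (delta_sub_pderiv_mul_mem_subalgebra v (fun w hw => X_mem_regFrac (hST hw)) hX hp)
  rwa [sub_sub_cancel] at h

end deltaFractions

section orders

variable {k : Type*} [Field k] {n : ℕ} {V : Finset (Fin n)} {e m : Fin n → ℕ}

/-- The derivatives of order at most `e y` for `y ∈ V` and at most `m z + N` for `z ∉ V`. -/
def orderSet (V : Finset (Fin n)) (e m : Fin n → ℕ) (N : ℕ) : Set (Der n) :=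
  {w | (w.var ∈ V → w.ord ≤ e w.var) ∧ (w.var ∉ V → w.ord ≤ m w.var + N)}

lemma orderSet_mono {N N' : ℕ} (h : N ≤ N') : orderSet V e m N ⊆ orderSet V e m N' :=
  fun _ hw => ⟨hw.1, fun hv => (hw.2 hv).trans (Nat.add_le_add_left h _)⟩

lemma mem_orderSet_of_mem {N : ℕ} {w : Der n} (hV : w.var ∈ V) (hw : w.ord ≤ e w.var) :
    w ∈ orderSet V e m N :=
  ⟨fun _ => hw, fun h => absurd hV h⟩

lemma mem_orderSet_of_notMem {N : ℕ} {w : Der n} (hV : w.var ∉ V) (hw : w.ord ≤ m w.var + N) :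
    w ∈ orderSet V e m N :=
  ⟨fun h => absurd h hV, fun _ => hw⟩

variable [LinearOrder (Der n)]

/-- The number of derivatives `y^(j)` with `y ∈ V` and `e y < j ≤ m y` that are at most `v`. -/
def derCount (V : Finset (Fin n)) (e m : Fin n → ℕ) (v : Der n) : ℕ :=
  ∑ y ∈ V, ((Finset.Ioc (e y) (m y)).filter fun j => (⟨y, j⟩ : Der n) ≤ v).card

lemma derCount_mono {v w : Der n} (h : v ≤ w) : derCount V e m v ≤ derCount V e m w :=
  Finset.sum_le_sum fun _ _ => Finset.card_le_card
    (Finset.monotone_filter_right _ fun _ _ hj => hj.trans h)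

lemma derCount_le (v : Der n) : derCount V e m v ≤ ∑ y ∈ V, (m y - e y) :=
  Finset.sum_le_sum fun _ _ => (Finset.card_filter_le _ _).trans (Nat.card_Ioc _ _).le

lemma derCount_lt_derCount_shift (hR : IsRanking n) {v : Der n} (hv : v.var ∈ V)
    (he : e v.var ≤ v.ord) (hm : v.ord < m v.var) :
    derCount V e m v < derCount V e m (v.shift 1) := by
  have hsub : ∀ y, (Finset.Ioc (e y) (m y)).filter (fun j => (⟨y, j⟩ : Der n) ≤ v) ⊆
      (Finset.Ioc (e y) (m y)).filter fun j => (⟨y, j⟩ : Der n) ≤ v.shift 1 := fun y =>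
    Finset.monotone_filter_right _ fun _ _ hj => hj.trans (hR.le_shift v 1)
  refine Finset.sum_lt_sum (fun y _ => Finset.card_le_card (hsub y)) ⟨v.var, hv,
    Finset.card_lt_card ((Finset.ssubset_iff_of_subset (hsub _)).2 ⟨v.ord + 1, ?_, ?_⟩)⟩
  · exact Finset.mem_filter.2 ⟨Finset.mem_Ioc.2 ⟨by omega, hm⟩, le_of_eq rfl⟩
  · exact fun hmem => (Finset.mem_filter.1 hmem).2.not_gt (hR.lt_shift v Nat.one_pos)

/-- If `v` is the derivative of some `y ∈ V` of order between `e y` and `m y`, then modulo `I` its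
derivative is a fraction in the derivatives up to `v.shift 1` whose orders are at most `e y` for
`y ∈ V` and at most `m z + derCount V e m v + 1` for `z ∉ V`. -/
def ShiftReducible (V : Finset (Fin n)) (e m : Fin n → ℕ) (I : Ideal (DPoly k n)) (v : Der n) :
    Prop :=
  v.var ∈ V → e v.var ≤ v.ord → v.ord ≤ m v.var →
    X (v.shift 1) ∈ regFrac (Set.Iic (v.shift 1) ∩ orderSet V e m (derCount V e m v + 1)) I

variable {I : Ideal (DPoly k n)}

lemma X_mem_regFrac_Iic (hR : IsRanking n) {w : Der n}
    (hred : ∀ x < w, ShiftReducible V e m I x) (hwm : w ∈ boundedDers m) :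
    X w ∈ regFrac (Set.Iic w ∩ orderSet V e m (derCount V e m w)) I := by
  have hwm : w.ord ≤ m w.var := hwm
  by_cases hwV : w.var ∈ V
  · rcases le_or_gt w.ord (e w.var) with hwe | hwe
    · exact X_mem_regFrac ⟨le_rfl, mem_orderSet_of_mem hwV hwe⟩
    obtain ⟨x, rfl⟩ : ∃ x : Der n, x.shift 1 = w :=
      ⟨⟨w.var, w.ord - 1⟩, by ext <;> simp; omega⟩
    simp only [Der.shift_ord, Der.shift_var] at hwV hwe hwm
    exact regFrac_mono
      (Set.inter_subset_inter_right _ (orderSet_mono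
        (derCount_lt_derCount_shift hR hwV (by omega) (by omega))))
      (hred x (hR.lt_shift x Nat.one_pos) hwV (by omega) (by omega))
  · exact X_mem_regFrac ⟨le_rfl, mem_orderSet_of_notMem hwV (by omega)⟩

lemma X_shift_mem_regFrac_of_lt (hR : IsRanking n) (hem : ∀ y ∈ V, e y ≤ m y) {v w : Der n}
    (hred : ShiftReducible V e m I w) (hwv : w < v)
    (hw : w ∈ orderSet V e m (derCount V e m v)) :
    X (w.shift 1) ∈ regFrac (Set.Iic (v.shift 1) ∩ orderSet V e m (derCount V e m v + 1)) I := by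
  have hle : w.shift 1 ≤ v.shift 1 := hR.shift_le_shift w v 1 hwv.le
  by_cases hwV : w.var ∈ V
  · rcases (hw.1 hwV).lt_or_eq with hwe | hwe
    · exact X_mem_regFrac ⟨hle, mem_orderSet_of_mem hwV hwe⟩
    · exact regFrac_mono (Set.inter_subset_inter (Set.Iic_subset_Iic.2 hle)
        (orderSet_mono (Nat.succ_le_succ (derCount_mono hwv.le))))
        (hred hwV hwe.ge (hwe.le.trans (hem _ hwV)))
  · exact X_mem_regFrac ⟨hle, mem_orderSet_of_notMem hwV (Nat.succ_le_succ (hw.2 hwV))⟩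

variable [Differential k]

/-- Below the bottom order `e y` there is nothing to prove; at `e y` the equation `c` is solved for
the derivative of `v`, and above it the fraction for `v` itself is differentiated. -/
lemma shiftReducible (hR : IsRanking n) (hem : ∀ y ∈ V, e y ≤ m y) {B : Set (Der n)}
    (hB : IsLowerSet B) (hI : IsDiffIdeal I)
    (hc : ∀ v ∈ B, v.var ∈ V → v.ord = e v.var →
      ∃ c ∈ I, c ∈ supported k (Set.Iic v ∩ boundedDers m) ∧ pderiv v c ∈ regularMod I)
    (v : Der n) (hvB : v ∈ B) : ShiftReducible V e m I v := by
  have := hR.wellFoundedLT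
  induction v using WellFoundedLT.induction with
  | _ v ih =>
  intro hvV hve hvm
  replace ih : ∀ w < v, ShiftReducible V e m I w := fun w hw => ih w hw (hB hw.le hvB)
  have hsub : Set.Iic v ∩ orderSet V e m (derCount V e m v) ⊆
      Set.Iic (v.shift 1) ∩ orderSet V e m (derCount V e m v + 1) :=
    Set.inter_subset_inter (Set.Iic_subset_Iic.2 (hR.le_shift v 1)) (orderSet_mono (Nat.le_succ _))
  have hshift : ∀ w ∈ Set.Iic v ∩ orderSet V e m (derCount V e m v), w ≠ v → X (w.shift 1) ∈
      regFrac (Set.Iic (v.shift 1) ∩ orderSet V e m (derCount V e m v + 1)) I := fun w hw hne =>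
    have hlt : w < v := lt_of_le_of_ne hw.1 hne
    X_shift_mem_regFrac_of_lt hR hem (ih w hlt) hlt hw.2
  rcases hve.lt_or_eq with hve | hve
  · rw [← delta_X]
    refine delta_mem_regFrac hI hsub (fun w hw => hshift w hw ?_) (X_mem_regFrac_Iic hR ih hvm)
    rintro rfl
    exact (hw.2.1 hvV).not_gt hve
  · obtain ⟨c, hcI, hcS, hcreg⟩ := hc v hvB hvV hve.symm
    have hfrac : ∀ w ∈ Set.Iic v ∩ boundedDers m, w ≠ v →
        X w ∈ regFrac (Set.Iio v ∩ orderSet V e m (derCount V e m v)) I := fun w hw hne =>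
      have hlt : w < v := lt_of_le_of_ne hw.1 hne
      regFrac_mono (Set.inter_subset_inter (Set.Iic_subset_Iio.2 hlt)
        (orderSet_mono (derCount_mono hlt.le)))
        (X_mem_regFrac_Iic hR (fun x hx => ih x (hx.trans hlt)) hw.2)
    obtain ⟨p, hp, hpI, hpreg⟩ :=
      exists_mem_pderiv_mem_regularMod (fun h => lt_irrefl v h.1) hfrac hcI hcS hcreg
    refine X_shift_mem_regFrac hI hsub hshift
      (supported_mono (Set.insert_subset ?_ ?_) hp) hpI hpreg
    · exact ⟨le_rfl, mem_orderSet_of_mem hvV hve.ge⟩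
    · exact Set.inter_subset_inter_left _ Set.Iio_subset_Iic_self

lemma mem_regFrac_orderSet (hR : IsRanking n) (hem : ∀ y ∈ V, e y ≤ m y) {B : Set (Der n)}
    (hB : IsLowerSet B) (hI : IsDiffIdeal I)
    (hc : ∀ v ∈ B, v.var ∈ V → v.ord = e v.var →
      ∃ c ∈ I, c ∈ supported k (Set.Iic v ∩ boundedDers m) ∧ pderiv v c ∈ regularMod I)
    {f : DPoly k n} (hf : f ∈ supported k (boundedDers m))
    (hfB : ∀ w ∈ f.vars, w.var ∈ V → w.ord ≤ e w.var ∨ w ∈ B) :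
    f ∈ regFrac (orderSet V e m (∑ y ∈ V, (m y - e y))) I := by
  refine supported_le_iff.2 (fun w hw => ?_) (mem_supported_vars f)
  have hwm : w.ord ≤ m w.var := mem_supported.1 hf hw
  by_cases hwV : w.var ∈ V
  · rcases hfB w hw hwV with hwe | hwB
    · exact X_mem_regFrac (mem_orderSet_of_mem hwV hwe)
    · exact regFrac_mono (Set.inter_subset_right.trans (orderSet_mono (derCount_le w)))
        (X_mem_regFrac_Iic hR (fun x hx => shiftReducible hR hem hB hI hc x (hB hx.le hwB)) hwm)
  · exact X_mem_regFrac (mem_orderSet_of_notMem hwV (hwm.trans (Nat.le_add_right _ _)))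

end orders

section truncation

variable {k : Type*} [Field k] {n : ℕ} {D : Finset (DPoly k n)}

lemma truncHom_mem_span {b : Fin n → ℕ} (hDb : ∀ d ∈ D, d ∈ supported k (boundedDers b))
    {x : DPoly k n} (hx : x ∈ Ideal.span (D : Set (DPoly k n))) :
    truncHom b x ∈ Ideal.span (D : Set (DPoly k n)) := by
  have hle : Ideal.span (D : Set (DPoly k n)) ≤
      (Ideal.span (D : Set (DPoly k n))).comap (truncHom b) :=
    Ideal.span_le.2 fun d hd => by
      rw [SetLike.mem_coe, Ideal.mem_comap, truncHom_eq_self (hDb d hd)]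
      exact Ideal.subset_span hd
  exact hle hx

variable [Differential k] [LinearOrder (Der n)]

/-- By Rosenfeld's lemma the membership is algebraic, so that it may be truncated. -/
lemma truncHom_mem_regIdeal (hR : IsRanking n) (hD : Autoreduced D) {b : Fin n → ℕ}
    (hDb : ∀ d ∈ D, d ∈ supported k (boundedDers b)) {x : DPoly k n} (hx : x ∈ regIdeal D)
    (hpart : ∀ d ∈ D, PartReduced x d) : truncHom b x ∈ regIdeal D := by
  obtain ⟨t, ht, htx⟩ := mem_sat_span_of_mem_regIdeal hR hD hx hpart
  refine ⟨t, ht, Ideal.span_le.2 (subset_diffIdeal _) ?_⟩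
  rw [← truncHom_eq_self (closure_initSep_mem_supported hDb ht), ← map_mul]
  exact truncHom_mem_span hDb htx

theorem IsDiffRem.truncate (hR : IsRanking n) (hD : Autoreduced D) {b : Fin n → ℕ}
    (hDb : ∀ d ∈ D, d ∈ supported k (boundedDers b)) {S : Set (Der n)} (hSb : S ⊆ boundedDers b)
    (hSD : ∀ d ∈ D, ∀ u : Der n, ld d = u → ∀ j, 0 < j → u.shift j ∉ S) {f g : DPoly k n}
    (hf : f ∈ regFrac S (regIdeal D)) (hg : IsDiffRem D f g) :
    IsDiffRem D f (DiffAlg.truncate b g) := by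
  obtain ⟨hred, h, hh, hfg : h * f - g ∈ regIdeal D⟩ := hg
  refine ⟨fun d hd => (hred d hd).truncate b, h, hh, ?_⟩
  obtain ⟨s, hs, hsreg, p, hp, hsp⟩ := hf
  have hsg : s * g - h * p ∈ regIdeal D := by
    rw [show s * g - h * p = h * (s * f - p) - s * (h * f - g) by ring]
    exact sub_mem (Ideal.mul_mem_left _ _ hsp) (Ideal.mul_mem_left _ _ hfg)
  have hpart : ∀ d ∈ D, PartReduced (s * g - h * p) d := by
    intro d hd u hu j hj hm
    have hS : supported k S ≤ supported k {u.shift j}ᶜ :=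
      supported_mono (Set.subset_compl_singleton_iff.2 (hSD d hd u hu j hj))
    have hg : g ∈ supported k {u.shift j}ᶜ :=
      mem_supported.2 (Set.subset_compl_singleton_iff.2 ((hred d hd).1 u hu j hj))
    have hh : h ∈ supported k {u.shift j}ᶜ := closure_initSep_mem_supported (fun d' hd' =>
      mem_supported.2 (Set.subset_compl_singleton_iff.2 (hD.partReduced hR hd' hd u hu j hj))) hh
    exact mem_supported.1 (sub_mem (mul_mem (hS hs) hg) (mul_mem hh (hS hp))) hm rfl
  have hτ := truncHom_mem_regIdeal hR hD hDb hsg hpart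
  have hSb : supported k S ≤ supported k (boundedDers b) := supported_mono hSb
  rw [map_sub, map_mul, map_mul, truncHom_eq_self (hSb hs), truncHom_eq_self (hSb hp),
    truncHom_eq_self (closure_initSep_mem_supported hDb hh), ← truncate_eq_truncHom] at hτ
  refine mem_of_isSMulRegular_quotient_of_smul_mem hsreg (?_ : s * _ ∈ regIdeal D)
  rw [show s * (h * f - DiffAlg.truncate b g) = h * (s * f - p) -
    (s * DiffAlg.truncate b g - h * p) by ring]
  exact sub_mem (Ideal.mul_mem_left _ _ hsp) hτ

end truncation

section Bounds

variable {k : Type*} [Field k] {n : ℕ} {f : DPoly k n} {A F G : Finset (DPoly k n)} {y : Fin n}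

lemma le_maxOrd {w : Der n} (hf : f ∈ F) (hw : w ∈ f.vars) : w.ord ≤ maxOrd w.var F :=
  Finset.le_sup_of_le hf
    (Finset.le_sup (f := Der.ord) (Finset.mem_filter.2 ⟨hw, rfl⟩))

lemma maxOrd_le {N : ℕ} (h : ∀ f ∈ F, ∀ w ∈ f.vars, w.var = y → w.ord ≤ N) : maxOrd y F ≤ N :=
  Finset.sup_le fun f hf => Finset.sup_le fun w hw =>
    h f hf w (Finset.mem_filter.1 hw).1 (Finset.mem_filter.1 hw).2

variable [LinearOrder (Der n)] {u w : Der n}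

lemma mem_ldSet : u ∈ ldSet A ↔ ∃ f ∈ A, ld f = u := by
  simp only [ldSet, Finset.mem_biUnion, Finset.mem_filter]
  exact ⟨fun ⟨f, hf, _, h⟩ => ⟨f, hf, h⟩, fun ⟨f, hf, h⟩ => ⟨f, hf, mem_vars_of_ld_eq h, h⟩⟩

lemma mem_lvSet : y ∈ lvSet A ↔ ∃ f ∈ A, ∃ u : Der n, ld f = u ∧ u.var = y := by
  simp only [lvSet, Finset.mem_image, mem_ldSet]
  exact ⟨fun ⟨u, ⟨f, hf, h⟩, hy⟩ => ⟨f, hf, u, h, hy⟩, fun ⟨f, hf, u, h, hy⟩ => ⟨u, ⟨f, hf, h⟩, hy⟩⟩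

/-- A set of non-constant polynomials with distinct leading variables. -/
structure Triangular (A : Finset (DPoly k n)) : Prop where
  not_isConst : ∀ f ∈ A, ¬ IsConst f
  eq_of_lv_eq : ∀ f ∈ A, ∀ g ∈ A, lv f = lv g → f = g

lemma Autoreduced.triangular (hA : Autoreduced A) : Triangular A := by
  refine ⟨hA.1, fun f hf g hg h => ?_⟩
  obtain ⟨u, hu⟩ := exists_ld_eq (hA.1 f hf)
  obtain ⟨w, hw⟩ := exists_ld_eq (hA.1 g hg)
  rw [lv_eq_var hu, lv_eq_var hw, WithBot.coe_inj] at h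
  exact hA.eq_of_var_eq hf hg hu hw h

lemma Triangular.ldOrd_eq (hA : Triangular A) (hf : f ∈ A) (hu : ld f = u) :
    ldOrd u.var A = u.ord := by
  refine le_antisymm (Finset.sup_le fun w hw => ?_) (Finset.le_sup (f := Der.ord)
    (Finset.mem_filter.2 ⟨mem_ldSet.2 ⟨f, hf, hu⟩, rfl⟩))
  obtain ⟨hwA, hwv⟩ := Finset.mem_filter.1 hw
  obtain ⟨g, hg, hgw⟩ := mem_ldSet.1 hwA
  obtain rfl := hA.eq_of_lv_eq g hg f hf (by rw [lv_eq_var hgw, lv_eq_var hu, hwv])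
  rw [WithBot.coe_inj.1 (hgw.symm.trans hu)]

lemma Triangular.exists_ld_eq_of_mem_lvSet (hA : Triangular A) (hy : y ∈ lvSet A) :
    ∃ f ∈ A, ld f = (⟨y, ldOrd y A⟩ : Der n) := by
  obtain ⟨f, hf, u, hu, rfl⟩ := mem_lvSet.1 hy
  exact ⟨f, hf, by rw [hA.ldOrd_eq hf hu, hu]⟩

lemma Triangular.ldOrd_le_maxOrd (hA : Triangular A) (hAG : A ⊆ G) (hy : y ∈ lvSet A) :
    ldOrd y A ≤ maxOrd y G := by
  obtain ⟨f, hf, hu⟩ := hA.exists_ld_eq_of_mem_lvSet hy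
  exact le_maxOrd (hAG hf) (mem_vars_of_ld_eq hu)

lemma Triangular.orderSet_subset_boundedDers (hA : Triangular A) (hAG : A ⊆ G) :
    orderSet (lvSet A) (fun y => ldOrd y A) (fun y => maxOrd y G)
      (∑ y ∈ lvSet A, (maxOrd y G - ldOrd y A)) ⊆ boundedDers (orderBound A G) := by
  intro w hw
  change w.ord ≤ orderBound A G w.var
  rw [orderBound]
  split_ifs with h
  · exact (hw.1 h).trans (hA.ldOrd_le_maxOrd hAG h)
  · exact hw.2 h

lemma Triangular.lt_and_var_ne_of_rk_lt (hA : Triangular A) {p c : DPoly k n} (hp : p ∈ A)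
    (hc : c ∈ A) (hw : ld p = w) (hu : ld c = u) (h : rk p < rk c) : w < u ∧ w.var ≠ u.var := by
  have hvar : w.var ≠ u.var := by
    intro hv
    obtain rfl := hA.eq_of_lv_eq p hp c hc (by rw [lv_eq_var hu, lv_eq_var hw, hv])
    exact lt_irrefl _ h
  have hle : w ≤ u := mem_supported.1 ((rk_le_rk_iff hu).1 h.le).1 (mem_vars_of_ld_eq hw)
  exact ⟨lt_of_le_of_ne hle fun he => hvar (by rw [he]), hvar⟩

end Bounds

section Systems

variable {k : Type*} [Field k] {n : ℕ} {I : Ideal (DPoly k n)}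

/-- The residue classes modulo `I` solve the system `A = 0`, `H ≠ 0`, where `H ≠ 0` is understood in
the strong sense that the elements of `H` are not zero divisors modulo `I`. -/
def SolvesSystem (I : Ideal (DPoly k n)) (A H : Set (DPoly k n)) : Prop :=
  (∀ f ∈ A, f ∈ I) ∧ ∀ h ∈ H, h ∈ regularMod I

variable [Differential k] {A H A' H' : Set (DPoly k n)}

theorem isLeast_sat_radDiffIdeal (A H : Set (DPoly k n)) :
    IsLeast {I | IsDiffIdeal I ∧ I.IsRadical ∧ SolvesSystem I A H} (sat (radDiffIdeal A) H) :=
  ⟨⟨isDiffIdeal_sat (isDiffIdeal_radDiffIdeal A) H, sat_isRadical (radDiffIdeal_isRadical A) H,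
    fun _ hf => le_sat _ _ (subset_radDiffIdeal A hf),
    fun _ hh => isSMulRegular_quotient_sat (Submonoid.subset_closure hh)⟩,
    fun _ ⟨hdiff, hrad, hA, hH⟩ => sat_le (radDiffIdeal_le hdiff hrad hA) hH⟩

theorem sat_radDiffIdeal_congr
    (h : ∀ I : Ideal (DPoly k n), IsDiffIdeal I → (SolvesSystem I A H ↔ SolvesSystem I A' H')) :
    sat (radDiffIdeal A) H = sat (radDiffIdeal A') H' := by
  have heq : {I : Ideal (DPoly k n) | IsDiffIdeal I ∧ I.IsRadical ∧ SolvesSystem I A H} =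
      {I | IsDiffIdeal I ∧ I.IsRadical ∧ SolvesSystem I A' H'} :=
    Set.ext fun I => and_congr_right fun hI => and_congr_right fun _ => h I hI
  exact (isLeast_sat_radDiffIdeal A H).unique (heq ▸ isLeast_sat_radDiffIdeal A' H')

variable [LinearOrder (Der n)] {D : Finset (DPoly k n)}

lemma solvesSystem_regIdeal (D : Finset (DPoly k n)) : SolvesSystem (regIdeal D) D (initSep D) :=
  ⟨fun _ hd => mem_regIdeal_of_mem hd,
    fun _ hx => isSMulRegular_quotient_sat (Submonoid.subset_closure hx)⟩

lemma SolvesSystem.regIdeal_le (h : SolvesSystem I D (initSep D)) (hI : IsDiffIdeal I) :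
    regIdeal D ≤ I :=
  DiffAlg.regIdeal_le hI h.1 h.2

lemma IsDiffRem.mem_iff {f g : DPoly k n} (hfg : IsDiffRem D f g) (hI : IsDiffIdeal I)
    (hD : SolvesSystem I D (initSep D)) : f ∈ I ↔ g ∈ I := by
  obtain ⟨-, h, hh, hmem⟩ := hfg
  exact mem_iff_mem_of_mul_sub_mem (Submonoid.closure_le.2 hD.2 hh) (hD.regIdeal_le hI hmem)

lemma IsDiffRem.mem_regularMod_iff {f g : DPoly k n} (hfg : IsDiffRem D f g) (hI : IsDiffIdeal I)
    (hD : SolvesSystem I D (initSep D)) : f ∈ regularMod I ↔ g ∈ regularMod I := by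
  obtain ⟨-, h, hh, hmem⟩ := hfg
  exact mem_regularMod_iff_of_mul_sub_mem (Submonoid.closure_le.2 hD.2 hh)
    (hD.regIdeal_le hI hmem)

end Systems

section LoopInvariant

variable {k : Type*} [Field k] {n : ℕ} [LinearOrder (Der n)] {b : Fin n → ℕ}
  {A G P D : Finset (DPoly k n)} {c d : DPoly k n} {u : Der n}

lemma solvesSystem_insert_iff {I : Ideal (DPoly k n)} :
    SolvesSystem I (insert c A : Finset _) (initSep (insert c A)) ↔
      (c ∈ I ∧ initial c ∈ regularMod I ∧ separant c ∈ regularMod I) ∧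
        SolvesSystem I A (initSep A) := by
  simp only [SolvesSystem, Finset.mem_coe, initSep, Finset.image_insert, Finset.forall_mem_union,
    Finset.forall_mem_insert]
  constructor
  · rintro ⟨⟨hc, hA⟩, ⟨hi, hiA⟩, hs, hsA⟩
    exact ⟨⟨hc, hi, hs⟩, hA, hiA, hsA⟩
  · rintro ⟨⟨hc, hi, hs⟩, hA, hiA, hsA⟩
    exact ⟨⟨hc, hA⟩, ⟨hi, hiA⟩, hs, hsA⟩

lemma Autoreduced.insert (hR : IsRanking n) (hD : Autoreduced D) (hd : ld d = u)
    (hDu : ∀ f ∈ D, ∀ w : Der n, ld f = w → w < u) (hred : ∀ f ∈ D, Reduced d f) :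
    Autoreduced (insert d D) := by
  refine ⟨Finset.forall_mem_insert .. |>.2 ⟨not_isConst_of_ld_eq hd, hD.1⟩, fun f hf g hg hne => ?_⟩
  rcases Finset.mem_insert.1 hf with rfl | hfD <;> rcases Finset.mem_insert.1 hg with rfl | hgD
  · exact absurd rfl hne
  · exact hred g hgD
  · obtain ⟨w, hw⟩ := exists_ld_eq (hD.1 f hfD)
    have hfg : ∀ v ∈ f.vars, v < u := fun v hv => (le_of_ld_eq hw hv).trans_lt (hDu f hfD w hw)
    refine ⟨fun v hv j hj hm => ?_, fun v hv => ?_⟩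
    · obtain rfl := WithBot.coe_inj.1 (hv.symm.trans hd)
      exact (hfg _ hm).asymm (hR.lt_shift v hj)
    · obtain rfl := WithBot.coe_inj.1 (hv.symm.trans hd)
      rw [degreeOf_eq_zero_iff_notMem_vars.2 fun hm => (hfg v hm).false]
      exact degreeOf_pos_iff.2 (mem_vars_of_ld_eq hd)
  · exact hD.2 f hfD g hgD hne

lemma exists_ld_eq_of_image_rk_eq (h : D.image rk = P.image rk) (hd : d ∈ D) (hu : ld d = u) :
    ∃ c ∈ P, ld c = u ∧ rk c = rk d := by
  obtain ⟨c, hc, hr⟩ := Finset.mem_image.1 (h ▸ Finset.mem_image_of_mem rk hd)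
  exact ⟨c, hc, (ld_eq_of_rk_eq hu hr).1, hr⟩

lemma lvSet_congr (h : D.image rk = P.image rk) : lvSet D = lvSet P := by
  ext y
  simp only [mem_lvSet]
  constructor
  · rintro ⟨d, hd, u, hu, hy⟩
    obtain ⟨c, hc, hcu, -⟩ := exists_ld_eq_of_image_rk_eq h hd hu
    exact ⟨c, hc, u, hcu, hy⟩
  · rintro ⟨c, hc, u, hu, hy⟩
    obtain ⟨d, hd, hdu, -⟩ := exists_ld_eq_of_image_rk_eq h.symm hc hu
    exact ⟨d, hd, u, hdu, hy⟩

variable [Differential k]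

/-- The leader `u` of `c` has no derivative in common with the derivatives of the leaders of `D`, so
that the congruence of `c` with its remainder holds coefficientwise in `u`. -/
lemma IsDiffRem.exists_coeffOf_mul_sub_mem (hR : IsRanking n) (hD : Autoreduced D) (hu : ld c = u)
    (hDu : ∀ f ∈ D, ∀ w : Der n, ld f = w → w < u ∧ w.var ≠ u.var) (hd : IsDiffRem D c d)
    (hle : rk d ≤ rk c) :
    ∃ x ∈ Submonoid.closure (initSep D : Set (DPoly k n)),
      x ∈ supported k ({u}ᶜ : Set (Der n)) ∧
        ∀ t, coeffOf u t (x * c - d) ∈ regIdeal D := by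
  obtain ⟨-, x, hx, hxc⟩ := hd
  have hxu : x ∈ supported k (Set.Iio u) := closure_initSep_mem_supported (fun f hf => by
    obtain ⟨w, hw⟩ := exists_ld_eq (hD.1 f hf)
    exact supported_mono (Set.Iic_subset_Iio.2 (hDu f hf w hw).1)
      (mem_supported_Iic_of_ld_eq hw)) hx
  refine ⟨x, hx, supported_mono (fun w (hw : w < u) => hw.ne) hxu,
    coeffOf_mem_regIdeal hR hD hDu hxc (sub_mem (mul_mem ?_ ?_) ?_)⟩
  · exact supported_mono Set.Iio_subset_Iic_self hxu
  · exact mem_supported_Iic_of_ld_eq hu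
  · exact ((rk_le_rk_iff hu).1 hle).1

lemma IsDiffRem.exists_mul_sub_mem (hR : IsRanking n) (hD : Autoreduced D) (hu : ld c = u)
    (hDu : ∀ f ∈ D, ∀ w : Der n, ld f = w → w < u ∧ w.var ≠ u.var) (hd : IsDiffRem D c d)
    (hle : rk d ≤ rk c) :
    ∃ x ∈ Submonoid.closure (initSep D : Set (DPoly k n)), x * c - d ∈ regIdeal D ∧
      x * initial c - coeffOf u (c.degreeOf u) d ∈ regIdeal D ∧
      x * separant c - pderiv u d ∈ regIdeal D := by
  obtain ⟨x, hx, hxu, hcoeff⟩ := hd.exists_coeffOf_mul_sub_mem hR hD hu hDu hle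
  refine ⟨x, hx, mem_of_forall_coeffOf_mem hcoeff, ?_, ?_⟩
  · have h := hcoeff (c.degreeOf u)
    rwa [coeffOf_sub, coeffOf_mul_of_mem_supported hxu, ← initial_eq_coeffOf hu] at h
  · have h := pderiv_mem_of_forall_coeffOf_mem hcoeff
    rwa [map_sub, pderiv_mul, pderiv_eq_zero_of_mem_supported hxu, zero_mul, zero_add,
      ← separant_eq_pderiv hu] at h

lemma IsDiffRem.mem_and_mem_regularMod_iff (hR : IsRanking n) (hD : Autoreduced D) (hu : ld c = u)
    (hDu : ∀ f ∈ D, ∀ w : Der n, ld f = w → w < u ∧ w.var ≠ u.var) (hd : IsDiffRem D c d)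
    (hrk : rk d = rk c) {I : Ideal (DPoly k n)} (hI : IsDiffIdeal I)
    (hDI : SolvesSystem I D (initSep D)) :
    (c ∈ I ∧ initial c ∈ regularMod I ∧ separant c ∈ regularMod I) ↔
      (d ∈ I ∧ initial d ∈ regularMod I ∧ separant d ∈ regularMod I) := by
  obtain ⟨x, hx, hmem, hinit, hsep⟩ := hd.exists_mul_sub_mem hR hD hu hDu hrk.le
  obtain ⟨hdu, hdeg⟩ := ld_eq_of_rk_eq hu hrk
  rw [← hdeg, ← initial_eq_coeffOf hdu] at hinit
  rw [← separant_eq_pderiv hdu] at hsep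
  have hxI : x ∈ regularMod I := Submonoid.closure_le.2 hDI.2 hx
  have hle := hDI.regIdeal_le hI
  rw [mem_iff_mem_of_mul_sub_mem hxI (hle hmem),
    mem_regularMod_iff_of_mul_sub_mem hxI (hle hinit),
    mem_regularMod_iff_of_mul_sub_mem hxI (hle hsep)]

/-- The invariant of the **for**-loop: `D` is the result for the elements of `P`. -/
structure LoopInv (b : Fin n → ℕ) (P D : Finset (DPoly k n)) : Prop where
  autoreduced : Autoreduced D
  bounded : ∀ d ∈ D, d ∈ supported k (boundedDers b)
  image_rk : D.image rk = P.image rk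
  solvesSystem_iff : ∀ I : Ideal (DPoly k n), IsDiffIdeal I →
    (SolvesSystem I P (initSep P) ↔ SolvesSystem I D (initSep D))

lemma LoopInv.empty (b : Fin n → ℕ) : LoopInv b (∅ : Finset (DPoly k n)) ∅ :=
  ⟨⟨by simp, by simp⟩, by simp, rfl, fun _ _ => Iff.rfl⟩

lemma LoopInv.insert (hR : IsRanking n) (h : LoopInv b P D) (hu : ld c = u)
    (hP : ∀ p ∈ P, ∀ w : Der n, ld p = w → w < u ∧ w.var ≠ u.var) (hd : IsDiffRem D c d)
    (hrk : rk d = rk c) (hdb : d ∈ supported k (boundedDers b)) :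
    LoopInv b (insert c P) (insert d D) := by
  have hDu : ∀ f ∈ D, ∀ w : Der n, ld f = w → w < u ∧ w.var ≠ u.var := fun f hf w hw => by
    obtain ⟨p, hp, hpw, -⟩ := exists_ld_eq_of_image_rk_eq h.image_rk hf hw
    exact hP p hp w hpw
  refine ⟨h.autoreduced.insert hR (ld_eq_of_rk_eq hu hrk).1 (fun f hf w hw => (hDu f hf w hw).1)
    hd.1, Finset.forall_mem_insert .. |>.2 ⟨hdb, h.bounded⟩, ?_, fun I hI => ?_⟩
  · rw [Finset.image_insert, Finset.image_insert, hrk, h.image_rk]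
  · rw [solvesSystem_insert_iff, solvesSystem_insert_iff, h.solvesSystem_iff I hI,
      and_congr_left_iff]
    exact hd.mem_and_mem_regularMod_iff hR h.autoreduced hu hDu hrk hI

lemma LoopInv.eq_top_of_rk_lt (hR : IsRanking n) (h : LoopInv b P D) (hu : ld c = u)
    (hP : ∀ p ∈ P, ∀ w : Der n, ld p = w → w < u ∧ w.var ≠ u.var) (hd : IsDiffRem D c d)
    (hlt : rk d < rk c) {I : Ideal (DPoly k n)} (hI : IsDiffIdeal I)
    (hPI : SolvesSystem I P (initSep P)) (hcI : initial c ∈ regularMod I) : I = ⊤ := by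
  obtain ⟨x, hx, -, hinit, -⟩ := hd.exists_mul_sub_mem hR h.autoreduced hu (fun f hf w hw => by
    obtain ⟨p, hp, hpw, -⟩ := exists_ld_eq_of_image_rk_eq h.image_rk hf hw
    exact hP p hp w hpw) hlt.le
  have hDI := (h.solvesSystem_iff I hI).1 hPI
  have hdeg : d.degreeOf u < c.degreeOf u := by
    obtain ⟨hdIic, hle⟩ := (rk_le_rk_iff hu).1 hlt.le
    refine lt_of_le_of_ne hle fun heq => ?_
    have hmem : u ∈ d.vars := degreeOf_pos_iff.1 (heq ▸ degreeOf_pos_iff.2 (mem_vars_of_ld_eq hu))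
    have hdu : ld d = u := ld_eq_coe_iff.2 ⟨hmem, fun w hw => mem_supported.1 hdIic hw⟩
    exact hlt.ne (by rw [rk_eq_coe hdu, rk_eq_coe hu, heq])
  rw [coeffOf_eq_zero_of_degreeOf_lt u d hdeg, sub_zero] at hinit
  have hreg : x * initial c ∈ regularMod I :=
    mul_mem (Submonoid.closure_le.2 hDI.2 hx) hcI
  refine (Ideal.eq_top_iff_one I).2 (mem_of_isSMulRegular_quotient_of_smul_mem hreg ?_)
  rw [smul_eq_mul, mul_one]
  exact hDI.regIdeal_le hI hinit

lemma LoopInv.isDiffRem_truncate (hR : IsRanking n) (hA : Triangular A) (hAG : A ⊆ G) (hPA : P ⊆ A)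
    (h : LoopInv (orderBound A G) P D) {B : Set (Der n)} (hB : IsLowerSet B)
    (hBP : ∀ c ∈ A, ∀ u : Der n, ld c = u → u ∈ B → c ∈ P) {f g : DPoly k n}
    (hf : ∀ w ∈ f.vars, w.ord ≤ maxOrd w.var G)
    (hfB : ∀ w ∈ f.vars, w.var ∈ lvSet A → w.ord ≤ ldOrd w.var A ∨ w ∈ B)
    (hg : IsDiffRem D f g) : IsDiffRem D f (truncate (orderBound A G) g) := by
  refine hg.truncate hR h.autoreduced h.bounded (hA.orderSet_subset_boundedDers hAG)
    (fun d hd u hu j hj hmem => ?_)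
    (mem_regFrac_orderSet hR (fun y hy => hA.ldOrd_le_maxOrd hAG hy) hB (isDiffIdeal_regIdeal D)
      (fun v hvB hvA hvo => ?_) (mem_supported.2 fun w hw => hf w hw) hfB)
  · obtain ⟨a, ha, hau, -⟩ := exists_ld_eq_of_image_rk_eq h.image_rk hd hu
    have hle := hmem.1 (mem_lvSet.2 ⟨a, hPA ha, u, hau, rfl⟩)
    have heq := hA.ldOrd_eq (hPA ha) hau
    simp only [Der.shift_ord, Der.shift_var] at hle
    lia
  · obtain ⟨c, hcA, hcv⟩ := hA.exists_ld_eq_of_mem_lvSet hvA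
    rw [← hvo] at hcv
    have hcP := hBP c hcA v hcv hvB
    have hPI := (h.solvesSystem_iff _ (isDiffIdeal_regIdeal D)).2 (solvesSystem_regIdeal D)
    refine ⟨c, hPI.1 c hcP, mem_supported.2 fun w hw =>
      ⟨le_of_ld_eq hcv hw, le_maxOrd (hAG hcA) hw⟩, ?_⟩
    rw [← separant_eq_pderiv hcv]
    exact hPI.2 _ (separant_mem_initSep hcP)

end LoopInvariant

section ForLoop

variable {k : Type*} [Field k] [Differential k] {n : ℕ} [LinearOrder (Der n)]
  {A G P D : Finset (DPoly k n)} {c e : DPoly k n} {L : List (DPoly k n)} {u : Der n}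

/-- The state of the **for**-loop over the elements of `A`, in order of increasing rank, when the
elements of `P` have been treated, with result `D`, and those of the list `L` are left. -/
structure LoopState (A G P D : Finset (DPoly k n)) (L : List (DPoly k n)) : Prop where
  inv : LoopInv (orderBound A G) P D
  union : P ∪ L.toFinset = A
  sorted : L.Pairwise fun p q => rk p < rk q
  lt : ∀ p ∈ P, ∀ q ∈ L, rk p < rk q

lemma LoopState.init (hL : L.toFinset = A) (hsort : L.Pairwise fun p q => rk p < rk q) :
    LoopState A G ∅ ∅ L :=
  ⟨LoopInv.empty _, by rw [hL, Finset.empty_union], hsort, by simp⟩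

lemma LoopState.subset (h : LoopState A G P D L) : P ⊆ A :=
  h.union ▸ Finset.subset_union_left

lemma LoopState.head_mem (h : LoopState A G P D (c :: L)) : c ∈ A := by
  simp [← h.union]

lemma LoopState.lt_and_var_ne (hA : Triangular A) (h : LoopState A G P D (c :: L))
    (hu : ld c = u) : ∀ p ∈ P, ∀ w : Der n, ld p = w → w < u ∧ w.var ≠ u.var := fun p hp _ hw =>
  hA.lt_and_var_ne_of_rk_lt (h.subset hp) h.head_mem hw hu (h.lt p hp c List.mem_cons_self)

lemma LoopState.mem_of_ld_lt (hA : Triangular A) (h : LoopState A G P D (c :: L)) (hu : ld c = u)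
    {p : DPoly k n} (hp : p ∈ A) {w : Der n} (hw : ld p = w) (hwu : w < u) : p ∈ P := by
  have hpA := hp
  rw [← h.union, Finset.mem_union, List.mem_toFinset, List.mem_cons] at hp
  rcases hp with hp | rfl | hp
  · exact hp
  · exact absurd (WithBot.coe_inj.1 (hw.symm.trans hu)) hwu.ne
  · have hrk := (List.pairwise_cons.1 h.sorted).1 p hp
    exact absurd (hA.lt_and_var_ne_of_rk_lt h.head_mem hpA hu hw hrk).1 hwu.asymm

lemma LoopState.isDiffRem_truncate (hR : IsRanking n) (hA : Triangular A) (hAG : A ⊆ G)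
    (h : LoopState A G P D (c :: L)) (he : IsDiffRem D c e) :
    IsDiffRem D c (truncate (orderBound A G) e) := by
  obtain ⟨u, hu⟩ := exists_ld_eq (hA.not_isConst c h.head_mem)
  refine h.inv.isDiffRem_truncate hR hA hAG h.subset (isLowerSet_Iio u)
    (fun p hp w hw hwu => h.mem_of_ld_lt hA hu hp hw hwu)
    (fun w hw => le_maxOrd (hAG h.head_mem) hw) (fun w hw _ => ?_) he
  rcases (le_of_ld_eq hu hw).lt_or_eq with hlt | rfl
  · exact Or.inr hlt
  · exact Or.inl (hA.ldOrd_eq h.head_mem hu).ge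

lemma LoopState.next (hR : IsRanking n) (hA : Triangular A) (hAG : A ⊆ G)
    (h : LoopState A G P D (c :: L)) (he : IsDiffRem D c e)
    (hrk : rk (truncate (orderBound A G) e) = rk c) :
    LoopState A G (insert c P) (insert (truncate (orderBound A G) e) D) L := by
  obtain ⟨u, hu⟩ := exists_ld_eq (hA.not_isConst c h.head_mem)
  obtain ⟨hc, hL⟩ := List.pairwise_cons.1 h.sorted
  refine ⟨h.inv.insert hR hu (h.lt_and_var_ne hA hu) (h.isDiffRem_truncate hR hA hAG he) hrk
    (truncate_mem_supported _ _), ?_, hL, Finset.forall_mem_insert .. |>.2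
    ⟨hc, fun p hp q hq => h.lt p hp q (List.mem_cons_of_mem _ hq)⟩⟩
  rw [Finset.insert_union, ← Finset.union_insert, ← List.toFinset_cons, h.union]

lemma LoopState.eq_top_of_rk_ne (hR : IsRanking n) (hA : Triangular A) (hAG : A ⊆ G)
    (h : LoopState A G P D (c :: L)) (he : IsDiffRem D c e) (hle : rk e ≤ rk c)
    (hrk : rk (truncate (orderBound A G) e) ≠ rk c) {I : Ideal (DPoly k n)} (hI : IsDiffIdeal I)
    (hAI : SolvesSystem I A (initSep A)) : I = ⊤ := by
  obtain ⟨u, hu⟩ := exists_ld_eq (hA.not_isConst c h.head_mem)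
  exact h.inv.eq_top_of_rk_lt hR hu (h.lt_and_var_ne hA hu) (h.isDiffRem_truncate hR hA hAG he)
    (((rk_truncate_le _ _).trans hle).lt_of_ne hrk) hI
    ⟨fun f hf => hAI.1 f (h.subset hf), fun x hx => hAI.2 x (initSep_mono h.subset hx)⟩
    (hAI.2 _ (initial_mem_initSep h.head_mem))

theorem ForLoop.loopInv_or_eq_top (hR : IsRanking n) (hA : Triangular A) (hAG : A ⊆ G)
    {r : Option (Finset (DPoly k n))} (hloop : ForLoop (orderBound A G) D L r)
    (h : LoopState A G P D L) :
    (∀ D', r = some D' → LoopInv (orderBound A G) A D') ∧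
      (r = none → ∀ I : Ideal (DPoly k n), IsDiffIdeal I → SolvesSystem I A (initSep A) →
        I = ⊤) := by
  induction hloop generalizing P with
  | done D =>
    refine ⟨?_, by simp⟩
    rintro _ ⟨⟩
    have hP : P = A := by simpa using h.union
    exact hP ▸ hP ▸ h.inv
  | next D c e L _ hrem _ hrk _ ih => exact ih (h.next hR hA hAG hrem hrk)
  | fail D c e L hrem hle hrk =>
    exact ⟨by simp, fun _ _ hI => h.eq_top_of_rk_ne hR hA hAG hrem hle hrk hI⟩

theorem exists_forLoop (hR : IsRanking n) (hA : Triangular A) (hAG : A ⊆ G)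
    (h : LoopState A G P D L) : ∃ r, ForLoop (orderBound A G) D L r := by
  induction L generalizing P D with
  | nil => exact ⟨_, ForLoop.done D⟩
  | cons c L ih =>
    obtain ⟨e, he, hle⟩ := exists_isDiffRem_rk_le hR h.inv.autoreduced c
    by_cases hrk : rk (truncate (orderBound A G) e) = rk c
    · obtain ⟨r, hr⟩ := ih (h.next hR hA hAG he hrk)
      exact ⟨r, ForLoop.next D c e L r he hle hrk hr⟩
    · exact ⟨none, ForLoop.fail D c e L he hle hrk⟩

end ForLoop

section Sorting

lemma exists_list_pairwise_lt_of_injOn {α β : Type*} [DecidableEq α] [LinearOrder β]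
    {s : Finset α} {f : α → β} (hf : Set.InjOn f s) :
    ∃ L : List α, (L.Pairwise fun a b => f a < f b) ∧ L.toFinset = s := by
  let L := s.toList.mergeSort fun a b => f a ≤ f b
  have hperm : L.Perm s.toList := List.mergeSort_perm ..
  have hmem : ∀ a ∈ L, a ∈ s := fun a ha => Finset.mem_toList.1 (hperm.mem_iff.1 ha)
  have hle : L.Pairwise fun a b => f a ≤ f b := by
    simpa using List.pairwise_mergeSort (le := fun a b => f a ≤ f b)
      (fun a b c hab hbc => by simpa using le_trans (by simpa using hab) (by simpa using hbc))
      (fun a b => by simpa using le_total (f a) (f b)) s.toList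
  have hne : L.Pairwise (· ≠ ·) := hperm.nodup_iff.2 s.nodup_toList
  refine ⟨L, (hle.and hne).imp_of_mem fun ha hb h => ?_, ?_⟩
  · exact h.1.lt_of_ne fun heq => h.2 (hf (hmem _ ha) (hmem _ hb) heq)
  · rw [List.toFinset_eq_of_perm _ _ hperm, Finset.toList_toFinset]

variable {k : Type*} [Field k] {n : ℕ} [LinearOrder (Der n)] {f g : DPoly k n}

lemma lv_eq_of_rk_eq (hf : ¬ IsConst f) (h : rk g = rk f) : lv g = lv f := by
  obtain ⟨u, hu⟩ := exists_ld_eq hf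
  rw [lv_eq_var hu, lv_eq_var (ld_eq_of_rk_eq hu h).1]

lemma Triangular.injOn_rk {A : Finset (DPoly k n)} (hA : Triangular A) :
    Set.InjOn rk (A : Set (DPoly k n)) :=
  fun f hf g hg h => hA.eq_of_lv_eq f hf g hg (lv_eq_of_rk_eq (hA.not_isConst g hg) h)

end Sorting

section Decomposition

variable {k : Type*} [Field k] [Differential k] {n : ℕ} [LinearOrder (Der n)]
  {A D G H : Finset (DPoly k n)}

theorem sat_radDiffIdeal_union_eq_of_isDiffRem
    (hAD : ∀ I : Ideal (DPoly k n), IsDiffIdeal I →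
      (SolvesSystem I A (initSep A) ↔ SolvesSystem I D (initSep D)))
    (hAH : initSep A ⊆ H) {rG rH : DPoly k n → DPoly k n}
    (hG : ∀ g ∈ G, IsDiffRem D g (rG g)) (hH : ∀ h ∈ H, IsDiffRem D h (rH h)) :
    sat (radDiffIdeal (↑(G ∪ A) : Set (DPoly k n))) H =
      sat (radDiffIdeal (↑((G.image rG).erase 0 ∪ D) : Set (DPoly k n)))
        ↑(H.image rH ∪ initSep D) := by
  refine sat_radDiffIdeal_congr fun I hI => ?_
  have hleft : SolvesSystem I ↑(G ∪ A) H ↔ SolvesSystem I A (initSep A) ∧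
      (∀ g ∈ G, g ∈ I) ∧ ∀ h ∈ H, h ∈ regularMod I := by
    simp only [SolvesSystem, Finset.mem_coe, Finset.forall_mem_union]
    exact ⟨fun h => ⟨⟨h.1.2, fun x hx => h.2 x (hAH hx)⟩, h.1.1, h.2⟩,
      fun h => ⟨⟨h.2.1, h.1.1⟩, h.2.2⟩⟩
  have hright : SolvesSystem I ↑((G.image rG).erase 0 ∪ D) ↑(H.image rH ∪ initSep D) ↔
      SolvesSystem I D (initSep D) ∧ (∀ g ∈ G, rG g ∈ I) ∧ ∀ h ∈ H, rH h ∈ regularMod I := by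
    have herase : (∀ x ∈ (G.image rG).erase 0, x ∈ I) ↔ ∀ g ∈ G, rG g ∈ I := by
      refine ⟨fun h g hg => ?_, fun h x hx => ?_⟩
      · by_cases h0 : rG g = 0
        · exact h0 ▸ zero_mem I
        · exact h _ (Finset.mem_erase.2 ⟨h0, Finset.mem_image_of_mem rG hg⟩)
      · obtain ⟨g, hg, rfl⟩ := Finset.mem_image.1 (Finset.mem_of_mem_erase hx)
        exact h g hg
    simp only [SolvesSystem, Finset.mem_coe, Finset.forall_mem_union, herase,
      Finset.forall_mem_image]
    exact ⟨fun h => ⟨⟨h.1.2, h.2.2⟩, h.1.1, h.2.1⟩, fun h => ⟨⟨h.2.1, h.1.1⟩, h.2.2, h.1.2⟩⟩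
  rw [hleft, hright, hAD I hI]
  refine and_congr_right fun hD => and_congr ?_ ?_
  · exact forall₂_congr fun g hg => (hG g hg).mem_iff hI hD
  · exact forall₂_congr fun h hh => (hH h hh).mem_regularMod_iff hI hD

theorem sat_radDiffIdeal_eq_sat_diffIdeal (hR : IsRanking n) (hD : Autoreduced D)
    (hDH : initSep D ⊆ H) :
    sat (radDiffIdeal (D : Set (DPoly k n))) H = sat (diffIdeal (D : Set (DPoly k n))) H := by
  refine le_antisymm ?_ (sat_mono (diffIdeal_le (isDiffIdeal_radDiffIdeal _)
    (subset_radDiffIdeal _)) le_rfl)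
  rw [← sat_sat (I := diffIdeal (D : Set (DPoly k n))) (Finset.coe_subset.2 hDH)]
  exact sat_mono (radDiffIdeal_le (isDiffIdeal_regIdeal D) (regIdeal_isRadical hR hD)
    fun d hd => mem_regIdeal_of_mem hd) le_rfl

end Decomposition

section ReducedSystem

variable {k : Type*} [Field k] {n : ℕ} [LinearOrder (Der n)] {b : Fin n → ℕ}
  {A D F' G H H' : Finset (DPoly k n)} {d x : DPoly k n}

lemma mem_initSep_singleton {f : DPoly k n} :
    x ∈ initSep {f} ↔ x = initial f ∨ x = separant f := by
  simp [initSep]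

lemma vars_subset_of_mem_initSep_singleton {f : DPoly k n} (hx : x ∈ initSep {f}) :
    x.vars ⊆ f.vars := by
  rcases mem_initSep_singleton.1 hx with rfl | rfl
  · exact vars_initial_subset f
  · exact vars_separant_subset f

lemma Autoreduced.partReduced_of_mem_initSep (hR : IsRanking n) (hD : Autoreduced D)
    (hx : x ∈ initSep D) (hd : d ∈ D) : PartReduced x d := by
  obtain ⟨f, hf, rfl | rfl⟩ := mem_initSep.1 hx
  · exact (hD.partReduced hR hf hd).of_vars_subset (vars_initial_subset f)
  · exact (hD.partReduced hR hf hd).of_vars_subset (vars_separant_subset f)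

variable [Differential k]

/-- The system `F' ∪ D = 0`, `H' ≠ 0` is the result of the reduction of the system `G ∪ A = 0`,
`H ≠ 0`, in which `A` is the triangular set and orders are bounded by `b`. -/
structure ReducedSystem (b : Fin n → ℕ) (A G H D F' H' : Finset (DPoly k n)) : Prop where
  inv : LoopInv b A D
  zero_notMem : 0 ∉ F'
  reduced : ∀ x ∈ F', ∀ d ∈ D, Reduced x d
  partReduced : ∀ x ∈ F' ∪ D ∪ H', ∀ d ∈ D, PartReduced x d
  bounded : ∀ x ∈ F' ∪ D ∪ H', x ∈ supported k (boundedDers b)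
  initSep_subset : initSep D ⊆ H'
  ideal_eq : sat (radDiffIdeal (↑(G ∪ A) : Set (DPoly k n))) H =
    sat (radDiffIdeal (↑(F' ∪ D) : Set (DPoly k n))) H'

lemma LoopInv.image_truncate_initSep (h : LoopInv b A D) :
    (initSep D).image (truncate b) = initSep D := by
  have heq : Set.EqOn (truncate b) id (initSep D : Set (DPoly k n)) := fun x hx => by
    rw [truncate_eq_truncHom, truncHom_eq_self (initSep_mem_supported h.bounded hx), id]
  rw [Finset.image_congr heq, Finset.image_id]

lemma LoopInv.reducedSystem (hR : IsRanking n) (h : LoopInv b A D) (hAH : initSep A ⊆ H)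
    {rG rH : DPoly k n → DPoly k n} (hG : ∀ g ∈ G, IsDiffRem D g (rG g))
    (hH : ∀ x ∈ H, IsDiffRem D x (rH x)) (hGb : ∀ g ∈ G, rG g ∈ supported k (boundedDers b))
    (hHb : ∀ x ∈ H, rH x ∈ supported k (boundedDers b)) :
    ReducedSystem b A G H D ((G.image rG).erase 0) (H.image rH ∪ initSep D) := by
  have hF : ∀ x ∈ (G.image rG).erase 0,
      (∀ d ∈ D, Reduced x d) ∧ x ∈ supported k (boundedDers b) := fun x hx => by
    obtain ⟨g, hg, rfl⟩ := Finset.mem_image.1 (Finset.mem_of_mem_erase hx)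
    exact ⟨(hG g hg).1, hGb g hg⟩
  refine ⟨h, Finset.notMem_erase 0 _, fun x hx => (hF x hx).1, ?_, ?_,
    Finset.subset_union_right, sat_radDiffIdeal_union_eq_of_isDiffRem h.solvesSystem_iff hAH hG hH⟩
  · simp only [Finset.forall_mem_union, Finset.forall_mem_image]
    exact ⟨⟨fun x hx d hd => ((hF x hx).1 d hd).1, fun x hx d => h.autoreduced.partReduced hR hx⟩,
      fun x hx d hd => ((hH x hx).1 d hd).1,
      fun x hx d => h.autoreduced.partReduced_of_mem_initSep hR hx⟩
  · simp only [Finset.forall_mem_union, Finset.forall_mem_image]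
    exact ⟨⟨fun x hx => (hF x hx).2, h.bounded⟩, hHb,
      fun x hx => initSep_mem_supported h.bounded hx⟩

lemma ReducedSystem.sat_radDiffIdeal_eq_top (h : ReducedSystem b A G H D F' H')
    (hbad : ¬ ((∀ g ∈ F', ¬ IsConst g) ∧ 0 ∉ H')) :
    sat (radDiffIdeal (↑(G ∪ A) : Set (DPoly k n))) H = ⊤ := by
  rw [h.ideal_eq]
  by_cases h0 : 0 ∈ H'
  · exact (Ideal.eq_top_iff_one _).2 ⟨0, Submonoid.subset_closure h0, by simp⟩
  · obtain ⟨g, hg, hconst⟩ : ∃ g ∈ F', IsConst g := by simpa [h0] using hbad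
    exact Ideal.eq_top_of_isUnit_mem _
      (le_sat _ _ (subset_radDiffIdeal _ (Finset.mem_union_left _ hg)))
      (isUnit_of_isConst hconst (ne_of_mem_of_not_mem hg h.zero_notMem))

lemma ReducedSystem.regularSystem (h : ReducedSystem b A G H D F' H') : RegularSystem D H' :=
  ⟨h.inv.autoreduced, fun x hx => h.partReduced x (Finset.mem_union_right _ hx), h.initSep_subset⟩

end ReducedSystem

section Body

variable {k : Type*} [Field k] {n : ℕ} [LinearOrder (Der n)]
  {t : Triple k n} {f x : DPoly k n} {D : Finset (DPoly k n)}

/-- The invariant of the triples treated by the algorithm. -/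
structure TripleInv (t : Triple k n) : Prop where
  nonempty : t.F.Nonempty
  not_isConst : ∀ f ∈ t.F, ¬ IsConst f
  autoreduced : Autoreduced t.C
  reduced : ∀ f ∈ t.F, ∀ c ∈ t.C, Reduced f c
  partReduced : ∀ h ∈ t.H, ∀ c ∈ t.C, PartReduced h c
  initSep_subset : initSep t.C ⊆ t.H

/-- The set `G` of the algorithm: the equations to be reduced. -/
def bodyG (t : Triple k n) (f : DPoly k n) : Finset (DPoly k n) := (t.F ∪ conflict t.C f) \ {f}

/-- The set `C̄` of the algorithm: the triangular set to be autoreduced. -/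
def bodyC (t : Triple k n) (f : DPoly k n) : Finset (DPoly k n) := (t.C \ conflict t.C f) ∪ {f}

lemma mem_bodyC : x ∈ bodyC t f ↔ (x ∈ t.C ∧ lv x ≠ lv f) ∨ x = f := by
  simp only [bodyC, conflict, Finset.mem_union, Finset.mem_sdiff, Finset.mem_filter,
    Finset.mem_singleton]
  tauto

lemma self_mem_bodyC (t : Triple k n) (f : DPoly k n) : f ∈ bodyC t f := mem_bodyC.2 (Or.inr rfl)

lemma bodyG_union_bodyC (hf : f ∈ t.F) : bodyG t f ∪ bodyC t f = t.F ∪ t.C := by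
  ext x
  by_cases hx : x = f
  · simp [hx, hf, self_mem_bodyC]
  · simp only [bodyG, bodyC, conflict, Finset.mem_union, Finset.mem_sdiff, Finset.mem_filter,
      Finset.mem_singleton, hx]
    tauto

lemma bodyC_subset (hf : f ∈ t.F) : bodyC t f ⊆ t.F ∪ t.C ∪ t.H :=
  (Finset.subset_union_right.trans (bodyG_union_bodyC hf).subset).trans Finset.subset_union_left

lemma bodyG_subset (hf : f ∈ t.F) : bodyG t f ⊆ t.F ∪ t.C ∪ t.H :=
  (Finset.subset_union_left.trans (bodyG_union_bodyC hf).subset).trans Finset.subset_union_left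

lemma TripleInv.triangular_bodyC (ht : TripleInv t) (hf : f ∈ t.F) : Triangular (bodyC t f) := by
  have hC := ht.autoreduced.triangular
  refine ⟨fun x hx => ?_, fun x hx y hy hxy => ?_⟩
  · rcases mem_bodyC.1 hx with hx | rfl
    · exact hC.not_isConst x hx.1
    · exact ht.not_isConst x hf
  · rcases mem_bodyC.1 hx with hx | rfl <;> rcases mem_bodyC.1 hy with hy | rfl
    · exact hC.eq_of_lv_eq x hx.1 y hy.1 hxy
    · exact absurd hxy hx.2
    · exact absurd hxy.symm hy.2
    · rfl

lemma TripleInv.initSep_bodyC (ht : TripleInv t) (f : DPoly k n) :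
    initSep (bodyC t f) ⊆ t.H ∪ initSep {f} := by
  intro x hx
  obtain ⟨d, hd, hxd⟩ := mem_initSep.1 hx
  rcases mem_bodyC.1 hd with hd | rfl
  · exact Finset.mem_union_left _ (ht.initSep_subset (mem_initSep.2 ⟨d, hd.1, hxd⟩))
  · exact Finset.mem_union_right _ (mem_initSep.2 ⟨d, Finset.mem_singleton_self d, hxd⟩)

lemma ord_le_maxOrd_of_mem_union_initSep (hf : f ∈ t.F) (hx : x ∈ t.H ∪ initSep {f}) {w : Der n}
    (hw : w ∈ x.vars) : w.ord ≤ maxOrd w.var (t.F ∪ t.C ∪ t.H) := by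
  rcases Finset.mem_union.1 hx with hx | hx
  · exact le_maxOrd (Finset.mem_union_right _ hx) hw
  · exact le_maxOrd (by simp [hf]) (vars_subset_of_mem_initSep_singleton hx hw)

variable [Differential k]

lemma body_iff (hf : f ∈ t.F) {U' : Finset (Triple k n)}
    {T' : Finset (Finset (DPoly k n) × Finset (DPoly k n))} :
    Body t f U' T' ↔ ∃ L r U₁, (L.Pairwise fun p q => rk p < rk q) ∧ L.toFinset = bodyC t f ∧
      ForLoop (orderBound (bodyC t f) (t.F ∪ t.C ∪ t.H)) ∅ L r ∧
      Collect (orderBound (bodyC t f) (t.F ∪ t.C ∪ t.H)) (bodyG t f) t.H f r U₁ T' ∧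
      U' = U₁ ∪ split t f := by
  rw [← bodyG_union_bodyC hf]
  rfl

/-- The system `F₁ ∪ D = 0`, `H₁ ≠ 0` is the result of the reduction of the system given by the
triple `t` with the choice of `f`. -/
abbrev BodyReduced (t : Triple k n) (f : DPoly k n) (D F₁ H₁ : Finset (DPoly k n)) : Prop :=
  ReducedSystem (orderBound (bodyC t f) (t.F ∪ t.C ∪ t.H)) (bodyC t f) (bodyG t f)
    (t.H ∪ initSep {f}) D F₁ H₁

/-- The possible results of the reduction step in the body of the **while**-loop. -/
inductive ReduceResult (t : Triple k n) (f : DPoly k n) :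
    Finset (Triple k n) → Finset (Finset (DPoly k n) × Finset (DPoly k n)) → Prop
  | discard (h : sat (radDiffIdeal (↑(t.F ∪ t.C) : Set (DPoly k n))) (↑(t.H ∪ initSep {f})) = ⊤) :
      ReduceResult t f ∅ ∅
  | proceed (D F' H' : Finset (DPoly k n)) (h : BodyReduced t f D F' H')
      (hF : ∀ g ∈ F', ¬ IsConst g) (hne : F'.Nonempty) : ReduceResult t f {⟨F', D, H'⟩} ∅
  | output (D H' : Finset (DPoly k n)) (h : BodyReduced t f D ∅ H') :
      ReduceResult t f ∅ {(D, H')}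

lemma TripleInv.bodyReduced (hR : IsRanking n) (ht : TripleInv t) (hf : f ∈ t.F)
    (hD : LoopInv (orderBound (bodyC t f) (t.F ∪ t.C ∪ t.H)) (bodyC t f) D)
    {remG remH : DPoly k n → DPoly k n} (hG : ∀ g ∈ bodyG t f, IsDiffRem D g (remG g))
    (hH : ∀ h ∈ t.H ∪ initSep {f}, IsDiffRem D h (remH h)) :
    BodyReduced t f D
      ((((bodyG t f).image remG).image
        (truncate (orderBound (bodyC t f) (t.F ∪ t.C ∪ t.H)))).erase 0)
      (((t.H ∪ initSep {f}).image remH ∪ initSep D).image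
        (truncate (orderBound (bodyC t f) (t.F ∪ t.C ∪ t.H)))) := by
  rw [Finset.image_union, Finset.image_image, Finset.image_image, hD.image_truncate_initSep]
  have htrunc : ∀ {x g : DPoly k n}, (∀ w ∈ x.vars, w.ord ≤ maxOrd w.var (t.F ∪ t.C ∪ t.H)) →
      IsDiffRem D x g → IsDiffRem D x (truncate _ g) := fun hx hg =>
    hD.isDiffRem_truncate hR (ht.triangular_bodyC hf) (bodyC_subset hf) subset_rfl
      isLowerSet_univ (fun c hc _ _ _ => hc) hx (fun _ _ _ => Or.inr trivial) hg
  exact hD.reducedSystem hR (ht.initSep_bodyC f)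
    (fun g hg => htrunc (fun _ => le_maxOrd (bodyG_subset hf hg)) (hG g hg))
    (fun h hh => htrunc (fun _ => ord_le_maxOrd_of_mem_union_initSep hf hh) (hH h hh))
    (fun _ _ => truncate_mem_supported _ _) fun _ _ => truncate_mem_supported _ _

lemma BodyReduced.reduceResult {F' H' : Finset (DPoly k n)} (h : BodyReduced t f D F' H')
    (hf : f ∈ t.F) :
    ReduceResult t f
      (if (∀ g ∈ F', ¬ IsConst g) ∧ 0 ∉ H' ∧ F' ≠ ∅ then {⟨F', D, H'⟩} else ∅)
      (if (∀ g ∈ F', ¬ IsConst g) ∧ 0 ∉ H' ∧ F' = ∅ then {(D, H')} else ∅) := by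
  by_cases hok : (∀ g ∈ F', ¬ IsConst g) ∧ 0 ∉ H'
  · by_cases hF' : F' = ∅
    · rw [if_neg (by tauto), if_pos ⟨hok.1, hok.2, hF'⟩]
      exact .output D H' (hF' ▸ h)
    · rw [if_pos ⟨hok.1, hok.2, hF'⟩, if_neg (by tauto)]
      exact .proceed D F' H' h hok.1 (Finset.nonempty_iff_ne_empty.2 hF')
  · rw [if_neg (by tauto), if_neg (by tauto)]
    exact .discard (bodyG_union_bodyC hf ▸ h.sat_radDiffIdeal_eq_top hok)

theorem Body.reduceResult (hR : IsRanking n) (ht : TripleInv t) (hf : f ∈ t.F)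
    {U' : Finset (Triple k n)} {T' : Finset (Finset (DPoly k n) × Finset (DPoly k n))}
    (hb : Body t f U' T') : ∃ U₁, ReduceResult t f U₁ T' ∧ U' = U₁ ∪ split t f := by
  obtain ⟨L, r, U₁, hsort, hL, hloop, hcollect, hU⟩ := (body_iff hf).1 hb
  refine ⟨U₁, ?_, hU⟩
  obtain ⟨hsome, hnone⟩ := hloop.loopInv_or_eq_top hR (ht.triangular_bodyC hf) (bodyC_subset hf)
    (LoopState.init hL hsort)
  cases hcollect with
  | discard =>
    obtain ⟨hdiff, -, hsolves⟩ := (isLeast_sat_radDiffIdeal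
      (↑(t.F ∪ t.C) : Set (DPoly k n)) ↑(t.H ∪ initSep {f})).1
    refine .discard (hnone rfl _ hdiff
      ⟨fun c hc => hsolves.1 c ?_, fun x hx => hsolves.2 x (ht.initSep_bodyC f hx)⟩)
    exact bodyG_union_bodyC hf ▸ Finset.mem_union_right _ hc
  | reduce D remG remH hG hH F' H' hF' hH' =>
    subst hF' hH'
    exact (ht.bodyReduced hR hf (hsome D rfl) hG hH).reduceResult hf

theorem exists_body (hR : IsRanking n) (ht : TripleInv t) (hf : f ∈ t.F) :
    ∃ U' T', Body t f U' T' := by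
  simp only [body_iff hf]
  have hA := ht.triangular_bodyC hf
  obtain ⟨L, hsort, hL⟩ := exists_list_pairwise_lt_of_injOn hA.injOn_rk
  have hstate := LoopState.init (G := t.F ∪ t.C ∪ t.H) hL hsort
  obtain ⟨r, hr⟩ := exists_forLoop hR hA (bodyC_subset hf) hstate
  cases r with
  | none => exact ⟨_, _, L, none, _, hsort, hL, hr, .discard, rfl⟩
  | some D =>
    have hD := (hr.loopInv_or_eq_top hR hA (bodyC_subset hf) hstate).1 D rfl
    choose rem hrem _ using fun g => exists_isDiffRem_rk_le hR hD.autoreduced g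
    exact ⟨_, _, L, some D, _, hsort, hL, hr,
      .reduce D rem rem (fun g _ => hrem g) (fun h _ => hrem h) _ _ rfl rfl, rfl⟩

end Body

section Split

variable {k : Type*} [Field k] {n : ℕ} [LinearOrder (Der n)]
  {t t' : Triple k n} {f : DPoly k n}

lemma isConst_initial_of_isConst_separant [CharZero k] (hf : ¬ IsConst f)
    (h : IsConst (separant f)) : IsConst (initial f) := by
  obtain ⟨u, hu⟩ := exists_ld_eq hf
  obtain ⟨c, hc⟩ := h
  obtain ⟨d, hd⟩ := Nat.exists_eq_succ_of_ne_zero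
    (degreeOf_pos_iff.2 (mem_vars_of_ld_eq hu)).ne'
  have hcoeff : (toPolynomialIn u (separant f)).coeff d =
      initial f * ((d : DPoly k n) + 1) := by
    rw [separant_eq_pderiv hu, ← derivative_toPolynomialIn, Polynomial.coeff_derivative,
      coeff_toPolynomialIn, ← Nat.succ_eq_add_one, ← hd, initial_eq_coeffOf hu]
  rw [hc, toPolynomialIn_of_mem_supported (f := C c) (Subalgebra.algebraMap_mem _ c),
    Polynomial.coeff_C] at hcoeff
  split_ifs at hcoeff with hd0
  · exact ⟨c, by simpa [hd0] using hcoeff.symm⟩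
  · exact absurd hcoeff.symm (mul_ne_zero (initial_ne_zero hf) (Nat.cast_add_one_ne_zero d))

lemma mem_split_iff [CharZero k] (hf : ¬ IsConst f) : t' ∈ split t f ↔
    ∃ x ∈ initSep {f}, ¬ IsConst x ∧ t' = ⟨insert x t.F, t.C, t.H⟩ := by
  have hconst := isConst_initial_of_isConst_separant hf
  unfold split
  split_ifs with hs hi
  · simp [mem_initSep_singleton, hs, hconst hs]
  · simp [mem_initSep_singleton, hs, hi]
  · simp [mem_initSep_singleton, hs, hi, or_comm]

lemma TripleInv.of_mem_split [CharZero k] (ht : TripleInv t) (hf : f ∈ t.F)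
    (h : t' ∈ split t f) : TripleInv t' := by
  have hfc := ht.not_isConst f hf
  obtain ⟨x, hx, hxc, rfl⟩ := (mem_split_iff hfc).1 h
  refine ⟨Finset.insert_nonempty _ _, Finset.forall_mem_insert .. |>.2 ⟨hxc, ht.not_isConst⟩,
    ht.autoreduced, Finset.forall_mem_insert .. |>.2 ⟨fun c hc => ?_, ht.reduced⟩,
    ht.partReduced, ht.initSep_subset⟩
  rcases mem_initSep_singleton.1 hx with rfl | rfl
  · exact (ht.reduced f hf c hc).initial hfc
  · exact (ht.reduced f hf c hc).separant hfc

variable [Differential k]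

/-- The ideal `{F ∪ C} : H^∞` described by a triple `(F, C, H)`. -/
def tripleIdeal (t : Triple k n) : Ideal (DPoly k n) :=
  sat (radDiffIdeal (↑(t.F ∪ t.C) : Set (DPoly k n))) t.H

lemma ReduceResult.ideal_eq (hR : IsRanking n) (hf : f ∈ t.F) {U₁ : Finset (Triple k n)}
    {T' : Finset (Finset (DPoly k n) × Finset (DPoly k n))} (h : ReduceResult t f U₁ T') :
    sat (radDiffIdeal (↑(t.F ∪ t.C) : Set (DPoly k n))) (↑(t.H ∪ initSep {f})) =
      (⨅ p ∈ T', sat (diffIdeal (p.1 : Set (DPoly k n))) p.2) ⊓ ⨅ t' ∈ U₁, tripleIdeal t' := by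
  cases h with
  | discard h => simpa using h
  | proceed D F' H' h =>
    rw [← bodyG_union_bodyC hf, h.ideal_eq]
    simp [tripleIdeal]
  | output D H' h =>
    rw [← bodyG_union_bodyC hf, h.ideal_eq, Finset.empty_union,
      sat_radDiffIdeal_eq_sat_diffIdeal hR h.inv.autoreduced h.initSep_subset]
    simp

variable [CharZero k]

lemma tripleIdeal_eq_inf_split (hf : ¬ IsConst f) :
    tripleIdeal t =
      sat (radDiffIdeal (↑(t.F ∪ t.C) : Set (DPoly k n))) (↑(t.H ∪ initSep {f})) ⊓
        ⨅ t' ∈ split t f, tripleIdeal t' := by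
  refine le_antisymm (le_inf (sat_mono le_rfl (by simp)) (le_iInf₂ fun t' ht' => ?_)) ?_
  · obtain ⟨x, -, -, rfl⟩ := (mem_split_iff hf).1 ht'
    exact sat_mono (radDiffIdeal_mono (Finset.coe_subset.2
      (Finset.union_subset_union_left (Finset.subset_insert _ _)))) le_rfl
  · rintro y ⟨hy, hysplit⟩
    rw [Finset.coe_union t.H] at hy
    refine mem_sat_radDiffIdeal_of_forall_mem_insert hy fun e he => ?_
    by_cases hc : IsConst e
    · refine Or.inl (isUnit_of_isConst hc ?_)
      rcases mem_initSep_singleton.1 he with rfl | rfl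
      · exact initial_ne_zero hf
      · exact separant_ne_zero hf
    · have hmem : y ∈ tripleIdeal ⟨insert e t.F, t.C, t.H⟩ :=
        iInf₂_le (f := fun t' (_ : t' ∈ split t f) => tripleIdeal t') _
          ((mem_split_iff hf).2 ⟨e, he, hc, rfl⟩) hysplit
      rw [tripleIdeal, Finset.insert_union, Finset.coe_insert] at hmem
      exact Or.inr hmem

end Split

section Measure

variable {k : Type*} [Field k] {n : ℕ} [LinearOrder (Der n)] {t t' : Triple k n}
  {A C D : Finset (DPoly k n)} {c f : DPoly k n} {u : Der n} {y : Fin n}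

lemma lv_eq_coe_iff : lv c = y ↔ ∃ u : Der n, ld c = u ∧ u.var = y := WithBot.map_eq_some_iff

/-- The order and the degree of the leader of `c`, compared lexicographically; it is `⊤` for
constants. -/
def leaderKey (c : DPoly k n) : WithTop (ℕ ×ₗ ℕ) :=
  WithBot.recBotCoe ⊤ (fun u : Der n => ((toLex (u.ord, c.degreeOf u) : ℕ ×ₗ ℕ) :
    WithTop (ℕ ×ₗ ℕ))) (ld c)

lemma leaderKey_eq_coe (h : ld c = u) :
    leaderKey c = ((toLex (u.ord, c.degreeOf u) : ℕ ×ₗ ℕ) : WithTop (ℕ ×ₗ ℕ)) := by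
  rw [leaderKey, h]
  rfl

lemma leaderKey_lt_of_reduced (hf : ld f = u) (hc : lv c = u.var) (h : Reduced f c) :
    leaderKey f < leaderKey c := by
  obtain ⟨w, hw, hwu⟩ := lv_eq_coe_iff.1 hc
  rw [leaderKey_eq_coe hf, leaderKey_eq_coe hw, WithTop.coe_lt_coe, Prod.Lex.toLex_lt_toLex]
  rcases (h.1.ord_le (mem_vars_of_ld_eq hf) hw hwu.symm).lt_or_eq with hlt | heq
  · exact Or.inl hlt
  · obtain rfl : u = w := Der.ext hwu.symm heq
    exact Or.inr ⟨rfl, h.2 u hw⟩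

/-- The least leader key of the elements of `C` with leading variable `y`. -/
def keyAt (C : Finset (DPoly k n)) (y : Fin n) : WithTop (ℕ ×ₗ ℕ) :=
  (C.filter fun c => lv c = (y : WithBot (Fin n))).inf leaderKey

lemma keyAt_le (hc : c ∈ C) (hy : lv c = y) : keyAt C y ≤ leaderKey c :=
  Finset.inf_le (Finset.mem_filter.2 ⟨hc, hy⟩)

lemma le_keyAt {κ : WithTop (ℕ ×ₗ ℕ)} (h : ∀ c ∈ C, lv c = y → κ ≤ leaderKey c) : κ ≤ keyAt C y :=
  Finset.le_inf fun c hc => h c (Finset.mem_filter.1 hc).1 (Finset.mem_filter.1 hc).2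

lemma keyAt_le_keyAt_of_image_rk_eq (h : D.image rk = A.image rk) : keyAt A ≤ keyAt D :=
  fun y => le_keyAt fun d hd hy => by
    obtain ⟨u, hu, rfl⟩ := lv_eq_coe_iff.1 hy
    obtain ⟨a, ha, hau, hrk⟩ := exists_ld_eq_of_image_rk_eq h hd hu
    rw [leaderKey_eq_coe hu, ← (ld_eq_of_rk_eq hu hrk).2, ← leaderKey_eq_coe hau]
    exact keyAt_le ha (lv_eq_var hau)

lemma keyAt_congr (h : D.image rk = A.image rk) : keyAt D = keyAt A :=
  le_antisymm (keyAt_le_keyAt_of_image_rk_eq h.symm) (keyAt_le_keyAt_of_image_rk_eq h)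

lemma keyAt_bodyC_lt (hf : ¬ IsConst f) (hred : ∀ c ∈ t.C, Reduced f c) :
    keyAt (bodyC t f) < keyAt t.C := by
  obtain ⟨u, hu⟩ := exists_ld_eq hf
  have hlt : keyAt (bodyC t f) u.var < keyAt t.C u.var := by
    refine (keyAt_le (self_mem_bodyC t f) (lv_eq_var hu)).trans_lt ?_
    refine (Finset.lt_inf_iff (leaderKey_eq_coe hu ▸ WithTop.coe_lt_top _)).2 fun c hc => ?_
    obtain ⟨hcC, hcu⟩ := Finset.mem_filter.1 hc
    exact leaderKey_lt_of_reduced hu hcu (hred c hcC)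
  refine Pi.lt_def.2 ⟨fun y => ?_, u.var, hlt⟩
  obtain rfl | hy := eq_or_ne y u.var
  · exact hlt.le
  · refine le_keyAt fun c hc hcy => keyAt_le (mem_bodyC.2 (Or.inl ⟨hc, ?_⟩)) hcy
    rw [hcy, lv_eq_var hu]
    exact WithBot.coe_injective.ne hy

/-- The least rank of the elements of `F`. -/
def minRk (F : Finset (DPoly k n)) : WithTop (WithBot (Der n ×ₗ ℕ)) :=
  F.inf fun f => (rk f : WithTop (WithBot (Der n ×ₗ ℕ)))

/-- The order on triples that decreases in the algorithm: reduction lowers the leader keys of `C`,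
and splitting preserves them but lowers the least rank of `F`. -/
def TripleLT (t t' : Triple k n) : Prop :=
  Prod.Lex (· < ·) (· < ·) (keyAt t.C, minRk t.F) (keyAt t'.C, minRk t'.F)

lemma wellFounded_tripleLT (hR : IsRanking n) : WellFounded (TripleLT (k := k) (n := n)) :=
  have := hR.wellFoundedLT
  InvImage.wf (fun t : Triple k n => (keyAt t.C, minRk t.F))
    (WellFounded.prod_lex wellFounded_lt wellFounded_lt)

lemma tripleLT_of_mem_split [CharZero k] (hf : ¬ IsConst f) (hmin : ∀ g ∈ t.F, rk f ≤ rk g)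
    (h : t' ∈ split t f) : TripleLT t' t := by
  obtain ⟨x, hx, -, rfl⟩ := (mem_split_iff hf).1 h
  have hlt : rk x < rk f := by
    rcases mem_initSep_singleton.1 hx with rfl | rfl
    · exact rk_initial_lt hf
    · exact rk_separant_lt hf
  exact .right _ <| calc
    minRk (insert x t.F) ≤ rk x := Finset.inf_le (Finset.mem_insert_self x t.F)
    _ < rk f := WithTop.coe_lt_coe.2 hlt
    _ ≤ minRk t.F := Finset.le_inf fun g hg => WithTop.coe_le_coe.2 (hmin g hg)

lemma tripleLT_of_bodyReduced [Differential k] (ht : TripleInv t) (hf : f ∈ t.F)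
    {F' H' : Finset (DPoly k n)} (h : BodyReduced t f D F' H') :
    TripleLT (⟨F', D, H'⟩ : Triple k n) t :=
  .left _ _ <| keyAt_congr h.inv.image_rk ▸ keyAt_bodyC_lt (ht.not_isConst f hf) (ht.reduced f hf)

end Measure

section Weights

variable {k : Type*} [Field k] {n : ℕ} {S S' : Finset (DPoly k n)} {V : Finset (Fin n)}
  {y : Fin n}

/-- The weighted total order, in which the variables of `V` count `max 1 (n - |V|)` times: a drop in
the order of one of them may raise the orders of all the `n - |V|` others. -/
def weight (V : Finset (Fin n)) (S : Finset (DPoly k n)) : ℕ :=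
  ∑ y : Fin n, (if y ∈ V then max 1 (n - V.card) else 1) * maxOrd y S

lemma weight_empty (S : Finset (DPoly k n)) : weight ∅ S = totalOrd S := by
  simp [weight, totalOrd]

lemma totalOrd_le_weight (V : Finset (Fin n)) (S : Finset (DPoly k n)) :
    totalOrd S ≤ weight V S :=
  Finset.sum_le_sum fun y _ => Nat.le_mul_of_pos_left _ (by split_ifs <;> simp)

lemma weight_mono (V : Finset (Fin n)) (h : ∀ y, maxOrd y S ≤ maxOrd y S') :
    weight V S ≤ weight V S' :=
  Finset.sum_le_sum fun y _ => Nat.mul_le_mul_left _ (h y)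

lemma weight_eq_add_sum (hy : y ∈ V) (S : Finset (DPoly k n)) :
    weight V S = max 1 (n - V.card) * maxOrd y S +
      ∑ z ∈ V.erase y, max 1 (n - V.card) * maxOrd z S + ∑ z ∈ Vᶜ, maxOrd z S := by
  rw [weight, ← Finset.sum_add_sum_compl V,
    Finset.add_sum_erase V (fun z => max 1 (n - V.card) * maxOrd z S) hy]
  congr 1
  · exact Finset.sum_congr rfl fun z hz => by rw [if_pos hz]
  · exact Finset.sum_congr rfl fun z hz => by rw [if_neg (Finset.mem_compl.1 hz), one_mul]

lemma weight_le_weight_of_le_add {e : ℕ} (hy : y ∈ V) (he : e ≤ maxOrd y S)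
    (hye : maxOrd y S' ≤ e) (hV : ∀ z ∈ V, maxOrd z S' ≤ maxOrd z S)
    (hVc : ∀ z ∉ V, maxOrd z S' ≤ maxOrd z S + (maxOrd y S - e)) :
    weight V S' ≤ weight V S := by
  rw [weight_eq_add_sum hy, weight_eq_add_sum hy]
  have herase : ∑ z ∈ V.erase y, max 1 (n - V.card) * maxOrd z S' ≤
      ∑ z ∈ V.erase y, max 1 (n - V.card) * maxOrd z S :=
    Finset.sum_le_sum fun z hz => Nat.mul_le_mul_left _ (hV z (Finset.mem_of_mem_erase hz))
  have hcompl : ∑ z ∈ Vᶜ, maxOrd z S' ≤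
      ∑ z ∈ Vᶜ, maxOrd z S + max 1 (n - V.card) * (maxOrd y S - e) := calc
    _ ≤ ∑ z ∈ Vᶜ, (maxOrd z S + (maxOrd y S - e)) :=
      Finset.sum_le_sum fun z hz => hVc z (Finset.mem_compl.1 hz)
    _ = ∑ z ∈ Vᶜ, maxOrd z S + (n - V.card) * (maxOrd y S - e) := by
      rw [Finset.sum_add_distrib, Finset.sum_const, Finset.card_compl, Fintype.card_fin,
        smul_eq_mul]
    _ ≤ _ := Nat.add_le_add_left (Nat.mul_le_mul_right _ (le_max_right _ _)) _
  have hdrop : max 1 (n - V.card) * maxOrd y S' + max 1 (n - V.card) * (maxOrd y S - e) ≤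
      max 1 (n - V.card) * maxOrd y S := by
    rw [← mul_add]
    exact Nat.mul_le_mul_left _ (by lia)
  lia

/-- The factor by which the weight may have grown when `r` leading variables have been found. -/
def growth (n r : ℕ) : ℕ := ∏ i ∈ Finset.range r, max 1 (n - 1 - i)

lemma growth_succ (n r : ℕ) : growth n (r + 1) = growth n r * max 1 (n - 1 - r) :=
  Finset.prod_range_succ _ r

lemma growth_mul_factorial_le (n r : ℕ) :
    growth n r * (n - 1 - r).factorial ≤ (n - 1).factorial := by
  induction r with
  | zero => simp [growth]
  | succ r ih =>
    refine le_trans ?_ ih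
    rw [growth_succ, mul_assoc, ← Nat.sub_sub]
    refine Nat.mul_le_mul_left _ ?_
    cases n - 1 - r with
    | zero => simp
    | succ l => simp [Nat.factorial_succ]

lemma growth_le_factorial (n r : ℕ) : growth n r ≤ (n - 1).factorial :=
  (Nat.le_mul_of_pos_right _ (Nat.factorial_pos _)).trans (growth_mul_factorial_le n r)

lemma totalOrd_le_of_weight_le {M : ℕ} (h : weight V S ≤ growth n V.card * M) :
    totalOrd S ≤ (n - 1).factorial * M :=
  (totalOrd_le_weight V S).trans (h.trans (Nat.mul_le_mul_right _ (growth_le_factorial n _)))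

lemma weight_insert_le (hy : y ∉ V) (S : Finset (DPoly k n)) :
    weight (insert y V) S ≤ max 1 (n - 1 - V.card) * weight V S := by
  rw [weight, weight, Finset.mul_sum, Finset.card_insert_of_notMem hy, add_comm, ← Nat.sub_sub]
  refine Finset.sum_le_sum fun z _ => ?_
  rw [← mul_assoc]
  refine Nat.mul_le_mul_right _ ?_
  by_cases hz : z ∈ V
  · rw [if_pos (Finset.mem_insert_of_mem hz), if_pos hz]
    exact Nat.le_mul_of_pos_right _ (by simp)
  · rw [if_neg hz, mul_one]
    split_ifs <;> simp

lemma weight_insert_le_growth_mul {M : ℕ} (h : weight V S ≤ growth n V.card * M) (y : Fin n) :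
    weight (insert y V) S ≤ growth n (insert y V).card * M := by
  by_cases hy : y ∈ V
  · rwa [Finset.insert_eq_of_mem hy]
  · calc weight (insert y V) S ≤ max 1 (n - 1 - V.card) * weight V S := weight_insert_le hy S
      _ ≤ max 1 (n - 1 - V.card) * (growth n V.card * M) := Nat.mul_le_mul_left _ h
      _ = growth n (insert y V).card * M := by
        rw [Finset.card_insert_of_notMem hy, growth_succ]
        ring

variable [LinearOrder (Der n)] {t t' : Triple k n} {c f : DPoly k n} {u w : Der n}

lemma lvSet_bodyC (hu : ld f = u) : lvSet (bodyC t f) = insert u.var (lvSet t.C) := by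
  ext y
  rw [Finset.mem_insert, mem_lvSet, mem_lvSet]
  constructor
  · rintro ⟨c, hc, w, hw, rfl⟩
    rcases mem_bodyC.1 hc with hc | rfl
    · exact Or.inr ⟨c, hc.1, w, hw, rfl⟩
    · exact Or.inl (by rw [WithBot.coe_inj.1 (hw.symm.trans hu)])
  · intro h
    by_cases hy : y = u.var
    · exact ⟨f, self_mem_bodyC t f, u, hu, hy.symm⟩
    · obtain ⟨c, hc, w, hw, rfl⟩ := h.resolve_left hy
      refine ⟨c, mem_bodyC.2 (Or.inl ⟨hc, ?_⟩), w, hw, rfl⟩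
      rwa [lv_eq_var hw, lv_eq_var hu, Ne, WithBot.coe_inj]

lemma TripleInv.maxOrd_le_ord_of_ld_eq (hR : IsRanking n) (ht : TripleInv t) (hc : c ∈ t.C)
    (hw : ld c = w) : maxOrd w.var (t.F ∪ t.C ∪ t.H) ≤ w.ord := by
  have hpart : ∀ x ∈ t.F ∪ t.C ∪ t.H, PartReduced x c := by
    simp only [Finset.forall_mem_union]
    exact ⟨⟨fun x hx => (ht.reduced x hx c hc).1,
      fun x hx => ht.autoreduced.partReduced hR hx hc⟩, fun x hx => ht.partReduced x hx c hc⟩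
  exact maxOrd_le fun x hx _ hv hvar => (hpart x hx).ord_le hv hw hvar

/-- Of all the leaders of `C̄`, only the one of `f` may have an order less than the order of its
variable in the system, because the system is partially reduced w.r.t. `C`. -/
lemma TripleInv.sum_maxOrd_sub_ldOrd_bodyC (hR : IsRanking n) (ht : TripleInv t) (hf : f ∈ t.F)
    (hu : ld f = u) :
    ∑ y ∈ lvSet (bodyC t f), (maxOrd y (t.F ∪ t.C ∪ t.H) - ldOrd y (bodyC t f)) =
      maxOrd u.var (t.F ∪ t.C ∪ t.H) - u.ord := by
  have hA := ht.triangular_bodyC hf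
  rw [Finset.sum_eq_single_of_mem u.var (lvSet_bodyC hu ▸ Finset.mem_insert_self _ _),
    hA.ldOrd_eq (self_mem_bodyC t f) hu]
  intro y hy hne
  rw [lvSet_bodyC hu] at hy
  obtain ⟨c, hc, w, hw, rfl⟩ := mem_lvSet.1 ((Finset.mem_insert.1 hy).resolve_left hne)
  have hcA : c ∈ bodyC t f := mem_bodyC.2 (Or.inl ⟨hc, by
    rwa [lv_eq_var hw, lv_eq_var hu, Ne, WithBot.coe_inj]⟩)
  rw [hA.ldOrd_eq hcA hw]
  exact Nat.sub_eq_zero_of_le (ht.maxOrd_le_ord_of_ld_eq hR hc hw)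

lemma ReducedSystem.maxOrd_le_ldOrd [Differential k] {b : Fin n → ℕ}
    {A D F' G H H' : Finset (DPoly k n)} (h : ReducedSystem b A G H D F' H') (hA : Triangular A)
    (hy : y ∈ lvSet A) : maxOrd y (F' ∪ D ∪ H') ≤ ldOrd y A := by
  obtain ⟨c, hc, hcu⟩ := hA.exists_ld_eq_of_mem_lvSet hy
  obtain ⟨d, hd, hdu, -⟩ := exists_ld_eq_of_image_rk_eq h.inv.image_rk.symm hc hcu
  exact maxOrd_le fun x hx w hw hwy => (h.partReduced x hx d hd).ord_le hw hdu hwy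

lemma ReducedSystem.maxOrd_le_bound [Differential k] {b : Fin n → ℕ}
    {A D F' G H H' : Finset (DPoly k n)} (h : ReducedSystem b A G H D F' H') (y : Fin n) :
    maxOrd y (F' ∪ D ∪ H') ≤ b y :=
  maxOrd_le fun x hx _ hw hwy => hwy ▸ mem_supported.1 (h.bounded x hx) hw

lemma BodyReduced.weight_le_weight [Differential k] (hR : IsRanking n) (ht : TripleInv t)
    (hf : f ∈ t.F) {D F' H' : Finset (DPoly k n)} (h : BodyReduced t f D F' H') :
    weight (lvSet (bodyC t f)) (F' ∪ D ∪ H') ≤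
      weight (lvSet (bodyC t f)) (t.F ∪ t.C ∪ t.H) := by
  obtain ⟨u, hu⟩ := exists_ld_eq (ht.not_isConst f hf)
  have hA := ht.triangular_bodyC hf
  have hmem : u.var ∈ lvSet (bodyC t f) := lvSet_bodyC hu ▸ Finset.mem_insert_self _ _
  have hdrop : ∀ y ∈ lvSet (bodyC t f), maxOrd y (F' ∪ D ∪ H') ≤ ldOrd y (bodyC t f) :=
    fun y hy => h.maxOrd_le_ldOrd hA hy
  have hle : ∀ y ∈ lvSet (bodyC t f), ldOrd y (bodyC t f) ≤ maxOrd y (t.F ∪ t.C ∪ t.H) :=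
    fun y hy => hA.ldOrd_le_maxOrd (bodyC_subset hf) hy
  refine weight_le_weight_of_le_add hmem (hle _ hmem) (hdrop _ hmem)
    (fun y hy => (hdrop y hy).trans (hle y hy)) fun z hz => (h.maxOrd_le_bound z).trans_eq ?_
  rw [orderBound, if_neg hz, ht.sum_maxOrd_sub_ldOrd_bodyC hR hf hu,
    hA.ldOrd_eq (self_mem_bodyC t f) hu]

lemma BodyReduced.weight_le_growth_mul [Differential k] (hR : IsRanking n) (ht : TripleInv t)
    (hf : f ∈ t.F) {D F' H' : Finset (DPoly k n)} (h : BodyReduced t f D F' H') {M : ℕ}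
    (hM : weight (lvSet t.C) (t.F ∪ t.C ∪ t.H) ≤ growth n (lvSet t.C).card * M) :
    weight (lvSet D) (F' ∪ D ∪ H') ≤ growth n (lvSet D).card * M := by
  obtain ⟨u, hu⟩ := exists_ld_eq (ht.not_isConst f hf)
  have hweight := h.weight_le_weight hR ht hf
  rw [lvSet_bodyC hu] at hweight
  rw [lvSet_congr h.inv.image_rk, lvSet_bodyC hu]
  exact hweight.trans (weight_insert_le_growth_mul hM u.var)

lemma weight_le_weight_of_mem_split [CharZero k] (hf : f ∈ t.F) (hfc : ¬ IsConst f)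
    (h : t' ∈ split t f) (V : Finset (Fin n)) :
    weight V (t'.F ∪ t'.C ∪ t'.H) ≤ weight V (t.F ∪ t.C ∪ t.H) := by
  obtain ⟨x, hx, -, rfl⟩ := (mem_split_iff hfc).1 h
  refine weight_mono V fun y => maxOrd_le fun g hg w hw hwy => hwy ▸ ?_
  rw [Finset.insert_union, Finset.insert_union, Finset.mem_insert] at hg
  rcases hg with rfl | hg
  · exact le_maxOrd (by simp [hf]) (vars_subset_of_mem_initSep_singleton hx hw)
  · exact le_maxOrd hg hw

end Weights

section Run

variable {k : Type*} [Field k] {n : ℕ} [LinearOrder (Der n)] {M : ℕ} {t t' : Triple k n}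
  {f : DPoly k n}

/-- The invariant of a triple together with the bound on its weighted total order, where `M` is the
total order of the input of the algorithm. -/
structure BoundedTriple (M : ℕ) (t : Triple k n) : Prop where
  inv : TripleInv t
  weight_le : weight (lvSet t.C) (t.F ∪ t.C ∪ t.H) ≤ growth n (lvSet t.C).card * M

lemma BoundedTriple.of_mem_split [CharZero k] (ht : BoundedTriple M t) (hf : f ∈ t.F)
    (h : t' ∈ split t f) : BoundedTriple M t' := by
  have hfc := ht.inv.not_isConst f hf
  obtain ⟨x, -, -, rfl⟩ := (mem_split_iff hfc).1 h
  exact ⟨ht.inv.of_mem_split hf h, (weight_le_weight_of_mem_split hf hfc h _).trans ht.weight_le⟩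

variable [Differential k]

lemma ReducedSystem.tripleInv {b : Fin n → ℕ} {A D F' G H H' : Finset (DPoly k n)}
    (h : ReducedSystem b A G H D F' H') (hF : ∀ g ∈ F', ¬ IsConst g) (hne : F'.Nonempty) :
    TripleInv ⟨F', D, H'⟩ :=
  ⟨hne, hF, h.inv.autoreduced, h.reduced, h.regularSystem.2.1, h.regularSystem.2.2⟩

/-- The invariant of the **while**-loop: the ideal `I` is the intersection of the ideals described
by the regular systems found so far and by the triples still to be treated. -/
structure StateInv (I : Ideal (DPoly k n)) (M : ℕ) (s : State k n) : Prop where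
  triples : ∀ t ∈ s.U, BoundedTriple M t
  systems : ∀ p ∈ s.T,
    RegularSystem p.1 p.2 ∧ totalOrd (p.1 ∪ p.2) ≤ (n - 1).factorial * M
  ideal_eq : I =
    (⨅ p ∈ s.T, sat (diffIdeal (p.1 : Set (DPoly k n))) p.2) ⊓ ⨅ t ∈ s.U, tripleIdeal t

variable {I : Ideal (DPoly k n)} {s s' : State k n} {F₀ H₀ : Finset (DPoly k n)}
  {U₁ U' : Finset (Triple k n)} {T' : Finset (Finset (DPoly k n) × Finset (DPoly k n))}
  {p : Finset (DPoly k n) × Finset (DPoly k n)}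

lemma ReduceResult.boundedTriple (hR : IsRanking n) (ht : BoundedTriple M t) (hf : f ∈ t.F)
    (h : ReduceResult t f U₁ T') (ht' : t' ∈ U₁) : BoundedTriple M t' := by
  cases h with
  | proceed D F' H' h hF hne =>
    obtain rfl := Finset.mem_singleton.1 ht'
    exact ⟨h.tripleInv hF hne, h.weight_le_growth_mul hR ht.inv hf ht.weight_le⟩
  | discard | output => simp at ht'

lemma ReduceResult.tripleLT (ht : TripleInv t) (hf : f ∈ t.F) (h : ReduceResult t f U₁ T')
    (ht' : t' ∈ U₁) : TripleLT t' t := by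
  cases h with
  | proceed D F' H' h =>
    obtain rfl := Finset.mem_singleton.1 ht'
    exact tripleLT_of_bodyReduced ht hf h
  | discard | output => simp at ht'

lemma ReduceResult.regularSystem (h : ReduceResult t f U₁ T') (hp : p ∈ T') :
    RegularSystem p.1 p.2 := by
  cases h with
  | output D H' h =>
    obtain rfl := Finset.mem_singleton.1 hp
    exact h.regularSystem
  | discard | proceed => simp at hp

lemma ReduceResult.totalOrd_le (hR : IsRanking n) (ht : BoundedTriple M t) (hf : f ∈ t.F)
    (h : ReduceResult t f U₁ T') (hp : p ∈ T') :
    totalOrd (p.1 ∪ p.2) ≤ (n - 1).factorial * M := by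
  cases h with
  | output D H' h =>
    obtain rfl := Finset.mem_singleton.1 hp
    exact totalOrd_le_of_weight_le
      (Finset.empty_union D ▸ h.weight_le_growth_mul hR ht.inv hf ht.weight_le)
  | discard | proceed => simp at hp

lemma stateInv_start (hne : F₀.Nonempty) (hF₀ : ∀ f ∈ F₀, ¬ IsConst f) :
    StateInv (sat (radDiffIdeal (F₀ : Set (DPoly k n))) H₀) (totalOrd (F₀ ∪ H₀)) (start F₀ H₀) := by
  refine ⟨fun t ht => ?_, by simp [start], by simp [start, tripleIdeal]⟩
  obtain rfl := Finset.mem_singleton.1 ht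
  have hlv : lvSet (∅ : Finset (DPoly k n)) = ∅ := by simp [lvSet, ldSet]
  exact ⟨⟨hne, hF₀, ⟨by simp, by simp⟩, by simp, by simp, by simp [initSep]⟩,
    by simp [hlv, weight_empty, growth]⟩

lemma StateInv.exists_step (hR : IsRanking n) (hs : StateInv I M s) (hU : s.U.Nonempty) :
    ∃ s', Step s s' := by
  obtain ⟨t, ht⟩ := hU
  have hinv := (hs.triples t ht).inv
  obtain ⟨f, hf, hmin⟩ := Finset.exists_min_image t.F rk hinv.nonempty
  obtain ⟨U', T', hb⟩ := exists_body hR hinv hf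
  exact ⟨_, t, ht, f, hf, hmin, U', T', hb, rfl⟩

variable [CharZero k]

lemma Body.boundedTriple (hR : IsRanking n) (ht : BoundedTriple M t) (hf : f ∈ t.F)
    (hb : Body t f U' T') (ht' : t' ∈ U') : BoundedTriple M t' := by
  obtain ⟨U₁, hres, rfl⟩ := hb.reduceResult hR ht.inv hf
  rcases Finset.mem_union.1 ht' with h | h
  · exact hres.boundedTriple hR ht hf h
  · exact ht.of_mem_split hf h

lemma Body.tripleLT (hR : IsRanking n) (ht : TripleInv t) (hf : f ∈ t.F)
    (hmin : ∀ g ∈ t.F, rk f ≤ rk g) (hb : Body t f U' T') (ht' : t' ∈ U') : TripleLT t' t := by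
  obtain ⟨U₁, hres, rfl⟩ := hb.reduceResult hR ht hf
  rcases Finset.mem_union.1 ht' with h | h
  · exact hres.tripleLT ht hf h
  · exact tripleLT_of_mem_split (ht.not_isConst f hf) hmin h

lemma Body.tripleIdeal_eq (hR : IsRanking n) (ht : TripleInv t) (hf : f ∈ t.F)
    (hb : Body t f U' T') : tripleIdeal t =
      (⨅ p ∈ T', sat (diffIdeal (p.1 : Set (DPoly k n))) p.2) ⊓ ⨅ t' ∈ U', tripleIdeal t' := by
  obtain ⟨U₁, hres, rfl⟩ := hb.reduceResult hR ht hf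
  rw [tripleIdeal_eq_inf_split (ht.not_isConst f hf), hres.ideal_eq hR hf, Finset.iInf_union,
    inf_assoc]

lemma StateInv.step (hR : IsRanking n) (hs : StateInv I M s) (h : Step s s') :
    StateInv I M s' := by
  obtain ⟨t, ht, f, hf, -, U', T', hb, rfl⟩ := h
  have hbt := hs.triples t ht
  refine ⟨fun t' ht' => ?_, fun p hp => ?_, ?_⟩
  · rcases Finset.mem_union.1 ht' with h | h
    · exact hs.triples t' (Finset.mem_of_mem_erase h)
    · exact hb.boundedTriple hR hbt hf h
  · rcases Finset.mem_union.1 hp with h | h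
    · exact hs.systems p h
    · obtain ⟨U₁, hres, -⟩ := hb.reduceResult hR hbt.inv hf
      exact ⟨hres.regularSystem h, hres.totalOrd_le hR hbt hf h⟩
  · have hsU : ⨅ t' ∈ s.U, tripleIdeal t' = tripleIdeal t ⊓ ⨅ t' ∈ s.U.erase t, tripleIdeal t' := by
      rw [← Finset.iInf_insert, Finset.insert_erase ht]
    rw [hs.ideal_eq, hsU, hb.tripleIdeal_eq hR hbt.inv hf, Finset.iInf_union, Finset.iInf_union]
    ac_rfl

lemma StateInv.of_reachable (hR : IsRanking n) (hne : F₀.Nonempty)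
    (hF₀ : ∀ f ∈ F₀, ¬ IsConst f) (h : Reachable F₀ H₀ s) :
    StateInv (sat (radDiffIdeal (F₀ : Set (DPoly k n))) H₀) (totalOrd (F₀ ∪ H₀)) s := by
  induction h with
  | refl => exact stateInv_start hne hF₀
  | tail _ hstep ih => exact ih.step hR hstep

lemma StateInv.cutExpand (hR : IsRanking n) (hs : StateInv I M s) (h : Step s s') :
    Relation.CutExpand TripleLT s'.U.val s.U.val := by
  obtain ⟨t, ht, f, hf, hmin, U', T', hb, rfl⟩ := h
  refine ⟨(U' \ s.U.erase t).val, t, fun t' ht' =>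
    hb.tripleLT hR (hs.triples t ht).inv hf hmin (Finset.mem_sdiff.1 ht').1, ?_⟩
  have hunion : (s.U.erase t ∪ U').val = (s.U.erase t).val + (U' \ s.U.erase t).val := by
    rw [← Finset.union_sdiff_self_eq_union, ← Finset.disjUnion_eq_union _ _ Finset.disjoint_sdiff,
      Finset.disjUnion_val]
  have hinsert : s.U.val = {t} + (s.U.erase t).val := by
    rw [Finset.erase_val, Multiset.singleton_add, Multiset.cons_erase ht]
  rw [hunion, hinsert]
  abel

lemma not_exists_infinite_run (hR : IsRanking n) (hne : F₀.Nonempty)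
    (hF₀ : ∀ f ∈ F₀, ¬ IsConst f) :
    ¬ ∃ s : ℕ → State k n, s 0 = start F₀ H₀ ∧ ∀ i, Step (s i) (s (i + 1)) := by
  rintro ⟨s, h0, hstep⟩
  have hinv : ∀ i, StateInv (sat (radDiffIdeal (F₀ : Set (DPoly k n))) H₀)
      (totalOrd (F₀ ∪ H₀)) (s i) := fun i => by
    induction i with
    | zero => exact h0 ▸ stateInv_start hne hF₀
    | succ i ih => exact ih.step hR (hstep i)
  exact (wellFounded_iff_isEmpty_descending_chain.1 (wellFounded_tripleLT hR).cutExpand).false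
    ⟨fun i => (s i).U.val, fun i => (hinv i).cutExpand hR (hstep i)⟩

end Run

end DiffAlg

end

theorem mainTheorem6 {k : Type*} [Field k] [CharZero k] [Differential k] {n : ℕ}
    [LinearOrder (Der n)] (hR : IsRanking n) (F₀ H₀ : Finset (DPoly k n))
    (hne : F₀.Nonempty) (hF₀ : ∀ f ∈ F₀, ¬ IsConst f) :
    -- every run terminates
    (¬ ∃ s : ℕ → State k n, s 0 = start F₀ H₀ ∧ ∀ i, Step (s i) (s (i + 1))) ∧
    -- no run gets stuck before `U` is empty
    (∀ s : State k n, Reachable F₀ H₀ s → s.U.Nonempty → ∃ s', Step s s') ∧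
    -- the bound for all intermediate systems
    (∀ s : State k n, Reachable F₀ H₀ s → ∀ t ∈ s.U,
      totalOrd (t.F ∪ t.C ∪ t.H) ≤ (n - 1).factorial * totalOrd (F₀ ∪ H₀)) ∧
    -- the output is a regular decomposition of `{F₀} : H₀^∞` that satisfies the bound
    (∀ s : State k n, Reachable F₀ H₀ s → s.U = ∅ →
      (∀ p ∈ s.T, RegularSystem p.1 p.2) ∧
      sat (radDiffIdeal (F₀ : Set (DPoly k n))) H₀ =
        ⨅ p ∈ s.T, sat (diffIdeal (p.1 : Set (DPoly k n))) p.2 ∧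
      ∀ p ∈ s.T, totalOrd (p.1 ∪ p.2) ≤ (n - 1).factorial * totalOrd (F₀ ∪ H₀)) := by
  refine ⟨not_exists_infinite_run hR hne hF₀,
    fun s hs hU => (StateInv.of_reachable hR hne hF₀ hs).exists_step hR hU,
    fun s hs t ht => totalOrd_le_of_weight_le
      ((StateInv.of_reachable hR hne hF₀ hs).triples t ht).weight_le,
    fun s hs hU => ?_⟩
  have h := StateInv.of_reachable hR hne hF₀ hs
  refine ⟨fun p hp => (h.systems p hp).1, ?_, fun p hp => (h.systems p hp).2⟩
  simpa only [hU, Finset.notMem_empty, iInf_false, iInf_top, inf_top_eq] using h.ideal_eq
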